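/- Let $a_1,\dots,a_n$ be distinct points of the open unit disk and let $\rho_1,\dots,\rho_n\in\mathbb C$ with $|\rho_k|<1$. For radii $r_1,\dots,r_n>0$ put $r=\max_k r_k$ and $\nu_k=r_k^2/r^2\in(0,1]$. For small $r$ let $D$ be the open unit disk without the disjoint closed disks $|z-a_k|\le r_k$. A number $\lambda\in\mathbb C\setminus\{0\}$ is an eigenvalue if there are functions $\varphi$ on $D$, $\varphi_k$ on $|z-a_k|<r_k$ $(k=1,\dots,n)$ and $\varphi_0$ on $|z|>1$, analytic there and continuous in the closures, with $\varphi_0\not\equiv0$, $\varphi_0(\infty)=0$ and $$\varphi=\varphi_k-\rho_k\overline{\varphi_k}\ \text{ on } |t-a_k|=r_k\ (k=1,\dots,n),\qquad \varphi=\overline\lambda\,\varphi_0-\overline{\varphi_0}\ \text{ on } |t|=1 .$$ Let $F$ be the matrix with entries $F_{mk}=\overline{\rho_m}\,\nu_m/(1-\overline{a_m}a_k)^2$. A vector $v\ne0$ is called an eigenvector for $\mu$ if $\mu v_k=\sum_m F_{mk}v_m$ for all $k$. 1. For all $c,\varepsilon>0$ there is $\delta>0$, depending only on $c,\varepsilon$,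 the $a_k$ and the $\rho_k$, such that for all radii with $r<\delta$ every eigenvalue $\lambda$ with $|\lambda|\ge c\,r^2$ satisfies $|\lambda-r^2\mu|\le\varepsilon r^2$ for some $\mu\neq0$ with $\det(\mu I-F)=0$. From now on the $\nu_k$ are fixed (so $r_k=r\sqrt{\nu_k}$) and $r\to0$. 2. Suppose that $\det(\mu I-F)$ has at least one simple nonzero root, or that all $\rho_m$ are equal to one real number $\rho\ne0$. Then for every $\varepsilon>0$ and all sufficiently small $r$ an eigenvalue of largest modulus exists, and every eigenvalue $\lambda$ of largest modulus satisfies $|\lambda-r^2\mu|\le\varepsilon r^2$ for some $\mu\neq0$ with $\det(\mu I-F)=0$; that is, $\lambda=r^2\mu+o(r^2)$. 3. If all $\rho_m$ are equal to one real number $\rho$, then $F$ is self-adjoint with respect to the inner product $\sum_m\nu_m^{-1}u_m\overline{w_m}$ (so $F$ is Hermitian if all $\nu_m$ are equal), and $\det(\mu I-F)=0$ has exactly $n$ real roots counted with multiplicity, that is, $\det(\mu I-F)=\prod_{i=1}^n(\mu-x_i)$ with real $x_i$. 4. Let $\mu\ne0$ be a simple root of $\det(\mu I-F)=0$. For every eigenvector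 $v$ for $\mu$ there is a constant $C$ such that for all sufficiently small $r$ there are an eigenvalue $\lambda$ and corresponding functions $\varphi,\varphi_k,\varphi_0$ with $$|\lambda-r^2\mu|\le Cr^3,\qquad |\varphi_k'(a_k)-v_k|\le C r\|v\|\ (k=1,\dots,n),\qquad \Bigl|\overline\lambda\,\varphi_0(z)+r^2\sum_{m=1}^n\frac{\rho_m\nu_m}{z-a_m}\overline{v_m}\Bigr|\le C r^3\|v\|\quad(|z|\ge1),$$ where $\|v\|=\max_k|v_k|$. Conversely, there are $C,\eta>0$ such that for all sufficiently small $r$, whenever $\lambda$ is an eigenvalue with $|\lambda-r^2\mu|\le\eta r^2$ and $\varphi,\varphi_k,\varphi_0$ are corresponding functions, these estimates hold for some eigenvector $v$ for $\mu$. -/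

import Mathlib

open scoped ComplexConjugate Matrix

namespace RLinear

variable {n : ℕ}

/-- The perforated unit disk: the open unit disk without the closed disks of centres `a k` and
radii `R k`. -/
def perforatedDisk (a : Fin n → ℂ) (R : Fin n → ℝ) : Set ℂ :=
  {z | ‖z‖ < 1 ∧ ∀ k, R k < ‖z - a k‖}

/-- The closure of the perforated disk (for disjoint closed disks inside the unit disk). -/
def closedPerforatedDisk (a : Fin n → ℂ) (R : Fin n → ℝ) : Set ℂ :=
  {z | ‖z‖ ≤ 1 ∧ ∀ k, R k ≤ ‖z - a k‖}

/-- `(φ, φi, φ0)` solves the `ℝ`-linear problem with spectral parameter `lam`: all functions are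
analytic in their domains and continuous up to the boundary, `φ0` vanishes at infinity, and
`φ = φ_k - ρ_k conj φ_k` on the circle `|t - a_k| = R_k`, `φ = conj lam φ0 - conj φ0` on the unit
circle. -/
structure IsSolution (a : Fin n → ℂ) (R : Fin n → ℝ) (ρ : Fin n → ℂ) (lam : ℂ)
    (φ : ℂ → ℂ) (φi : Fin n → ℂ → ℂ) (φ0 : ℂ → ℂ) : Prop where
  analytic_matrix : DifferentiableOn ℂ φ (perforatedDisk a R)
  continuous_matrix : ContinuousOn φ (closedPerforatedDisk a R)
  analytic_inclusion : ∀ k, DifferentiableOn ℂ (φi k) (Metric.ball (a k) (R k))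
  continuous_inclusion : ∀ k, ContinuousOn (φi k) (Metric.closedBall (a k) (R k))
  analytic_exterior : DifferentiableOn ℂ φ0 {z | 1 < ‖z‖}
  continuous_exterior : ContinuousOn φ0 {z | 1 ≤ ‖z‖}
  vanishes_at_infinity : Filter.Tendsto φ0 (Filter.cocompact ℂ) (nhds 0)
  inclusion_condition : ∀ k, ∀ t ∈ Metric.sphere (a k) (R k),
    φ t = φi k t - ρ k * conj (φi k t)
  exterior_condition : ∀ t : ℂ, ‖t‖ = 1 → φ t = conj lam * φ0 t - conj (φ0 t)

/-- A solution for a nonzero spectral parameter whose exterior component `φ0` (the eigenfunction)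
is not identically zero. -/
def IsEigensolution (a : Fin n → ℂ) (R : Fin n → ℝ) (ρ : Fin n → ℂ) (lam : ℂ)
    (φ : ℂ → ℂ) (φi : Fin n → ℂ → ℂ) (φ0 : ℂ → ℂ) : Prop :=
  lam ≠ 0 ∧ IsSolution a R ρ lam φ φi φ0 ∧ ∃ z : ℂ, 1 ≤ ‖z‖ ∧ φ0 z ≠ 0

/-- `lam` is an eigenvalue of the `ℝ`-linear problem. -/
def IsEigenvalue (a : Fin n → ℂ) (R : Fin n → ℝ) (ρ : Fin n → ℂ) (lam : ℂ) : Prop :=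
  ∃ φ φi φ0, IsEigensolution a R ρ lam φ φi φ0

/-- An eigenvalue of largest modulus. -/
def IsMaxEigenvalue (a : Fin n → ℂ) (R : Fin n → ℝ) (ρ : Fin n → ℂ) (lam : ℂ) : Prop :=
  IsEigenvalue a R ρ lam ∧ ∀ lam', IsEigenvalue a R ρ lam' → ‖lam'‖ ≤ ‖lam‖

/-- The possible values of `ν_k = r_k ^ 2 / r ^ 2`, where `r = max r_k` and all `r_k > 0`. -/
def IsRatio (ν : Fin n → ℝ) : Prop :=
  (∀ k, 0 < ν k ∧ ν k ≤ 1) ∧ ∃ k, ν k = 1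

/-- The radii `r_k` with maximum `r` and `r_k ^ 2 / r ^ 2 = ν_k`. -/
noncomputable def radii (ν : Fin n → ℝ) (r : ℝ) : Fin n → ℝ :=
  fun k => r * Real.sqrt (ν k)

/-- The matrix `F_{mk} = conj ρ_m ν_m / (1 - conj a_m a_k) ^ 2`. -/
noncomputable def matF (a : Fin n → ℂ) (ρ : Fin n → ℂ) (ν : Fin n → ℝ) :
    Matrix (Fin n) (Fin n) ℂ :=
  Matrix.of fun m k => conj (ρ m) * (ν m : ℂ) / (1 - conj (a m) * a k) ^ 2

/-- `μ` is a root of `det (μ I - F) = 0`. -/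
def IsRootF (a : Fin n → ℂ) (ρ : Fin n → ℂ) (ν : Fin n → ℝ) (μ : ℂ) : Prop :=
  (μ • (1 : Matrix (Fin n) (Fin n) ℂ) - matF a ρ ν).det = 0

/-- `μ` is a nonzero root of `det (μ I - F) = 0` of multiplicity one. -/
def IsSimpleNonzeroRootF (a : Fin n → ℂ) (ρ : Fin n → ℂ) (ν : Fin n → ℝ) (μ : ℂ) : Prop :=
  μ ≠ 0 ∧ (matF a ρ ν).charpoly.rootMultiplicity μ = 1

/-- `v` is a nonzero solution of the system `μ v_k = ∑ m, F_{mk} v_m`. -/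
def IsEigenvectorF (a : Fin n → ℂ) (ρ : Fin n → ℂ) (ν : Fin n → ℝ) (μ : ℂ)
    (v : Fin n → ℂ) : Prop :=
  v ≠ 0 ∧ ∀ k, μ * v k = ∑ m, matF a ρ ν m k * v m

/-- The leading-order relations, with constant `C`, between an eigenvalue with its eigenfunctions
and the pair `(μ, v)`. -/
def LeadingOrder (a : Fin n → ℂ) (ρ : Fin n → ℂ) (ν : Fin n → ℝ) (μ : ℂ) (v : Fin n → ℂ)
    (C r : ℝ) (lam : ℂ) (φi : Fin n → ℂ → ℂ) (φ0 : ℂ → ℂ) : Prop :=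
  ‖lam - (r : ℂ) ^ 2 * μ‖ ≤ C * r ^ 3 ∧
  (∀ k, ‖deriv (φi k) (a k) - v k‖ ≤ C * r * ‖v‖) ∧
  ∀ z : ℂ, 1 ≤ ‖z‖ →
    ‖conj lam * φ0 z - -((r : ℂ) ^ 2 * ∑ m, ρ m * (ν m : ℂ) / (z - a m) * conj (v m))‖
      ≤ C * r ^ 3 * ‖v‖

end RLinear

namespace RLinear

open scoped BoundedContinuousFunction

open Metric Set Filter Topology

variable {n : ℕ}

/-! On each circle the conjugate of an analytic function is the boundary value of its reflection.
Adding the reflected functions `circleReflection` and `unitReflection` to `φ` gives pieces in the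
perforated disk, in the inclusions and outside that match on all circles. Circles are removable for
continuous functions, so the pieces form an entire function vanishing at infinity, which is zero by
Liouville (`glue_eq_zero`). The outer identity expresses `φ0` through the `φ_k`; substituting its
reflection into the inner identities leaves equations for the `φ_k` alone.

Write `φ_k(a_k + R_k w) = φ_k(a_k) + R_k ∑ d (k, j) w ^ (j + 1)`. Differentiating and comparing
coefficients gives `CoeffEq`: the antilinear matrix `reflMat` comes from reflections between
inclusions, the linear matrix `bergMat` from reflection in an inclusion followed by the unit circle.
The latter is the Bergman kernel `(1 - conj w z)⁻²` expanded at the centres, and its entries of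
index `(0, 0)` are `r ^ 2 F`. All other entries are smaller by a power of the radii. With `lam = r ^
2 κ` the equations therefore say that `d` is in the kernel of `κ (1 + A) - J Fᵀ Q - G`, where `Q`
takes the leading coefficients, `J` embeds them, and `‖A‖, ‖G‖ = O(r)`
(`Separated.exists_realizes`). As `A` involves conjugation, everything is only real-linear.

If `|κ| ≥ c`, a kernel element is dominated by its leading coefficients, which nearly solve `κ u =
Fᵀ u` (`pencil_kernel_estimates`). Hence `det (κ - F)` is small and `κ` is close to a root;
compactness in the ratios gives uniformity (`exists_root_near`).

Near a simple root `μ ≠ 0` the linearization in the parameter and the coefficients is surjective,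
because the left eigenvector is not orthogonal to the right one. A quantitative surjection theorem
then produces a kernel at distance `O(r)` (`exists_pencil_kernel`), and pairing with the left
eigenvector gives the converse (`pencil_kernel_near_eigenvector`).

A Schur complement reduces the kernel problem with `|κ| ≥ c` to a continuous family of operators on
the leading coefficients, so a kernel parameter of largest modulus exists by compactness once there
is any (`exists_max_kernel`). For equal real contrasts the reduced operators at real `κ` are
symmetric for a weighted real inner product. The form changes from indefinite or negative to
positive definite as `|κ|` grows, and at the last parameter where it is not positive definite it has
a kernel (`exists_kernel_of_forms`); no simplicity of roots is needed. -/

/-! ### Removability of circles -/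

/-- Cauchy's theorem on the annulus moves the integral to the circle of radius `R`, and Cauchy's
theorem in the disk makes it vanish there. Both versions need continuity up to the boundary only and
allow the exceptional point `w`. -/
theorem circleIntegral_dslope_eq_zero {f : ℂ → ℂ} {c w : ℂ} {R R₂ : ℝ} (hR : 0 < R) (hRR : R < R₂)
    (hc : ContinuousOn f (closedBall c R₂)) (hin : ∀ z ∈ ball c R, DifferentiableAt ℂ f z)
    (hout : ∀ z, R < dist z c → dist z c < R₂ → DifferentiableAt ℂ f z)
    (hw : w ∈ ball c R₂) (hfw : DifferentiableAt ℂ f w) :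
    (∮ z in C(c, R₂), dslope f w z) = 0 := by
  have hcont : ContinuousOn (dslope f w) (closedBall c R₂) :=
    (continuousOn_dslope (closedBall_mem_nhds_of_mem hw)).2 ⟨hc, hfw⟩
  rw [Complex.circleIntegral_eq_of_differentiable_on_annulus_off_countable hR hRR.le
    (countable_singleton w) (hcont.mono sdiff_subset) ?_]
  · refine Complex.circleIntegral_eq_zero_of_differentiable_on_off_countable hR.le
      (countable_singleton w) (hcont.mono (closedBall_subset_closedBall hRR.le)) ?_
    rintro z ⟨hz, hzw⟩
    exact (differentiableAt_dslope_of_ne hzw).2 (hin z hz)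
  · rintro z ⟨⟨hz1, hz2⟩, hzw⟩
    exact (differentiableAt_dslope_of_ne hzw).2 (hout z (by simpa using hz2) (by simpa using hz1))

theorem cauchy_integral_eq_of_circle {f : ℂ → ℂ} {c w : ℂ} {R R₂ : ℝ} (hR : 0 < R) (hRR : R < R₂)
    (hc : ContinuousOn f (closedBall c R₂)) (hin : ∀ z ∈ ball c R, DifferentiableAt ℂ f z)
    (hout : ∀ z, R < dist z c → dist z c < R₂ → DifferentiableAt ℂ f z)
    (hw : w ∈ ball c R₂) (hfw : DifferentiableAt ℂ f w) :
    ((2 * Real.pi * Complex.I : ℂ)⁻¹ • ∮ z in C(c, R₂), (z - w)⁻¹ • f z) = f w := by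
  have h0 := circleIntegral_dslope_eq_zero hR hRR hc hin hout hw hfw
  have hne : ∀ z ∈ sphere c R₂, z ≠ w := fun z hz h => by
    subst h; exact (mem_ball.1 hw).ne (mem_sphere.1 hz)
  have hR₂ : 0 < R₂ := hR.trans hRR
  have hci : ContinuousOn (fun z => (z - w)⁻¹) (sphere c R₂) :=
    ContinuousOn.inv₀ (by fun_prop) fun z hz => sub_ne_zero.2 (hne z hz)
  have h1 : (∮ z in C(c, R₂), dslope f w z) =
      ∮ z in C(c, R₂), ((z - w)⁻¹ • f z - (z - w)⁻¹ • f w) := by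
    refine circleIntegral.integral_congr hR₂.le fun z hz => ?_
    rw [dslope_of_ne _ (hne z hz), slope_def_module, smul_sub]
  rw [h1, circleIntegral.integral_sub, circleIntegral.integral_smul_const,
    circleIntegral.integral_sub_inv_of_mem_ball hw, sub_eq_zero] at h0
  · rw [h0, inv_smul_smul₀ Complex.two_pi_I_ne_zero]
  · exact (hci.smul (hc.mono sphere_subset_closedBall)).circleIntegrable hR₂.le
  · exact (hci.smul continuousOn_const).circleIntegrable hR₂.le

/-- A circle is removable for continuous functions. -/
theorem differentiableOn_ball_of_circle {f : ℂ → ℂ} {c : ℂ} {R R₂ : ℝ} (hR : 0 < R) (hRR : R < R₂)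
    (hc : ContinuousOn f (closedBall c R₂)) (hin : ∀ z ∈ ball c R, DifferentiableAt ℂ f z)
    (hout : ∀ z, R < dist z c → dist z c < R₂ → DifferentiableAt ℂ f z) :
    DifferentiableOn ℂ f (ball c R₂) := by
  have hR₂ : 0 < R₂ := hR.trans hRR
  set F : ℂ → ℂ := fun w => (2 * Real.pi * Complex.I : ℂ)⁻¹ • ∮ z in C(c, R₂), (z - w)⁻¹ • f z
  have hF : DifferentiableOn ℂ F (ball c R₂) := by
    have := (hasFPowerSeriesOn_cauchy_integral (R := ⟨R₂, hR₂.le⟩)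
      ((hc.mono sphere_subset_closedBall).circleIntegrable hR₂.le) hR₂).differentiableOn
    exact this.mono (Metric.eball_coe (ε := ⟨R₂, hR₂.le⟩)).ge
  -- The Cauchy integral over the large circle is analytic across the inner one and equals `f` off
  -- it; density and continuity extend the equality to the circle.
  have heq : EqOn f F (ball c R₂ ∩ (sphere c R)ᶜ) := by
    rintro w ⟨hw, hwR⟩
    refine (cauchy_integral_eq_of_circle hR hRR hc hin hout hw ?_).symm
    rcases lt_or_gt_of_ne (show dist w c ≠ R from hwR) with h | h
    · exact hin w h
    · exact hout w h hw
  have hd : Dense (sphere c R)ᶜ := by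
    rw [← interior_eq_empty_iff_dense_compl, interior_sphere _ hR.ne']
  have := heq.of_subset_closure (hc.mono ball_subset_closedBall) hF.continuousOn inter_subset_left
    (hd.open_subset_closure_inter isOpen_ball)
  exact hF.congr this

/-! ### Reflections, gluing and the functional equations -/

/-- The closed disks of centres `a k` and radii `R k` are disjoint and lie in the unit disk. -/
structure Admissible (a : Fin n → ℂ) (R : Fin n → ℝ) : Prop where
  pos : ∀ k, 0 < R k
  lt_one : ∀ k, ‖a k‖ + R k < 1
  disjoint : ∀ k m, k ≠ m → R k + R m < ‖a k - a m‖

/-- The function `f` reflected in the circle `|z - a| = R`, normalized to vanish at infinity. -/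
noncomputable def circleReflection (a : ℂ) (R : ℝ) (f : ℂ → ℂ) (z : ℂ) : ℂ :=
  conj (f (a + (R : ℂ) ^ 2 / conj (z - a))) - conj (f a)

/-- The function `f`, vanishing at infinity, reflected in the unit circle. -/
noncomputable def unitReflection (f : ℂ → ℂ) (z : ℂ) : ℂ :=
  if z = 0 then 0 else conj (f (conj z)⁻¹)

theorem norm_reflected_point {a z : ℂ} {R : ℝ} :
    ‖a + (R : ℂ) ^ 2 / conj (z - a) - a‖ = R ^ 2 / ‖z - a‖ := by
  rw [add_sub_cancel_left, norm_div, RCLike.norm_conj, norm_pow, Complex.norm_real,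
    Real.norm_eq_abs, sq_abs]

theorem circleReflection_continuousOn {a : ℂ} {R : ℝ} (hR : 0 < R) {f : ℂ → ℂ}
    (hf : ContinuousOn f (closedBall a R)) :
    ContinuousOn (circleReflection a R f) {z | R ≤ ‖z - a‖} := by
  refine ContinuousOn.sub ?_ continuousOn_const
  refine Complex.continuous_conj.comp_continuousOn (hf.comp ?_ ?_)
  · refine continuousOn_const.add (continuousOn_const.div (by fun_prop) ?_)
    intro z hz
    have : z - a ≠ 0 := norm_pos_iff.1 (hR.trans_le hz)
    exact (map_ne_zero _).2 this
  · intro z hz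
    have hz : R ≤ ‖z - a‖ := hz
    rw [mem_closedBall, dist_eq_norm, norm_reflected_point, div_le_iff₀ (hR.trans_le hz), sq]
    gcongr

theorem circleReflection_differentiableAt {a : ℂ} {R : ℝ} (hR : 0 < R) {f : ℂ → ℂ}
    (hf : DifferentiableOn ℂ f (ball a R)) {z : ℂ} (hz : R < ‖z - a‖) :
    DifferentiableAt ℂ (circleReflection a R f) z := by
  refine DifferentiableAt.sub ?_ (differentiableAt_const _)
  have hza : z - a ≠ 0 := norm_pos_iff.1 (hR.trans hz)
  have hw : DifferentiableAt ℂ f (a + (R : ℂ) ^ 2 / conj (z - a)) := by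
    refine hf.differentiableAt (isOpen_ball.mem_nhds ?_)
    rw [mem_ball, dist_eq_norm, norm_reflected_point, div_lt_iff₀ (hR.trans hz), sq]
    gcongr
  have h1 : DifferentiableAt ℂ (conj ∘ f ∘ conj) (conj (a + (R : ℂ) ^ 2 / conj (z - a))) :=
    hw.conj_conj
  have h2 : DifferentiableAt ℂ (fun z => conj a + (R : ℂ) ^ 2 / (z - a)) z := by
    fun_prop (disch := exact hza)
  have h3 : conj (a + (R : ℂ) ^ 2 / conj (z - a)) = conj a + (R : ℂ) ^ 2 / (z - a) := by
    simp
  rw [h3] at h1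
  have := DifferentiableAt.comp z h1 h2
  refine this.congr_of_eventuallyEq (Eventually.of_forall fun w => ?_)
  simp

theorem circleReflection_tendsto {a : ℂ} {R : ℝ} (hR : 0 < R) {f : ℂ → ℂ}
    (hf : DifferentiableOn ℂ f (ball a R)) :
    Tendsto (circleReflection a R f) (cocompact ℂ) (𝓝 0) := by
  have hfa : ContinuousAt f a :=
    (hf.differentiableAt (isOpen_ball.mem_nhds (mem_ball_self hR))).continuousAt
  have h1 : Tendsto (fun z : ℂ => a + (R : ℂ) ^ 2 / conj (z - a)) (cocompact ℂ) (𝓝 a) := by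
    have h3 : Tendsto (fun z : ℂ => conj (z - a)) (cocompact ℂ) (cocompact ℂ) :=
      (((Homeomorph.subRight a).trans Complex.conjCLE.toHomeomorph).isClosedEmbedding).tendsto_cocompact
    have h2 := ((tendsto_inv₀_cobounded (α := ℂ)).comp
      (h3.mono_right (Metric.cobounded_eq_cocompact (α := ℂ)).ge)).const_mul ((R : ℂ) ^ 2)
    simpa [div_eq_mul_inv] using h2.const_add a
  have h2 : Tendsto (circleReflection a R f) (cocompact ℂ) (𝓝 (conj (f a) - conj (f a))) :=
    ((Complex.continuous_conj.tendsto _).comp (hfa.tendsto.comp h1)).sub_const _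
  simpa using h2

/-- Away from `0` this is a composition with two conjugations. The origin is a removable singularity
because `f` tends to `0` at infinity, which is the value assigned there. -/
theorem unitReflection_differentiableAt {f : ℂ → ℂ} (hf : DifferentiableOn ℂ f {z | 1 < ‖z‖})
    (h0 : Tendsto f (cocompact ℂ) (𝓝 0)) {z : ℂ} (hz : ‖z‖ < 1) :
    DifferentiableAt ℂ (unitReflection f) z := by
  have hopen : IsOpen {z : ℂ | 1 < ‖z‖} := isOpen_lt continuous_const continuous_norm
  suffices DifferentiableOn ℂ (unitReflection f) (ball 0 1) from
    this.differentiableAt (isOpen_ball.mem_nhds (by simpa using hz))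
  rw [← Complex.differentiableOn_compl_singleton_and_continuousAt_iff (c := 0)
    (isOpen_ball.mem_nhds (mem_ball_self one_pos))]
  constructor
  · rintro w ⟨hw, hw0⟩
    have hw0 : w ≠ 0 := hw0
    refine DifferentiableAt.differentiableWithinAt ?_
    have h1 : DifferentiableAt ℂ f (conj w)⁻¹ := by
      refine hf.differentiableAt (hopen.mem_nhds ?_)
      rw [mem_ofPred, norm_inv, RCLike.norm_conj]
      exact (one_lt_inv₀ (norm_pos_iff.2 hw0)).2 (by simpa using hw)
    have h2 : DifferentiableAt ℂ (conj ∘ f ∘ conj) (w⁻¹) := by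
      have := h1.conj_conj
      simpa using this
    have h3 := DifferentiableAt.comp w h2 (differentiableAt_inv hw0)
    refine h3.congr_of_eventuallyEq ?_
    filter_upwards [isOpen_ne.mem_nhds hw0] with u hu
    simp [unitReflection, if_neg hu]
  · have h1 : Tendsto (fun z : ℂ => (conj z)⁻¹) (𝓝[≠] 0) (cocompact ℂ) := by
      rw [← Metric.cobounded_eq_cocompact]
      refine (tendsto_inv₀_nhdsNE_zero (α := ℂ)).comp ?_
      refine tendsto_nhdsWithin_of_tendsto_nhds_of_eventually_within _ ?_ ?_
      · have := (Complex.continuous_conj.tendsto 0).mono_left (nhdsWithin_le_nhds (s := {0}ᶜ))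
        simpa using this
      · filter_upwards [self_mem_nhdsWithin] with z hz
        simpa using hz
    have h2 : Tendsto (unitReflection f) (𝓝[≠] 0) (𝓝 0) := by
      have := (Complex.continuous_conj.tendsto 0).comp (h0.comp h1)
      rw [map_zero] at this
      refine this.congr' ?_
      filter_upwards [self_mem_nhdsWithin] with z hz
      simp only [unitReflection, if_neg (show z ≠ 0 from hz), Function.comp]
    rw [continuousAt_iff_punctured_nhds]
    simpa [unitReflection] using h2

theorem unitReflection_continuousOn {f : ℂ → ℂ} (hf : DifferentiableOn ℂ f {z | 1 < ‖z‖})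
    (hc : ContinuousOn f {z | 1 ≤ ‖z‖}) (h0 : Tendsto f (cocompact ℂ) (𝓝 0)) :
    ContinuousOn (unitReflection f) (closedBall 0 1) := by
  intro z hz
  rcases eq_or_ne z 0 with rfl | hz0
  · exact (unitReflection_differentiableAt hf h0 (by simp)).continuousAt.continuousWithinAt
  · have h1 : ContinuousOn (fun z => conj (f (conj z)⁻¹)) (closedBall (0 : ℂ) 1 ∩ {0}ᶜ) := by
      refine Complex.continuous_conj.comp_continuousOn (hc.comp ?_ ?_)
      · refine ContinuousOn.inv₀ (by fun_prop) ?_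
        rintro w ⟨_, hw⟩
        simpa using hw
      · rintro w ⟨hw, hw0⟩
        rw [mem_ofPred, norm_inv, RCLike.norm_conj]
        exact (one_le_inv₀ (norm_pos_iff.2 hw0)).2 (by simpa using hw)
    have h2 : ContinuousOn (unitReflection f) (closedBall (0 : ℂ) 1 ∩ {0}ᶜ) :=
      h1.congr fun w hw => by
        simp only [unitReflection, if_neg (show w ≠ 0 from hw.2)]
    exact (h2 z ⟨hz, hz0⟩).mono_of_mem_nhdsWithin
      (inter_mem self_mem_nhdsWithin (mem_nhdsWithin_of_mem_nhds (isOpen_ne.mem_nhds hz0)))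

theorem circleReflection_of_norm_eq {a t : ℂ} {R : ℝ} (hR : 0 < R) {f : ℂ → ℂ}
    (ht : ‖t - a‖ = R) : circleReflection a R f t = conj (f t) - conj (f a) := by
  have hta : t - a ≠ 0 := norm_pos_iff.1 (ht ▸ hR)
  have : (R : ℂ) ^ 2 / conj (t - a) = t - a := by
    rw [div_eq_iff ((map_ne_zero _).2 hta), Complex.mul_conj, Complex.normSq_eq_norm_sq, ht]
    push_cast; rfl
  rw [circleReflection, this, add_sub_cancel]

theorem unitReflection_of_norm_eq {t : ℂ} {f : ℂ → ℂ} (ht : ‖t‖ = 1) :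
    unitReflection f t = conj (f t) := by
  have h0 : t ≠ 0 := norm_pos_iff.1 (ht ▸ one_pos)
  have : (conj t)⁻¹ = t := by
    rw [inv_eq_iff_eq_inv, Complex.inv_def, Complex.normSq_eq_norm_sq, ht]; simp
  rw [unitReflection, if_neg h0, this]

theorem Admissible.norm_sub_lt {a : Fin n → ℂ} {R : Fin n → ℝ} (h : Admissible a R) {k m : Fin n}
    (hkm : m ≠ k) {z : ℂ} (hz : ‖z - a k‖ ≤ R k) : R m < ‖z - a m‖ := by
  have h1 := h.disjoint m k hkm
  have h2 := norm_sub_le_norm_sub_add_norm_sub (a m) z (a k)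
  rw [norm_sub_rev (a m) z] at h2
  linarith

theorem Admissible.norm_lt_one {a : Fin n → ℂ} {R : Fin n → ℝ} (h : Admissible a R) {k : Fin n}
    {z : ℂ} (hz : ‖z - a k‖ ≤ R k) : ‖z‖ < 1 := by
  have h1 := h.lt_one k
  have h2 := norm_le_norm_sub_add z (a k)
  linarith

theorem Admissible.lt_norm_sub {a : Fin n → ℂ} {R : Fin n → ℝ} (h : Admissible a R) (k : Fin n)
    {z : ℂ} (hz : 1 ≤ ‖z‖) : R k < ‖z - a k‖ := by
  by_contra! h1
  exact absurd (h.norm_lt_one h1) (not_lt.2 hz)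

theorem continuous_of_cover {f : ℂ → ℂ} {ι : Type*} [Finite ι] {s : ι → Set ℂ}
    (hcl : ∀ i, IsClosed (s i)) (hcov : ∀ z, ∃ i, z ∈ s i) (hf : ∀ i, ContinuousOn f (s i)) :
    Continuous f :=
  (locallyFinite_of_finite s).continuous (iUnion_eq_univ_iff.2 hcov) hcl hf

theorem isOpen_perforatedDisk (a : Fin n → ℂ) (R : Fin n → ℝ) : IsOpen (perforatedDisk a R) := by
  have : perforatedDisk a R = {z | ‖z‖ < 1} ∩ ⋂ k, {z | R k < ‖z - a k‖} := by
    ext z; simp [perforatedDisk]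
  rw [this]
  exact (isOpen_lt continuous_norm continuous_const).inter
    (isOpen_iInter_of_finite fun k => isOpen_lt continuous_const (by fun_prop))

theorem isClosed_closedPerforatedDisk (a : Fin n → ℂ) (R : Fin n → ℝ) :
    IsClosed (closedPerforatedDisk a R) := by
  have : closedPerforatedDisk a R = {z | ‖z‖ ≤ 1} ∩ ⋂ k, {z | R k ≤ ‖z - a k‖} := by
    ext z; simp [closedPerforatedDisk]
  rw [this]
  exact (isClosed_le continuous_norm continuous_const).inter
    (isClosed_iInter fun k => isClosed_le continuous_const (by fun_prop))

/-- Supplies the outer radius required by `differentiableOn_ball_of_circle` around an inclusion. -/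
theorem Admissible.exists_annulus {a : Fin n → ℂ} {R : Fin n → ℝ} (h : Admissible a R)
    (k : Fin n) : ∃ R₂, R k < R₂ ∧ ∀ z, R k < dist z (a k) → dist z (a k) < R₂ →
      z ∈ perforatedDisk a R := by
  have h1 : ∀ᶠ S in 𝓝[>] (R k), ‖a k‖ + S < 1 :=
    (((continuous_const.add continuous_id).tendsto (R k)).mono_left
      nhdsWithin_le_nhds).eventually (gt_mem_nhds (h.lt_one k))
  have h2 : ∀ᶠ S in 𝓝[>] (R k), ∀ m, m ≠ k → S + R m < ‖a k - a m‖ := by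
    rw [eventually_all]
    intro m
    by_cases hm : m = k
    · simp [hm]
    · filter_upwards [(((continuous_id.add continuous_const).tendsto (R k)).mono_left
        nhdsWithin_le_nhds).eventually (gt_mem_nhds (h.disjoint k m (Ne.symm hm)))] with S hS _
      exact hS
  obtain ⟨S, hS1, hS2, hS3⟩ := (h1.and (h2.and self_mem_nhdsWithin)).exists
  refine ⟨S, hS3, fun z hz1 hz2 => ⟨?_, fun m => ?_⟩⟩
  · rw [dist_eq_norm] at hz2
    have := norm_le_norm_sub_add z (a k)
    linarith
  · by_cases hm : m = k
    · rwa [hm, ← dist_eq_norm]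
    · have h3 := hS2 m hm
      have h4 := norm_sub_le_norm_sub_add_norm_sub (a k) z (a m)
      rw [norm_sub_rev (a k) z] at h4
      rw [dist_eq_norm] at hz2
      linarith

/-- A function glued from pieces analytic in the perforated disk, in the removed disks and in the
exterior, and agreeing on the circles, vanishes identically if it vanishes at infinity. -/
theorem glue_eq_zero {a : Fin n → ℂ} {R : Fin n → ℝ} (h : Admissible a R)
    {M E : ℂ → ℂ} {I : Fin n → ℂ → ℂ}
    (hM : DifferentiableOn ℂ M (perforatedDisk a R))
    (hMc : ContinuousOn M (closedPerforatedDisk a R))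
    (hI : ∀ k, DifferentiableOn ℂ (I k) (ball (a k) (R k)))
    (hIc : ∀ k, ContinuousOn (I k) (closedBall (a k) (R k)))
    (hE : DifferentiableOn ℂ E {z | 1 < ‖z‖}) (hEc : ContinuousOn E {z | 1 ≤ ‖z‖})
    (hE0 : Tendsto E (cocompact ℂ) (𝓝 0))
    (hMI : ∀ k, ∀ t, ‖t - a k‖ = R k → M t = I k t) (hME : ∀ t, ‖t‖ = 1 → M t = E t) :
    (∀ k, ∀ z ∈ closedBall (a k) (R k), I k z = 0) ∧ ∀ z, 1 ≤ ‖z‖ → E z = 0 := by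
  classical
  set Φ : ℂ → ℂ := fun z => if 1 ≤ ‖z‖ then E z else
    if hk : ∃ k, ‖z - a k‖ ≤ R k then I hk.choose z else M z with hΦ
  have hΦE : EqOn Φ E {z | 1 ≤ ‖z‖} := fun z hz => by
    rw [hΦ]; exact if_pos hz
  have hΦI : ∀ k, EqOn Φ (I k) (closedBall (a k) (R k)) := by
    intro k z hz
    rw [mem_closedBall, dist_eq_norm] at hz
    have hk : ∃ k, ‖z - a k‖ ≤ R k := ⟨k, hz⟩
    have hkk : hk.choose = k := by
      by_contra hne
      exact absurd hk.choose_spec (not_le.2 (h.norm_sub_lt hne hz))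
    simp only [hΦ, if_neg (not_le.2 (h.norm_lt_one hz)), dif_pos hk]
    rw [hkk]
  have hΦM : EqOn Φ M (closedPerforatedDisk a R) := by
    rintro z ⟨hz1, hz2⟩
    by_cases h1 : 1 ≤ ‖z‖
    · rw [hΦE h1, hME z (le_antisymm hz1 h1)]
    · by_cases h2 : ∃ k, ‖z - a k‖ ≤ R k
      · obtain ⟨k, hk⟩ := h2
        rw [hΦI k (by simpa [dist_eq_norm] using hk), hMI k z (le_antisymm hk (hz2 k))]
      · simp only [hΦ, if_neg h1, dif_neg h2]
  have hcont : Continuous Φ := by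
    refine continuous_of_cover (ι := Bool ⊕ Fin n) (s := Sum.elim
      (fun b => if b then {z | 1 ≤ ‖z‖} else closedPerforatedDisk a R)
      (fun k => closedBall (a k) (R k))) ?_ ?_ ?_
    · rintro ((_ | _) | k)
      · exact isClosed_closedPerforatedDisk a R
      · exact isClosed_le continuous_const continuous_norm
      · exact isClosed_closedBall
    · intro z
      by_cases h1 : 1 ≤ ‖z‖
      · exact ⟨Sum.inl true, h1⟩
      · by_cases h2 : ∃ k, ‖z - a k‖ ≤ R k
        · obtain ⟨k, hk⟩ := h2
          exact ⟨Sum.inr k, by simpa [dist_eq_norm] using hk⟩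
        · push Not at h1 h2
          exact ⟨Sum.inl false, h1.le, fun k => (h2 k).le⟩
    · rintro ((_ | _) | k)
      · exact hMc.congr hΦM
      · exact hEc.congr hΦE
      · exact (hIc k).congr (hΦI k)
  have hsub : perforatedDisk a R ⊆ closedPerforatedDisk a R := fun z hz =>
    ⟨hz.1.le, fun k => (hz.2 k).le⟩
  have hdM : ∀ z ∈ perforatedDisk a R, DifferentiableAt ℂ Φ z := fun z hz =>
    (hM.congr (hΦM.mono hsub)).differentiableAt ((isOpen_perforatedDisk a R).mem_nhds hz)
  have hdI : ∀ k, ∀ z ∈ ball (a k) (R k), DifferentiableAt ℂ Φ z := fun k z hz =>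
    ((hI k).congr ((hΦI k).mono ball_subset_closedBall)).differentiableAt (isOpen_ball.mem_nhds hz)
  have hdE : ∀ z : ℂ, 1 < ‖z‖ → DifferentiableAt ℂ Φ z := fun z hz =>
    (hE.congr fun w hw => hΦE (show (1 : ℝ) ≤ ‖w‖ from le_of_lt hw)).differentiableAt
      ((isOpen_lt continuous_const continuous_norm).mem_nhds hz)
  have hdin : ∀ z : ℂ, ‖z‖ < 1 → DifferentiableAt ℂ Φ z := by
    intro z hz
    by_cases h2 : ∃ k, ‖z - a k‖ ≤ R k
    · obtain ⟨k, hk⟩ := h2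
      obtain ⟨R₂, hR₂, hann⟩ := h.exists_annulus k
      refine (differentiableOn_ball_of_circle (h.pos k) hR₂ hcont.continuousOn (hdI k)
        fun w hw1 hw2 => hdM w (hann w hw1 hw2)).differentiableAt (isOpen_ball.mem_nhds ?_)
      rw [mem_ball, dist_eq_norm]; linarith
    · push Not at h2
      exact hdM z ⟨hz, h2⟩
  have hdiff : Differentiable ℂ Φ := by
    intro z
    rcases lt_trichotomy ‖z‖ 1 with hz | hz | hz
    · exact hdin z hz
    -- The unit circle is removable as well; any outer radius above `1` works, since there are no
    -- further circles outside.
    · refine (differentiableOn_ball_of_circle (c := 0) one_pos one_lt_two hcont.continuousOn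
        (fun w hw => hdin w (by simpa using hw))
        fun w hw1 hw2 => hdE w (by simpa using hw1)).differentiableAt (isOpen_ball.mem_nhds ?_)
      simp [hz]
    · exact hdE z hz
  have hzero : ∀ z, Φ z = 0 := by
    intro z
    refine hdiff.apply_eq_of_tendsto_cocompact z (hE0.congr' ?_)
    filter_upwards [(isCompact_closedBall (0 : ℂ) 1).compl_mem_cocompact] with w hw
    exact (hΦE (le_of_lt (by simpa using hw))).symm
  exact ⟨fun k z hz => by rw [← hΦI k hz, hzero], fun z hz => by rw [← hΦE hz, hzero]⟩

/-- On the circle `k` the boundary condition replaces `φ` by `φ_k - ρ_k conj φ_k`, and the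
reflection term with `m = k` cancels the conjugate up to the constant `ρ_k conj (φ_k (a_k))`. On the
unit circle `unitReflection φ0` cancels `conj φ0`. So the three expressions match and `glue_eq_zero`
applies. -/
theorem IsSolution.functional_equations {a : Fin n → ℂ} {R : Fin n → ℝ} (h : Admissible a R)
    {ρ : Fin n → ℂ} {lam : ℂ} {φ : ℂ → ℂ} {φi : Fin n → ℂ → ℂ} {φ0 : ℂ → ℂ}
    (hs : IsSolution a R ρ lam φ φi φ0) :
    (∀ k, ∀ z ∈ closedBall (a k) (R k), φi k z - ρ k * conj (φi k (a k)) +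
      ∑ m ∈ Finset.univ.erase k, ρ m * circleReflection (a m) (R m) (φi m) z +
        unitReflection φ0 z = 0) ∧
    ∀ z, 1 ≤ ‖z‖ →
      conj lam * φ0 z + ∑ m, ρ m * circleReflection (a m) (R m) (φi m) z = 0 := by
  have hgc := fun m => (circleReflection_continuousOn (h.pos m)
    (hs.continuous_inclusion m)).const_mul (ρ m)
  have hgd := fun m z (hz : R m < ‖z - a m‖) => (circleReflection_differentiableAt (h.pos m)
    (hs.analytic_inclusion m) hz).const_mul (ρ m)
  have h0c := unitReflection_continuousOn hs.analytic_exterior hs.continuous_exterior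
    hs.vanishes_at_infinity
  have h0d := fun z hz => unitReflection_differentiableAt (z := z) hs.analytic_exterior
    hs.vanishes_at_infinity hz
  refine glue_eq_zero h
    (M := fun z => φ z + ∑ m, ρ m * circleReflection (a m) (R m) (φi m) z + unitReflection φ0 z)
    ?_ ?_ ?_ ?_ ?_ ?_ ?_ ?_ ?_
  · intro z hz
    refine DifferentiableWithinAt.add (DifferentiableWithinAt.add (hs.analytic_matrix z hz) ?_) ?_
    · exact DifferentiableWithinAt.fun_sum fun m _ => (hgd m z (hz.2 m)).differentiableWithinAt
    · exact (h0d z hz.1).differentiableWithinAt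
  · refine (hs.continuous_matrix.add ?_).add ?_
    · exact continuousOn_finsetSum _ fun m _ => (hgc m).mono fun z hz => hz.2 m
    · exact h0c.mono fun z hz => by simpa using hz.1
  · intro k z hz
    rw [mem_ball, dist_eq_norm] at hz
    refine DifferentiableWithinAt.add (DifferentiableWithinAt.add (DifferentiableWithinAt.sub
      (hs.analytic_inclusion k z (by simpa [dist_eq_norm] using hz))
        (differentiableWithinAt_const _)) ?_) ?_
    · exact DifferentiableWithinAt.fun_sum fun m hm => (hgd m z
        (h.norm_sub_lt (Finset.ne_of_mem_erase hm) hz.le)).differentiableWithinAt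
    · exact (h0d z (h.norm_lt_one hz.le)).differentiableWithinAt
  · intro k
    refine (((hs.continuous_inclusion k).sub continuousOn_const).add ?_).add ?_
    · exact continuousOn_finsetSum _ fun m hm => (hgc m).mono fun z hz =>
        (h.norm_sub_lt (Finset.ne_of_mem_erase hm) (by simpa [dist_eq_norm] using hz)).le
    · refine h0c.mono fun z hz => ?_
      have := h.norm_lt_one (k := k) (z := z) (by simpa [dist_eq_norm] using hz)
      simpa using this.le
  · intro z hz
    refine DifferentiableWithinAt.add ((hs.analytic_exterior z hz).const_mul _) ?_
    exact DifferentiableWithinAt.fun_sum fun m _ => (hgd m z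
      (h.lt_norm_sub m (le_of_lt hz))).differentiableWithinAt
  · refine (hs.continuous_exterior.const_mul _).add ?_
    exact continuousOn_finsetSum _ fun m _ => (hgc m).mono fun z hz => (h.lt_norm_sub m hz).le
  · have h1 := (hs.vanishes_at_infinity.const_mul (conj lam)).add
      (tendsto_finsetSum Finset.univ fun m _ =>
        (circleReflection_tendsto (h.pos m) (hs.analytic_inclusion m)).const_mul (ρ m))
    simpa using h1
  · intro k t ht
    have h1 := hs.inclusion_condition k t (by simpa [dist_eq_norm] using ht)
    simp only [h1]
    rw [← Finset.add_sum_erase _ _ (Finset.mem_univ k), circleReflection_of_norm_eq (h.pos k) ht]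
    ring
  · intro t ht
    simp only [hs.exterior_condition t ht, unitReflection_of_norm_eq ht]
    ring

/-! ### Rearrangement of nonnegative multiple series -/

/-- Summing along the antidiagonals `i + j = s` is the binomial theorem; nonnegativity turns this
into summability of the double series. -/
theorem hasSum_weight_choose {w : ℕ → ℝ} (hw : ∀ s, 0 ≤ w s) {X Y V : ℝ} (hX : 0 ≤ X) (hY : 0 ≤ Y)
    (h : HasSum (fun s => w s * (X + Y) ^ s) V) :
    HasSum (fun p : ℕ × ℕ => w (p.1 + p.2) * ((p.1 + p.2).choose p.1 : ℝ) * X ^ p.1 * Y ^ p.2)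
      V := by
  rw [← (Equiv.hasSum_iff (Finset.HasAntidiagonal.sigmaAntidiagonalEquivProd (A := ℕ)))]
  set f : (Σ s : ℕ, Finset.HasAntidiagonal.antidiagonal s) → ℝ := (fun p : ℕ × ℕ =>
    w (p.1 + p.2) * ((p.1 + p.2).choose p.1 : ℝ) * X ^ p.1 * Y ^ p.2) ∘
      Finset.HasAntidiagonal.sigmaAntidiagonalEquivProd with hf
  have hnn : ∀ q, 0 ≤ f q := fun q => by
    have := hw
    simp only [hf, Function.comp]
    have h1 := hw ((Finset.HasAntidiagonal.sigmaAntidiagonalEquivProd q).1 + (Finset.HasAntidiagonal.sigmaAntidiagonalEquivProd q).2)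
    positivity
  have hfib : ∀ s, HasSum (fun q : Finset.HasAntidiagonal.antidiagonal s => f ⟨s, q⟩) (w s * (X + Y) ^ s) := by
    intro s
    convert! hasSum_fintype _ using 1
    rw [Commute.add_pow' (Commute.all X Y), Finset.mul_sum, ← Finset.sum_coe_sort]
    refine Finset.sum_congr rfl fun q _ => ?_
    have hq : q.1.1 + q.1.2 = s := Finset.HasAntidiagonal.mem_antidiagonal.1 q.2
    simp only [hf, Function.comp, Finset.HasAntidiagonal.sigmaAntidiagonalEquivProd_apply, hq, nsmul_eq_mul]
    ring
  have hs : Summable f := by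
    refine (summable_sigma_of_nonneg hnn).2 ⟨fun s => (hfib s).summable, ?_⟩
    simpa only [fun s => (hfib s).tsum_eq] using h.summable
  have := hs.hasSum.sigma hfib
  rw [← this.unique h]
  exact hs.hasSum

theorem hasSum_binomial {𝕜 : Type*} [NormedField 𝕜] (x y : 𝕜) (p : ℕ) :
    HasSum (fun j => (p.choose j : 𝕜) * x ^ j * y ^ (p - j)) ((x + y) ^ p) := by
  have h := hasSum_sum_of_ne_finset_zero (L := SummationFilter.unconditional ℕ) (f := fun j => (p.choose j : 𝕜) * x ^ j * y ^ (p - j))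
    (s := Finset.range (p + 1)) fun j hj => by
      rw [Nat.choose_eq_zero_of_lt (by simpa [Nat.lt_succ_iff] using hj)]; simp
  convert h using 1
  rw [add_pow]
  exact Finset.sum_congr rfl fun j _ => by ring

/-- Tonelli. The index `p` shared by both factors is placed last, so that fixing the first two
leaves exactly the series that defines `bergmanCoeff`. -/
theorem hasSum_triple {u v : ℕ → ℕ → ℝ} {w U V : ℕ → ℝ} {S : ℝ} (hu : ∀ p j, 0 ≤ u p j)
    (hv : ∀ p j, 0 ≤ v p j) (hw : ∀ p, 0 ≤ w p) (hU : ∀ p, HasSum (u p) (U p))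
    (hV : ∀ p, HasSum (v p) (V p)) (hS : HasSum (fun p => w p * (U p * V p)) S) :
    HasSum (fun q : ℕ × ℕ × ℕ => w q.2.2 * (u q.2.2 q.1 * v q.2.2 q.2.1)) S := by
  have hfib : ∀ p, HasSum (fun q : ℕ × ℕ => w p * (u p q.1 * v p q.2)) (w p * (U p * V p)) := by
    intro p
    refine HasSum.mul_left _ ((hU p).mul (hV p) ?_)
    exact (hU p).summable.mul_of_nonneg (hV p).summable (hu p) (hv p)
  have hs : Summable (fun q : ℕ × ℕ × ℕ => w q.1 * (u q.1 q.2.1 * v q.1 q.2.2)) := by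
    refine (summable_prod_of_nonneg fun q =>
      mul_nonneg (hw _) (mul_nonneg (hu _ _) (hv _ _))).2 ⟨fun p => (hfib p).summable, ?_⟩
    simpa only [fun p => (hfib p).tsum_eq] using hS.summable
  have h1 : HasSum (fun q : ℕ × ℕ × ℕ => w q.1 * (u q.1 q.2.1 * v q.1 q.2.2)) S := by
    rw [← (hs.hasSum.prod_fiberwise hfib).unique hS]; exact hs.hasSum
  exact (((Equiv.prodAssoc ℕ ℕ ℕ).symm.trans (Equiv.prodComm (ℕ × ℕ) ℕ)).hasSum_iff).2 h1

/-! ### Power series and expansion of the reflections -/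

/-- The power series with coefficients `c`, without constant term. -/
noncomputable def pser (c : ℕ → ℂ) (w : ℂ) : ℂ := ∑' j, c j * w ^ (j + 1)

theorem summable_pser {c : ℕ → ℂ} {M : ℝ} (hc : ∀ j, ‖c j‖ ≤ M) {w : ℂ} (hw : ‖w‖ < 1) :
    Summable fun j => c j * w ^ (j + 1) := by
  refine Summable.of_norm_bounded (g := fun j => M * ‖w‖ * ‖w‖ ^ j)
    ((summable_geometric_of_lt_one (norm_nonneg _) hw).mul_left _) fun j => ?_
  rw [norm_mul, norm_pow, pow_succ]
  calc ‖c j‖ * (‖w‖ ^ j * ‖w‖) ≤ M * (‖w‖ ^ j * ‖w‖) := by gcongr; exact hc j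
    _ = _ := by ring

theorem conj_pser (c : ℕ → ℂ) (w : ℂ) : conj (pser c w) = pser (fun j => conj (c j)) (conj w) := by
  simp only [pser, Complex.conj_tsum, map_mul, map_pow]

theorem pser_zero (c : ℕ → ℂ) : pser c 0 = 0 := by simp [pser]

theorem pser_continuousOn {c : ℕ → ℂ} (hc : Summable c) :
    ContinuousOn (pser c) (closedBall 0 1) := by
  refine continuousOn_tsum (fun j => by fun_prop) hc.norm fun j w hw => ?_
  rw [norm_mul, norm_pow]
  exact mul_le_of_le_one_right (norm_nonneg _) (pow_le_one₀ (norm_nonneg _) (by simpa using hw))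

theorem pser_differentiableOn {c : ℕ → ℂ} {M : ℝ} (hc : ∀ j, ‖c j‖ ≤ M) :
    DifferentiableOn ℂ (pser c) (ball 0 1) := by
  intro w hw
  rw [mem_ball_zero_iff] at hw
  obtain ⟨s, hs1, hs2⟩ := exists_between hw
  have hs0 : 0 ≤ s := (norm_nonneg _).trans hs1.le
  refine DifferentiableAt.differentiableWithinAt (DifferentiableOn.differentiableAt
    (s := ball 0 s) ?_ (isOpen_ball.mem_nhds (by simpa using hs1)))
  refine Complex.differentiableOn_tsum_of_summable_norm (u := fun j => M * s * s ^ j)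
    ((summable_geometric_of_lt_one hs0 hs2).mul_left _) (fun j => by fun_prop) isOpen_ball ?_
  intro j z hz
  rw [mem_ball_zero_iff] at hz
  have hM : 0 ≤ M := (norm_nonneg _).trans (hc 0)
  rw [norm_mul, norm_pow]
  calc ‖c j‖ * ‖z‖ ^ (j + 1) ≤ M * s ^ (j + 1) := by gcongr; exact hc j
    _ = _ := by ring

theorem norm_pser_sub_le {c : ℕ → ℂ} {M : ℝ} (hc : ∀ j, ‖c (j + 1)‖ ≤ M) {w : ℂ}
    (hw : ‖w‖ ≤ 1 / 2) : ‖pser c w - c 0 * w‖ ≤ 2 * M * ‖w‖ ^ 2 := by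
  have hw1 : ‖w‖ < 1 := by linarith
  have hM : 0 ≤ M := (norm_nonneg _).trans (hc 0)
  have hs : Summable fun j => c j * w ^ (j + 1) := by
    refine summable_pser (M := max ‖c 0‖ M) (fun j => ?_) hw1
    cases j with
    | zero => exact le_max_left _ _
    | succ j => exact (hc j).trans (le_max_right _ _)
  have h1 : pser c w - c 0 * w = ∑' j, c (j + 1) * w ^ (j + 2) := by
    rw [pser, hs.tsum_eq_zero_add]; simp
  rw [h1]
  have hg := (hasSum_geometric_of_lt_one (norm_nonneg w) hw1).mul_left (M * ‖w‖ ^ 2)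
  refine (tsum_of_norm_bounded hg fun j => ?_).trans ?_
  · rw [norm_mul, norm_pow]
    calc ‖c (j + 1)‖ * ‖w‖ ^ (j + 2) ≤ M * ‖w‖ ^ (j + 2) := by gcongr; exact hc j
      _ = _ := by ring
  · have : (1 - ‖w‖)⁻¹ ≤ 2 := by
      rw [inv_le_comm₀ (by linarith) two_pos]; linarith
    calc M * ‖w‖ ^ 2 * (1 - ‖w‖)⁻¹ ≤ M * ‖w‖ ^ 2 * 2 := by gcongr
      _ = _ := by ring

theorem hasDerivAt_pser_zero {c : ℕ → ℂ} {M : ℝ} (hc : ∀ j, ‖c j‖ ≤ M) :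
    HasDerivAt (pser c) (c 0) 0 := by
  rw [hasDerivAt_iff_isLittleO_nhds_zero]
  refine Asymptotics.IsBigO.trans_isLittleO (g := fun h : ℂ => h ^ 2) ?_ ?_
  · refine Asymptotics.IsBigO.of_bound (2 * M) ?_
    filter_upwards [closedBall_mem_nhds (0 : ℂ) (by norm_num : (0 : ℝ) < 1 / 2)] with w hw
    have := norm_pser_sub_le (fun j => hc (j + 1)) (w := w) (by simpa using hw)
    simpa [pser_zero, mul_comm] using this
  · exact Asymptotics.isLittleO_pow_id one_lt_two

/-- A function analytic in the unit disk and continuous in its closure has bounded Taylor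
coefficients. -/
theorem exists_taylor {f : ℂ → ℂ} (hf : DifferentiableOn ℂ f (ball 0 1))
    (hc : ContinuousOn f (closedBall 0 1)) :
    ∃ (c : ℕ → ℂ) (M : ℝ), (∀ j, ‖c j‖ ≤ M) ∧ ∀ w, ‖w‖ < 1 → f w = f 0 + pser c w := by
  have h1 : DiffContOnCl ℂ f (ball (0 : ℂ) ((1 : NNReal) : ℝ)) := by
    rw [NNReal.coe_one]
    exact ⟨hf, by rwa [closure_ball _ one_ne_zero]⟩
  have h2 := h1.hasFPowerSeriesOnBall one_pos
  set p := cauchyPowerSeries f 0 ((1 : NNReal) : ℝ)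
  -- The common bound is the mean of `|f|` over the unit circle: on radius `1` Cauchy's estimate has
  -- no power of the radius.
  refine ⟨fun j => p.coeff (j + 1),
    (2 * Real.pi)⁻¹ * ∫ θ : ℝ in 0..2 * Real.pi, ‖f (circleMap 0 ((1 : NNReal) : ℝ) θ)‖, ?_, ?_⟩
  · intro j
    have h3 := norm_cauchyPowerSeries_le f 0 ((1 : NNReal) : ℝ) (j + 1)
    rw [← FormalMultilinearSeries.norm_apply_eq_norm_coef]
    simpa [p] using h3
  · intro w hw
    have h3 := h2.hasSum (y := w) (by
      rw [mem_eball_zero_iff, enorm_lt_coe]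
      exact_mod_cast hw)
    simp only [FormalMultilinearSeries.apply_eq_pow_smul_coeff, zero_add, smul_eq_mul] at h3
    have h4 : p.coeff 0 = f 0 := by
      rw [FormalMultilinearSeries.coeff]
      exact h2.coeff_zero _
    rw [← h3.tsum_eq, h3.summable.tsum_eq_zero_add, pser]
    simp [h4, mul_comm]

theorem coeff_eq_zero_of_hasSum {c : ℕ → ℂ}
    (h : ∀ w : ℂ, ‖w‖ < 1 → HasSum (fun i => c i * w ^ i) 0) (i : ℕ) : c i = 0 := by
  set p : FormalMultilinearSeries ℂ ℂ ℂ := fun i => ContinuousMultilinearMap.mkPiRing ℂ (Fin i) (c i)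
  have hp : HasFPowerSeriesOnBall (fun _ => (0 : ℂ)) p 0 1 := by
    refine ⟨?_, one_pos, ?_⟩
    · refine ENNReal.le_of_forall_nnreal_lt fun r hr => ?_
      have hr1 : (r : ℝ) < 1 := by exact_mod_cast hr
      refine p.le_radius_of_tendsto (l := 0) ?_
      have h1 := (h (r : ℂ) (by simpa using hr1)).summable.tendsto_atTop_zero.norm
      simpa [p] using h1
    · intro y hy
      have := h y (by
        rw [← ENNReal.coe_one, mem_eball_zero_iff, enorm_lt_coe] at hy
        exact_mod_cast hy)
      simpa [p, mul_comm] using this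
  have h2 := (hp.hasFPowerSeriesAt.eq_zero)
  have h3 := congrArg (fun q => q i (fun _ => 1)) h2
  simpa [p] using h3

theorem one_sub_inv_pow {t : ℂ} (ht : ‖t‖ < 1) (j : ℕ) :
    HasSum (fun i => ((i + j).choose i : ℂ) * t ^ i) ((1 - t)⁻¹ ^ (j + 1)) := by
  have := hasSum_choose_mul_geometric_of_norm_lt_one j ht
  rw [one_div, ← inv_pow] at this
  refine this.congr_fun fun i => ?_
  rw [Nat.choose_symm_add]

theorem hasSum_choose_shift {b z : ℂ} (h : ‖b * z‖ < 1) (j : ℕ) :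
    HasSum (fun p => (p.choose j : ℂ) * b ^ (p - j) * z ^ (p + 1))
      ((z * (1 - b * z)⁻¹) ^ (j + 1)) := by
  rw [← hasSum_nat_add_iff' j, Finset.sum_eq_zero, sub_zero, mul_pow]
  · refine ((one_sub_inv_pow h j).mul_left (z ^ (j + 1))).congr_fun fun i => ?_
    rw [Nat.add_sub_cancel, Nat.choose_symm_add, mul_pow]
    ring
  · intro p hp
    rw [Nat.choose_eq_zero_of_lt (by simpa using hp)]; simp

/-- Each power of `y / (α + x)` is expanded geometrically in `x` and the sums are exchanged. The
moduli sum to a geometric series in `(|x| + |y|) / |α|`; for `α = a_k - a_m` and `x`, `y` of the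
size of the radii, the condition is disjointness of the two disks. -/
theorem hasSum_inversion {c : ℕ → ℂ} {M : ℝ} (hc : ∀ j, ‖c j‖ ≤ M) {x y α : ℂ}
    (h : ‖x‖ + ‖y‖ < ‖α‖) :
    HasSum (fun i => (∑' j, c j * ((-1) ^ i * ((i + j).choose i : ℂ) * y ^ (j + 1) *
      α⁻¹ ^ (i + j + 1))) * x ^ i) (pser c (y / (α + x))) := by
  have hα : 0 < ‖α‖ := lt_of_le_of_lt (by positivity) h
  have hα0 : α ≠ 0 := norm_pos_iff.1 hα
  have hxy : ‖x‖ / ‖α‖ + ‖y‖ / ‖α‖ < 1 := by rwa [← add_div, div_lt_one hα]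
  have hs : Summable fun p : ℕ × ℕ => c p.2 * ((-1) ^ p.1 * ((p.1 + p.2).choose p.1 : ℂ) *
      y ^ (p.2 + 1) * α⁻¹ ^ (p.1 + p.2 + 1)) * x ^ p.1 := by
    have h1 := (hasSum_weight_choose (w := fun _ => 1) (fun _ => zero_le_one)
      (div_nonneg (norm_nonneg x) hα.le) (div_nonneg (norm_nonneg y) hα.le)
      (by simpa using hasSum_geometric_of_lt_one (by positivity) hxy)).summable
    refine Summable.of_norm_bounded (h1.mul_left (M * (‖y‖ / ‖α‖))) fun p => ?_
    have h2 : ‖c p.2 * ((-1) ^ p.1 * ((p.1 + p.2).choose p.1 : ℂ) *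
      y ^ (p.2 + 1) * α⁻¹ ^ (p.1 + p.2 + 1)) * x ^ p.1‖ = ‖c p.2‖ * ((‖y‖ / ‖α‖) *
        (1 * ((p.1 + p.2).choose p.1 : ℝ) * (‖x‖ / ‖α‖) ^ p.1 * (‖y‖ / ‖α‖) ^ p.2)) := by
      simp only [norm_mul, norm_pow, norm_neg, norm_one, one_pow, norm_inv, Complex.norm_natCast,
        div_eq_mul_inv]
      ring
    rw [h2, mul_assoc M]
    exact mul_le_mul_of_nonneg_right (hc _) (by positivity)
  have hcol : ∀ j, HasSum (fun i => c j * ((-1) ^ i * ((i + j).choose i : ℂ) * y ^ (j + 1) *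
      α⁻¹ ^ (i + j + 1)) * x ^ i) (c j * (y / (α + x)) ^ (j + 1)) := by
    intro j
    have h1 : ‖-(x / α)‖ < 1 := by
      rw [norm_neg, norm_div]
      exact lt_of_le_of_lt (le_add_of_nonneg_right (by positivity)) hxy
    have h2 := (one_sub_inv_pow h1 j).mul_left (c j * (y / α) ^ (j + 1))
    have h3 : y / (α + x) = (y / α) * (1 - -(x / α))⁻¹ := by
      rw [sub_neg_eq_add, ← div_eq_mul_inv, div_div, mul_add, mul_one, mul_div_cancel₀ _ hα0]
    rw [h3, mul_pow, ← mul_assoc]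
    refine h2.congr_fun fun i => ?_
    rw [neg_pow (x / α), div_eq_mul_inv, div_eq_mul_inv]
    ring
  have htot : HasSum _ _ := hs.hasSum
  have h1 := ((Equiv.prodComm ℕ ℕ).hasSum_iff.2 htot).prod_fiberwise fun j => hcol j
  rw [pser, h1.tsum_eq]
  refine (htot.prod_fiberwise fun i => (hs.prod_factor i).hasSum).congr_fun fun i => ?_
  rw [← tsum_mul_right]

/-- Expansion of a function reflected in an inclusion and in the unit circle: the powers of `z / (1
- b z)` are expanded in `z = x + a`, and these in `x`. The majorant is `∑ (|x| + |a|) ^ (p + 1) (|y|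
+ |b|) ^ p`, finite because both disks lie in the unit disk. -/
theorem hasSum_mobius {c : ℕ → ℂ} {M : ℝ} (hc : ∀ j, ‖c j‖ ≤ M) {x y a b : ℂ}
    (hx : ‖x‖ + ‖a‖ < 1) (hy : ‖y‖ + ‖b‖ < 1) :
    HasSum (fun i => (∑' j, c j * (y ^ (j + 1) * ∑' p : ℕ, (p.choose j : ℂ) * b ^ (p - j) *
      (((p + 1).choose i : ℂ) * a ^ (p + 1 - i)))) * x ^ i)
      (pser c (y * ((x + a) * (1 - b * (x + a))⁻¹))) := by
  set G : ℕ × ℕ × ℕ → ℂ := fun q => c q.2.1 * (y ^ (q.2.1 + 1) * ((q.2.2.choose q.2.1 : ℂ) *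
    b ^ (q.2.2 - q.2.1) * (((q.2.2 + 1).choose q.1 : ℂ) * a ^ (q.2.2 + 1 - q.1)))) * x ^ q.1
    with hG
  have hbz : ‖b * (x + a)‖ < 1 := by
    rw [norm_mul]
    refine mul_lt_one_of_nonneg_of_lt_one_left (norm_nonneg _) ?_ ((norm_add_le _ _).trans hx.le)
    linarith [norm_nonneg y]
  have hs : Summable G := by
    have hgeo : Summable fun p : ℕ => (1 : ℝ) * ((‖x‖ + ‖a‖) ^ (p + 1) * (‖y‖ + ‖b‖) ^ p) := by
      refine Summable.of_nonneg_of_le (fun p => by positivity) (fun p => ?_)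
        (summable_geometric_of_lt_one (by positivity) hy)
      rw [one_mul]
      exact mul_le_of_le_one_left (by positivity) (pow_le_one₀ (by positivity) hx.le)
    have h1 := (hasSum_triple (u := fun p i => ((p + 1).choose i : ℝ) * ‖x‖ ^ i * ‖a‖ ^ (p + 1 - i))
      (v := fun p j => (p.choose j : ℝ) * ‖y‖ ^ j * ‖b‖ ^ (p - j)) (w := fun _ => 1)
      (fun p j => by positivity) (fun p j => by positivity) (fun _ => zero_le_one)
      (fun p => hasSum_binomial _ _ _) (fun p => hasSum_binomial _ _ _) hgeo.hasSum).summable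
    refine Summable.of_norm_bounded (h1.mul_left (M * ‖y‖)) fun q => ?_
    have h2 : ‖G q‖ = ‖c q.2.1‖ * (‖y‖ * (1 * (((q.2.2 + 1).choose q.1 : ℝ) * ‖x‖ ^ q.1 *
        ‖a‖ ^ (q.2.2 + 1 - q.1) * ((q.2.2.choose q.2.1 : ℝ) * ‖y‖ ^ q.2.1 *
          ‖b‖ ^ (q.2.2 - q.2.1))))) := by
      simp only [hG, norm_mul, norm_pow, Complex.norm_natCast]
      ring
    rw [h2, mul_assoc M]
    exact mul_le_mul_of_nonneg_right (hc _) (by positivity)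
  have h1 : HasSum (fun q : ℕ × ℕ => c q.1 * (y ^ (q.1 + 1) * ((q.2.choose q.1 : ℂ) *
      b ^ (q.2 - q.1) * (x + a) ^ (q.2 + 1)))) (∑' q, G q) := by
    refine ((Equiv.prodComm (ℕ × ℕ) ℕ).hasSum_iff.2 hs.hasSum).prod_fiberwise fun q => ?_
    have := (hasSum_binomial x a (q.2 + 1)).mul_left (c q.1 * (y ^ (q.1 + 1) *
      ((q.2.choose q.1 : ℂ) * b ^ (q.2 - q.1))))
    convert! this using 1
    · funext i
      simp only [hG, Function.comp, Equiv.prodComm_apply, Prod.swap]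
      ring
    · ring
  have h2 : HasSum (fun j => c j * (y * ((x + a) * (1 - b * (x + a))⁻¹)) ^ (j + 1))
      (∑' q, G q) := by
    refine h1.prod_fiberwise fun j => ?_
    have := (hasSum_choose_shift hbz j).mul_left (c j * y ^ (j + 1))
    convert! this using 1
    · funext p; simp only; ring
    · rw [mul_pow y]; ring
  rw [pser, h2.tsum_eq]
  refine (hs.hasSum.prod_fiberwise fun i => (hs.prod_factor i).hasSum).congr_fun fun i => ?_
  rw [(hs.prod_factor i).tsum_prod, ← tsum_mul_right]
  refine tsum_congr fun j => ?_
  rw [← tsum_mul_left, ← tsum_mul_left, ← tsum_mul_right]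

/-! ### The infinite matrices and their absolute summability -/

/-- Matrix of the reflections in the circles, acting on Taylor coefficients. -/
noncomputable def reflMat (a : Fin n → ℂ) (R : Fin n → ℝ) (ρ : Fin n → ℂ) (p q : Fin n × ℕ) : ℂ :=
  if q.1 = p.1 then 0 else ρ q.1 * ((-1) ^ (p.2 + 1) *
    (((p.2 + q.2 + 1 : ℕ) : ℂ) * ((p.2 + q.2).choose p.2 : ℂ)) * (R p.1 : ℂ) ^ p.2 *
      (R q.1 : ℂ) ^ (q.2 + 2) * (a p.1 - a q.1)⁻¹ ^ (p.2 + q.2 + 2))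

/-- Taylor coefficients of the Bergman kernel of the unit disk. -/
noncomputable def bergmanCoeff (a : Fin n → ℂ) (p q : Fin n × ℕ) : ℂ :=
  ∑' l : ℕ, ((l + 1 : ℕ) : ℂ) * ((l.choose p.2 : ℂ) * a p.1 ^ (l - p.2)) *
    ((l.choose q.2 : ℂ) * conj (a q.1) ^ (l - q.2))

/-- Matrix of the successive reflections in the circles and in the unit circle, acting on Taylor
coefficients. -/
noncomputable def bergMat (a : Fin n → ℂ) (R : Fin n → ℝ) (ρ : Fin n → ℂ) (p q : Fin n × ℕ) : ℂ :=
  conj (ρ q.1) * ((R p.1 : ℂ) ^ p.2 * (R q.1 : ℂ) ^ (q.2 + 2) * bergmanCoeff a p q)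

theorem hasSum_pairs {g : (Fin n × ℕ) × (Fin n × ℕ) → ℝ} (hg : ∀ x, 0 ≤ g x)
    {S : Fin n → Fin n → ℝ}
    (h : ∀ k m, HasSum (fun p : ℕ × ℕ => g ((k, p.1), (m, p.2))) (S k m)) :
    HasSum g (∑ k, ∑ m, S k m) := by
  rw [← (Equiv.prodProdProdComm (Fin n) (Fin n) ℕ ℕ).hasSum_iff]
  have hs : Summable (g ∘ Equiv.prodProdProdComm (Fin n) (Fin n) ℕ ℕ) :=
    (summable_prod_of_nonneg fun x => hg _).2
      ⟨fun x => (h x.1 x.2).summable, Summable.of_finite⟩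
  have h1 : HasSum (fun x : Fin n × Fin n => S x.1 x.2) _ :=
    hs.hasSum.prod_fiberwise fun x => h x.1 x.2
  rw [← Fintype.sum_prod_type' S, ← h1.unique (hasSum_fintype _)]
  exact hs.hasSum

theorem hasSum_succ_mul_geometric {t : ℝ} (h0 : 0 ≤ t) (h1 : t < 1) :
    HasSum (fun s : ℕ => ((s + 1 : ℕ) : ℝ) * t ^ s) (((1 - t) ^ 2)⁻¹) := by
  have := hasSum_choose_mul_geometric_of_norm_lt_one 1 (r := t)
    (by rwa [Real.norm_eq_abs, abs_of_nonneg h0])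
  rw [one_div] at this
  simpa using this

/-- Grouping by `s = i + j` leaves `∑ (s + 1) t ^ s = (1 - t)⁻²` with `t = (R_k + R_m) / |a_k -
a_m|`; the two extra powers of `R_m` come out in front. -/
theorem hasSum_norm_reflMat {a : Fin n → ℂ} {R : Fin n → ℝ} (ρ : Fin n → ℂ)
    (hR : ∀ k, 0 < R k) {k m : Fin n} (hkm : m ≠ k) (h : R k + R m < ‖a k - a m‖) :
    HasSum (fun p : ℕ × ℕ => ‖reflMat a R ρ (k, p.1) (m, p.2)‖) (‖ρ m‖ * (R m / ‖a k - a m‖) ^ 2 *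
      ((1 - (R k / ‖a k - a m‖ + R m / ‖a k - a m‖)) ^ 2)⁻¹) := by
  have hα : 0 < ‖a k - a m‖ := (add_pos (hR k) (hR m)).trans h
  have hX := div_nonneg (hR k).le hα.le
  have hY := div_nonneg (hR m).le hα.le
  have h1 := (hasSum_weight_choose (w := fun s => ((s + 1 : ℕ) : ℝ)) (fun s => by positivity) hX hY
    (hasSum_succ_mul_geometric (add_nonneg hX hY) (by rwa [← add_div, div_lt_one hα]))).mul_left
    (‖ρ m‖ * (R m / ‖a k - a m‖) ^ 2)
  refine h1.congr_fun fun p => ?_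
  simp only [reflMat, if_neg hkm, norm_mul, norm_pow, norm_neg, norm_one, one_pow, norm_inv,
    Complex.norm_natCast, Complex.norm_real, Real.norm_eq_abs, abs_of_pos (hR _), div_eq_mul_inv]
  ring

theorem summable_reflMat {a : Fin n → ℂ} {R : Fin n → ℝ} (ρ : Fin n → ℂ) (h : Admissible a R) :
    Summable fun x : (Fin n × ℕ) × (Fin n × ℕ) => ‖reflMat a R ρ x.1 x.2‖ := by
  refine (hasSum_pairs (S := fun k m => if m = k then 0 else ‖ρ m‖ * (R m / ‖a k - a m‖) ^ 2 *
      ((1 - (R k / ‖a k - a m‖ + R m / ‖a k - a m‖)) ^ 2)⁻¹) (fun x => norm_nonneg _)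
      fun k m => ?_).summable
  by_cases hkm : m = k
  · simp [reflMat, hkm, hasSum_zero]
  · rw [if_neg hkm]
    exact hasSum_norm_reflMat ρ h.pos hkm (h.disjoint k m (Ne.symm hkm))

/-- The binomial sums collapse to `∑ (p + 1) (x + A) ^ p (y + B) ^ p`. It suffices that one base is
strictly below `1`, so the other is merely bounded by `1`. -/
theorem hasSum_bergman {x y : ℝ} (hx : 0 ≤ x) (hy : 0 ≤ y) {A B : ℝ} (hA : 0 ≤ A) (hB : 0 ≤ B)
    {t : ℝ} (hxA : x + A ≤ 1) (hyB : y + B ≤ t) (ht : t < 1) :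
    ∃ S ≤ ((1 - t) ^ 2)⁻¹, HasSum (fun q : ℕ × ℕ × ℕ => ((q.2.2 + 1 : ℕ) : ℝ) *
      ((q.2.2.choose q.1 : ℝ) * x ^ q.1 * A ^ (q.2.2 - q.1) *
        ((q.2.2.choose q.2.1 : ℝ) * y ^ q.2.1 * B ^ (q.2.2 - q.2.1)))) S := by
  have ht0 : 0 ≤ t := (add_nonneg hy hB).trans hyB
  have hgeo := hasSum_succ_mul_geometric ht0 ht
  have hle : ∀ p : ℕ, ((p + 1 : ℕ) : ℝ) * ((x + A) ^ p * (y + B) ^ p) ≤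
      ((p + 1 : ℕ) : ℝ) * t ^ p := by
    intro p
    have h1 : (x + A) ^ p ≤ 1 := pow_le_one₀ (by positivity) hxA
    have h2 : (y + B) ^ p ≤ t ^ p := by gcongr
    calc _ ≤ ((p + 1 : ℕ) : ℝ) * (1 * t ^ p) := by gcongr
      _ = _ := by ring
  have hs : Summable fun p : ℕ => ((p + 1 : ℕ) : ℝ) * ((x + A) ^ p * (y + B) ^ p) :=
    Summable.of_nonneg_of_le (fun p => by positivity) hle hgeo.summable
  refine ⟨_, ?_, hasSum_triple (u := fun p i => (p.choose i : ℝ) * x ^ i * A ^ (p - i))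
      (v := fun p j => (p.choose j : ℝ) * y ^ j * B ^ (p - j)) (w := fun p => ((p + 1 : ℕ) : ℝ))
      (fun p j => by positivity) (fun p j => by positivity) (fun _ => by positivity)
      (fun p => hasSum_binomial _ _ _) (fun p => hasSum_binomial _ _ _) hs.hasSum⟩
  exact hasSum_le hle hs.hasSum hgeo

/-- Absolute summability of the Bergman coefficients, with weights. -/
theorem hasSum_norm_bergmanCoeff (a : Fin n → ℂ) {x y t : ℝ} (hx : 0 < x) (hy : 0 < y)
    {k m : Fin n} (hk : x + ‖a k‖ ≤ 1) (hm : y + ‖a m‖ ≤ t) (ht : t < 1) :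
    ∃ S ≤ ((1 - t) ^ 2)⁻¹, HasSum (fun p : ℕ × ℕ =>
      x ^ p.1 * y ^ p.2 * ‖bergmanCoeff a (k, p.1) (m, p.2)‖) S := by
  obtain ⟨S, hS, hsum⟩ := hasSum_bergman hx.le hy.le (norm_nonneg (a k)) (norm_nonneg (a m)) hk hm ht
  have h1 := ((Equiv.prodAssoc ℕ ℕ ℕ).hasSum_iff.2 hsum)
  have h2 := h1.prod_fiberwise fun p => (h1.summable.prod_factor p).hasSum
  have hle : ∀ p : ℕ × ℕ, x ^ p.1 * y ^ p.2 * ‖bergmanCoeff a (k, p.1) (m, p.2)‖ ≤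
      ∑' l : ℕ, ((l + 1 : ℕ) : ℝ) * ((l.choose p.1 : ℝ) * x ^ p.1 * ‖a k‖ ^ (l - p.1) *
        ((l.choose p.2 : ℝ) * y ^ p.2 * ‖a m‖ ^ (l - p.2))) := by
    intro p
    have h3 : x ^ p.1 * y ^ p.2 * ‖bergmanCoeff a (k, p.1) (m, p.2)‖ =
        ‖(x : ℂ) ^ p.1 * (y : ℂ) ^ p.2 * bergmanCoeff a (k, p.1) (m, p.2)‖ := by
      simp only [norm_mul, norm_pow, Complex.norm_real, Real.norm_eq_abs, abs_of_pos hx,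
        abs_of_pos hy]
    rw [h3, bergmanCoeff, ← tsum_mul_left]
    refine tsum_of_norm_bounded (h1.summable.prod_factor p).hasSum fun l => le_of_eq ?_
    simp only [norm_mul, norm_pow, Complex.norm_natCast, Complex.norm_real, Real.norm_eq_abs,
      abs_of_pos hx, abs_of_pos hy, RCLike.norm_conj, Function.comp, Equiv.prodAssoc_apply]
    ring
  have hs := Summable.of_nonneg_of_le (fun p => by positivity) hle h2.summable
  exact ⟨_, (hasSum_le hle hs.hasSum h2).trans hS, hs.hasSum⟩

theorem norm_bergMat {a : Fin n → ℂ} {R : Fin n → ℝ} (ρ : Fin n → ℂ) (hR : ∀ k, 0 < R k)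
    (p q : Fin n × ℕ) : ‖bergMat a R ρ p q‖ = ‖ρ q.1‖ * R q.1 ^ 2 *
      (R p.1 ^ p.2 * R q.1 ^ q.2 * ‖bergmanCoeff a p q‖) := by
  simp only [bergMat, norm_mul, norm_pow, Complex.norm_real, Real.norm_eq_abs, abs_of_pos (hR _),
    RCLike.norm_conj]
  ring

theorem summable_bergMat {a : Fin n → ℂ} {R : Fin n → ℝ} (ρ : Fin n → ℂ) (h : Admissible a R) :
    Summable fun x : (Fin n × ℕ) × (Fin n × ℕ) => ‖bergMat a R ρ x.1 x.2‖ := by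
  have h1 : ∀ k m, ∃ S, HasSum (fun p : ℕ × ℕ =>
      R k ^ p.1 * R m ^ p.2 * ‖bergmanCoeff a (k, p.1) (m, p.2)‖) S := fun k m => by
    obtain ⟨S, -, hS⟩ := hasSum_norm_bergmanCoeff a (h.pos k) (h.pos m) (t := R m + ‖a m‖)
      (by linarith [h.lt_one k]) le_rfl (by linarith [h.lt_one m])
    exact ⟨S, hS⟩
  choose S hS using h1
  refine (hasSum_pairs (S := fun k m => ‖ρ m‖ * R m ^ 2 * S k m) (fun x => norm_nonneg _)
      fun k m => ?_).summable
  exact ((hS k m).mul_left (‖ρ m‖ * R m ^ 2)).congr_fun fun p => norm_bergMat ρ h.pos _ _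

/-- The reflection in the circle `m` of the function with Taylor coefficients `d`. -/
noncomputable def sRefl (a : Fin n → ℂ) (R : Fin n → ℝ) (d : Fin n × ℕ → ℂ) (m : Fin n) (z : ℂ) :
    ℂ := R m * pser (fun j => conj (d (m, j))) (R m / (z - a m))

/-- The reflection of `sRefl` in the unit circle. -/
noncomputable def uRefl (a : Fin n → ℂ) (R : Fin n → ℝ) (d : Fin n × ℕ → ℂ) (m : Fin n) (z : ℂ) :
    ℂ := R m * pser (fun j => d (m, j)) (R m * (z * (1 - conj (a m) * z)⁻¹))

theorem summable_mul_bounded {ι : Type*} {f c : ι → ℂ} (hf : Summable fun q => ‖f q‖) {M : ℝ}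
    (hc : ∀ q, ‖c q‖ ≤ M) : Summable fun q => f q * c q := by
  refine Summable.of_norm_bounded (hf.mul_right M) fun q => ?_
  rw [norm_mul]
  exact mul_le_mul_of_nonneg_left (hc q) (norm_nonneg _)

theorem tsum_fin_prod {f : Fin n × ℕ → ℂ} (hf : Summable f) :
    ∑' q, f q = ∑ m, ∑' j, f (m, j) := by
  rw [hf.tsum_prod, tsum_fintype]

/-- The identity `(i + j + 1) C(i + j, i) = (i + 1) C(i + j + 1, i + 1)` shows that the matrix row
gives the Taylor coefficients of the derivative of the reflected functions from `hasSum_inversion`.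
-/
theorem tsum_reflMat {a : Fin n → ℂ} {R : Fin n → ℝ} (ρ : Fin n → ℂ) (h : Admissible a R)
    {d : Fin n × ℕ → ℂ} {M : ℝ} (hd : ∀ q, ‖d q‖ ≤ M) (k : Fin n) (i : ℕ) :
    (R k : ℂ) * ∑' q, reflMat a R ρ (k, i) q * conj (d q) =
      ((i + 1 : ℕ) : ℂ) * ∑ m ∈ Finset.univ.erase k, ρ m * (R m * ((∑' j, conj (d (m, j)) *
        ((-1) ^ (i + 1) * ((i + 1 + j).choose (i + 1) : ℂ) * (R m : ℂ) ^ (j + 1) *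
          (a k - a m)⁻¹ ^ (i + 1 + j + 1))) * (R k : ℂ) ^ (i + 1))) := by
  have hs : Summable fun q => reflMat a R ρ (k, i) q * conj (d q) :=
    summable_mul_bounded ((summable_reflMat ρ h).prod_factor (k, i)) (M := M)
      fun q => by rw [RCLike.norm_conj]; exact hd q
  rw [tsum_fin_prod hs, ← Finset.add_sum_erase _ _ (Finset.mem_univ k)]
  have h0 : ∑' j, reflMat a R ρ (k, i) (k, j) * conj (d (k, j)) = 0 := by simp [reflMat]
  rw [h0, zero_add, Finset.mul_sum, Finset.mul_sum]
  refine Finset.sum_congr rfl fun m hm => ?_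
  simp only [← tsum_mul_left, ← tsum_mul_right]
  refine tsum_congr fun j => ?_
  have h1 : ((i + j + 1 : ℕ) : ℂ) * ((i + j).choose i : ℂ) =
      ((i + 1 + j).choose (i + 1) : ℂ) * ((i + 1 : ℕ) : ℂ) := by
    rw [add_right_comm i 1 j]; exact_mod_cast Nat.add_one_mul_choose_eq (i + j) i
  simp only [reflMat, if_neg (Finset.ne_of_mem_erase hm), h1]
  rw [show i + 1 + j + 1 = i + j + 2 by ring]
  ring

/-- As for `reflMat`, now with `(p + 1) C(p, i) = (i + 1) C(p + 1, i + 1)` and the expansion of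
`hasSum_mobius`. -/
theorem tsum_bergMat {a : Fin n → ℂ} {R : Fin n → ℝ} (ρ : Fin n → ℂ) (h : Admissible a R)
    {d : Fin n × ℕ → ℂ} {M : ℝ} (hd : ∀ q, ‖d q‖ ≤ M) (k : Fin n) (i : ℕ) :
    (R k : ℂ) * ∑' q, bergMat a R ρ (k, i) q * d q =
      ((i + 1 : ℕ) : ℂ) * ∑ m, conj (ρ m) * (R m * ((∑' j, d (m, j) *
        ((R m : ℂ) ^ (j + 1) * ∑' p : ℕ, (p.choose j : ℂ) * conj (a m) ^ (p - j) *
          (((p + 1).choose (i + 1) : ℂ) * a k ^ (p + 1 - (i + 1))))) * (R k : ℂ) ^ (i + 1))) := by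
  have hs : Summable fun q => bergMat a R ρ (k, i) q * d q :=
    summable_mul_bounded ((summable_bergMat ρ h).prod_factor (k, i)) hd
  rw [tsum_fin_prod hs, Finset.mul_sum, Finset.mul_sum]
  refine Finset.sum_congr rfl fun m hm => ?_
  simp only [bergMat, bergmanCoeff, ← tsum_mul_left, ← tsum_mul_right]
  refine tsum_congr fun j => tsum_congr fun p => ?_
  have h1 : ((p + 1 : ℕ) : ℂ) * (p.choose i : ℂ) =
      ((p + 1).choose (i + 1) : ℂ) * ((i + 1 : ℕ) : ℂ) := by
    exact_mod_cast Nat.add_one_mul_choose_eq p i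
  rw [Nat.add_sub_add_right]
  linear_combination (a k ^ (p - i) * (R k : ℂ) ^ (i + 1) * conj (ρ m) * (R m : ℂ) ^ (j + 2) *
    (p.choose j : ℂ) * conj (a m) ^ (p - j) * d (m, j)) * h1

/-- The dictionary between the functional equation in the disk `k` and the coefficient equations. It
is stated for the derivative, with factor `i + 1`: this drops the constant term, which the value
`φ_k (a_k)` absorbs, and makes the matrices symmetric up to the weights `R_k ^ 2`. -/
theorem exists_coeff {a : Fin n → ℂ} {R : Fin n → ℝ} (ρ : Fin n → ℂ) (h : Admissible a R)
    {d : Fin n × ℕ → ℂ} {M : ℝ} (hd : ∀ q, ‖d q‖ ≤ M) (lam : ℂ) (k : Fin n) :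
    ∃ c : ℕ → ℂ, (∀ ζ : ℂ, ‖ζ‖ ≤ 1 → HasSum (fun i => c i * ζ ^ i)
      (lam * ∑ m ∈ Finset.univ.erase k, ρ m * sRefl a R d m (a k + R k * ζ) -
        ∑ m, conj (ρ m) * uRefl a R d m (a k + R k * ζ))) ∧
      ∀ i, ((i + 1 : ℕ) : ℂ) * c (i + 1) =
        R k * (lam * ∑' q, reflMat a R ρ (k, i) q * conj (d q) -
          ∑' q, bergMat a R ρ (k, i) q * d q) := by
  refine ⟨fun i => lam * ∑ m ∈ Finset.univ.erase k, ρ m * (R m * ((∑' j, conj (d (m, j)) *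
        ((-1) ^ i * ((i + j).choose i : ℂ) * (R m : ℂ) ^ (j + 1) *
          (a k - a m)⁻¹ ^ (i + j + 1))) * (R k : ℂ) ^ i)) -
      ∑ m, conj (ρ m) * (R m * ((∑' j, d (m, j) *
        ((R m : ℂ) ^ (j + 1) * ∑' p : ℕ, (p.choose j : ℂ) * conj (a m) ^ (p - j) *
          (((p + 1).choose i : ℂ) * a k ^ (p + 1 - i)))) * (R k : ℂ) ^ i)), ?_, ?_⟩
  · intro ζ hζ
    have hx : ‖(R k : ℂ) * ζ‖ ≤ R k := by
      rw [norm_mul, Complex.norm_real, Real.norm_eq_abs, abs_of_pos (h.pos k)]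
      exact mul_le_of_le_one_right (h.pos k).le hζ
    have hA : ∀ m ∈ Finset.univ.erase k, HasSum (fun i => ρ m * (R m * ((∑' j, conj (d (m, j)) *
        ((-1) ^ i * ((i + j).choose i : ℂ) * (R m : ℂ) ^ (j + 1) *
          (a k - a m)⁻¹ ^ (i + j + 1))) * (R k : ℂ) ^ i)) * ζ ^ i)
        (ρ m * sRefl a R d m (a k + R k * ζ)) := by
      intro m hm
      have h1 := hasSum_inversion (c := fun j => conj (d (m, j))) (M := M)
        (fun j => by rw [RCLike.norm_conj]; exact hd _) (x := (R k : ℂ) * ζ) (y := (R m : ℂ))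
        (α := a k - a m) (by
          rw [Complex.norm_real, Real.norm_eq_abs, abs_of_pos (h.pos m)]
          linarith [h.disjoint k m (Finset.ne_of_mem_erase hm).symm])
      have h2 := (h1.mul_left (R m : ℂ)).mul_left (ρ m)
      rw [sRefl, show a k + R k * ζ - a m = a k - a m + R k * ζ by ring]
      exact h2.congr_fun fun i => by rw [mul_pow]; ring
    have hB : ∀ m ∈ Finset.univ, HasSum (fun i => conj (ρ m) * (R m * ((∑' j, d (m, j) *
        ((R m : ℂ) ^ (j + 1) * ∑' p : ℕ, (p.choose j : ℂ) * conj (a m) ^ (p - j) *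
          (((p + 1).choose i : ℂ) * a k ^ (p + 1 - i)))) * (R k : ℂ) ^ i)) * ζ ^ i)
        (conj (ρ m) * uRefl a R d m (a k + R k * ζ)) := by
      intro m _
      have h1 := hasSum_mobius (c := fun j => d (m, j)) (M := M)
        (fun j => hd _) (x := (R k : ℂ) * ζ) (y := (R m : ℂ)) (a := a k) (b := conj (a m))
        (by linarith [h.lt_one k]) (by
          rw [Complex.norm_real, Real.norm_eq_abs, abs_of_pos (h.pos m), RCLike.norm_conj]
          linarith [h.lt_one m])
      have h2 := (h1.mul_left (R m : ℂ)).mul_left (conj (ρ m))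
      rw [uRefl, show a k + R k * ζ = R k * ζ + a k by ring]
      exact h2.congr_fun fun i => by rw [mul_pow]; ring
    refine (((hasSum_sum hA).mul_left lam).sub (hasSum_sum hB)).congr_fun fun i => ?_
    rw [sub_mul, Finset.sum_mul, mul_assoc, Finset.sum_mul]
  · intro i
    have h1 := tsum_reflMat ρ h hd k i
    have h2 := tsum_bergMat ρ h hd k i
    simp only
    linear_combination -lam * h1 + h2

/-! ### Equivalence of the boundary problem with the coefficient equations -/

/-- The equations for the Taylor coefficients. -/
def CoeffEq (a : Fin n → ℂ) (R : Fin n → ℝ) (ρ : Fin n → ℂ) (lam : ℂ) (d : Fin n × ℕ → ℂ) : Prop :=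
  ∀ p : Fin n × ℕ, lam * (((p.2 + 1 : ℕ) : ℂ) * d p + ∑' q, reflMat a R ρ p q * conj (d q)) =
    ∑' q, bergMat a R ρ p q * d q

/-- The Taylor coefficients `d` describe the functions `φi`, `φ0`. -/
structure Represents (a : Fin n → ℂ) (R : Fin n → ℝ) (ρ : Fin n → ℂ) (lam : ℂ)
    (d : Fin n × ℕ → ℂ) (φi : Fin n → ℂ → ℂ) (φ0 : ℂ → ℂ) : Prop where
  deriv_eq : ∀ k, deriv (φi k) (a k) = d (k, 0)
  exterior_eq : ∀ z : ℂ, 1 ≤ ‖z‖ → conj lam * φ0 z = -∑ m, ρ m * sRefl a R d m z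

theorem pser_const_mul (b : ℂ) (c : ℕ → ℂ) (w : ℂ) : pser (fun j => b * c j) w = b * pser c w := by
  simp only [pser, mul_assoc, tsum_mul_left]

theorem conj_sRefl (a : Fin n → ℂ) (R : Fin n → ℝ) (d : Fin n × ℕ → ℂ) (m : Fin n) {z : ℂ}
    (hz : z ≠ 0) : conj (sRefl a R d m (conj z)⁻¹) = uRefl a R d m z := by
  have h : z⁻¹ - conj (a m) = z⁻¹ * (1 - conj (a m) * z) := by field_simp
  simp only [sRefl, uRefl, map_mul, Complex.conj_ofReal, conj_pser, map_div₀, map_sub, map_inv₀,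
    Complex.conj_conj]
  rw [h, div_eq_mul_inv, mul_inv, inv_inv]

theorem uRefl_zero (a : Fin n → ℂ) (R : Fin n → ℝ) (d : Fin n × ℕ → ℂ) (m : Fin n) :
    uRefl a R d m 0 = 0 := by simp [uRefl, pser_zero]

theorem circleReflection_eq_sRefl {a : Fin n → ℂ} {R : Fin n → ℝ} (hR : ∀ k, 0 < R k)
    {d : Fin n × ℕ → ℂ} {φi : Fin n → ℂ → ℂ}
    (hφ : ∀ k, ∀ w : ℂ, ‖w‖ < 1 →
      φi k (a k + R k * w) = φi k (a k) + R k * pser (fun j => d (k, j)) w)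
    (m : Fin n) {z : ℂ} (hz : R m < ‖z - a m‖) :
    circleReflection (a m) (R m) (φi m) z = sRefl a R d m z := by
  have h1 : ‖(R m : ℂ) / conj (z - a m)‖ < 1 := by
    rw [norm_div, RCLike.norm_conj, Complex.norm_real, Real.norm_eq_abs, abs_of_pos (hR m),
      div_lt_one ((hR m).trans hz)]
    exact hz
  have h2 := hφ m _ h1
  rw [circleReflection, sq, mul_div_assoc, h2, map_add, add_sub_cancel_left, map_mul,
    Complex.conj_ofReal, conj_pser, map_div₀, Complex.conj_conj, Complex.conj_ofReal, sRefl]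

theorem deriv_of_pser {f : ℂ → ℂ} {c : ℕ → ℂ} {M : ℝ} (hc : ∀ j, ‖c j‖ ≤ M) {a : ℂ} {R : ℝ}
    (hR : 0 < R) (hf : ∀ w : ℂ, ‖w‖ < 1 → f (a + R * w) = f a + R * pser c w) :
    deriv f a = c 0 := by
  have hR0 : (R : ℂ) ≠ 0 := by exact_mod_cast hR.ne'
  have h1 : HasDerivAt (fun z => f a + R * pser c ((z - a) / R)) (R * (c 0 * (1 / R))) a := by
    have h2 : HasDerivAt (fun z : ℂ => (z - a) / R) (1 / R) a :=
      ((hasDerivAt_id a).sub_const a).div_const _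
    have h3 : HasDerivAt (pser c) (c 0) ((a - a) / R) := by
      simpa using hasDerivAt_pser_zero hc
    exact ((h3.comp a h2).const_mul (R : ℂ)).const_add _
  have h4 : f =ᶠ[𝓝 a] fun z => f a + R * pser c ((z - a) / R) := by
    filter_upwards [ball_mem_nhds a hR] with z hz
    rw [mem_ball, dist_eq_norm] at hz
    rw [← hf _ (by rwa [norm_div, Complex.norm_real, Real.norm_eq_abs, abs_of_pos hR,
      div_lt_one hR]), mul_div_cancel₀ _ hR0, add_sub_cancel]
  rw [(h1.congr_of_eventuallyEq h4).deriv]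
  field_simp

theorem hasSum_cons {c : ℕ → ℂ} {M : ℝ} (hc : ∀ j, ‖c j‖ ≤ M) (b x : ℂ) {w : ℂ} (hw : ‖w‖ < 1) :
    HasSum (fun i => (Nat.casesOn i x fun j => b * c j : ℂ) * w ^ i) (x + b * pser c w) := by
  rw [← hasSum_nat_add_iff' 1]
  have := (summable_pser hc hw).hasSum.mul_left b
  simpa [mul_assoc, pser] using this

/-- The Taylor coefficients of an eigensolution satisfy the coefficient equations. -/
theorem IsEigensolution.exists_coeffEq {a : Fin n → ℂ} {R : Fin n → ℝ} (h : Admissible a R)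
    {ρ : Fin n → ℂ} {lam : ℂ} {φ : ℂ → ℂ} {φi : Fin n → ℂ → ℂ} {φ0 : ℂ → ℂ}
    (hs : IsEigensolution a R ρ lam φ φi φ0) :
    ∃ (d : Fin n × ℕ → ℂ) (M : ℝ), (∀ q, ‖d q‖ ≤ M) ∧ d ≠ 0 ∧ CoeffEq a R ρ lam d ∧
      Represents a R ρ lam d φi φ0 := by
  obtain ⟨hlam, hsol, z₀, hz₀, hφz₀⟩ := hs
  obtain ⟨hin, hout⟩ := hsol.functional_equations h
  have hR0 : ∀ k, (R k : ℂ) ≠ 0 := fun k => by exact_mod_cast (h.pos k).ne'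
  have hball : ∀ k (w : ℂ), ‖(R k : ℂ) * w‖ = R k * ‖w‖ := fun k w => by
    rw [norm_mul, Complex.norm_real, Real.norm_eq_abs, abs_of_pos (h.pos k)]
  have htaylor : ∀ k, ∃ (c : ℕ → ℂ) (M : ℝ), (∀ j, ‖c j‖ ≤ M) ∧ ∀ w : ℂ, ‖w‖ < 1 →
      φi k (a k + R k * w) = φi k (a k) + pser c w := by
    intro k
    have h1 : DifferentiableOn ℂ (fun w => φi k (a k + R k * w)) (ball 0 1) := by
      refine (hsol.analytic_inclusion k).comp (by fun_prop) fun w hw => ?_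
      rw [mem_ball_zero_iff] at hw
      rw [mem_ball, dist_eq_norm, add_sub_cancel_left, hball]
      exact mul_lt_of_lt_one_right (h.pos k) hw
    have h2 : ContinuousOn (fun w => φi k (a k + R k * w)) (closedBall 0 1) := by
      refine (hsol.continuous_inclusion k).comp (by fun_prop) fun w hw => ?_
      rw [mem_closedBall_zero_iff] at hw
      rw [mem_closedBall, dist_eq_norm, add_sub_cancel_left, hball]
      exact mul_le_of_le_one_right (h.pos k).le hw
    obtain ⟨c, M, hc, hf⟩ := exists_taylor h1 h2
    exact ⟨c, M, hc, fun w hw => by simpa using hf w hw⟩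
  choose c M hcM hc using htaylor
  -- Dividing by `R_k` makes `d (k, 0)` the derivative `φ_k' (a_k)`.
  set d : Fin n × ℕ → ℂ := fun q => (R q.1 : ℂ)⁻¹ * c q.1 q.2 with hd
  have hdM : ∀ q, ‖d q‖ ≤ ∑ k, ‖(R k : ℂ)⁻¹‖ * M k := by
    intro q
    have h1 : ‖d q‖ ≤ ‖(R q.1 : ℂ)⁻¹‖ * M q.1 := by
      rw [hd, norm_mul]; exact mul_le_mul_of_nonneg_left (hcM _ _) (norm_nonneg _)
    refine h1.trans (Finset.single_le_sum (f := fun k => ‖(R k : ℂ)⁻¹‖ * M k) (fun k _ => ?_)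
      (Finset.mem_univ q.1))
    exact mul_nonneg (norm_nonneg _) ((norm_nonneg _).trans (hcM k 0))
  have hφ : ∀ k, ∀ w : ℂ, ‖w‖ < 1 →
      φi k (a k + R k * w) = φi k (a k) + R k * pser (fun j => d (k, j)) w := by
    intro k w hw
    rw [hc k w hw, show (fun j => d (k, j)) = fun j => (R k : ℂ)⁻¹ * c k j from rfl,
      pser_const_mul, mul_inv_cancel_left₀ (hR0 k)]
  have hrep : ∀ z : ℂ, 1 ≤ ‖z‖ → conj lam * φ0 z = -∑ m, ρ m * sRefl a R d m z := by
    intro z hz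
    rw [eq_neg_iff_add_eq_zero, ← hout z hz]
    congr 1
    exact Finset.sum_congr rfl fun m _ => by
      rw [circleReflection_eq_sRefl h.pos hφ m (h.lt_norm_sub m hz)]
  have hunit : ∀ z : ℂ, ‖z‖ < 1 →
      lam * unitReflection φ0 z = -∑ m, conj (ρ m) * uRefl a R d m z := by
    intro z hz
    by_cases hz0 : z = 0
    · simp [hz0, unitReflection, uRefl_zero]
    · have h1 : 1 ≤ ‖(conj z)⁻¹‖ := by
        rw [norm_inv, RCLike.norm_conj]
        exact (one_le_inv₀ (norm_pos_iff.2 hz0)).2 hz.le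
      have h2 := congrArg conj (hrep _ h1)
      simp only [map_mul, map_neg, map_sum, Complex.conj_conj, conj_sRefl a R d _ hz0] at h2
      rw [unitReflection, if_neg hz0, h2]
  refine ⟨d, _, hdM, ?_, ?_, ⟨fun k => deriv_of_pser (fun j => hdM (k, j)) (h.pos k) (hφ k), hrep⟩⟩
  · intro hd0
    have h1 := hrep z₀ hz₀
    rw [hd0] at h1
    simp only [sRefl, pser, Pi.zero_apply, map_zero, zero_mul, tsum_zero, mul_zero,
      Finset.sum_const_zero, neg_zero, mul_eq_zero, map_eq_zero] at h1
    exact h1.elim hlam hφz₀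
  · rintro ⟨k, i⟩
    obtain ⟨e, he, he1⟩ := exists_coeff ρ h hdM lam k
    -- The functional equation in the disk `k`, times `lam`, with `lam * unitReflection φ0`
    -- eliminated by the reflected outer identity. Index `0` carries only the constant `lam (φ_k
    -- (a_k) - ρ_k conj (φ_k (a_k)))`, so the equations in `d` start at index `1`.
    have h0 : ∀ w : ℂ, ‖w‖ < 1 → HasSum (fun i => ((Nat.casesOn i
        (lam * (φi k (a k) - ρ k * conj (φi k (a k)))) fun j => lam * R k * d (k, j) : ℂ) + e i) *
          w ^ i) 0 := by
      intro w hw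
      have h1 := (hasSum_cons (fun j => hdM (k, j)) (lam * R k)
        (lam * (φi k (a k) - ρ k * conj (φi k (a k)))) hw).add (he w hw.le)
      have hzk : ‖a k + R k * w - a k‖ ≤ R k := by
        rw [add_sub_cancel_left, hball]
        exact mul_le_of_le_one_right (h.pos k).le hw.le
      have h2 := hin k (a k + R k * w) (by rwa [mem_closedBall, dist_eq_norm])
      rw [hφ k w hw] at h2
      have h3 := hunit _ (h.norm_lt_one hzk)
      have h4 : ∑ m ∈ Finset.univ.erase k, ρ m * circleReflection (a m) (R m) (φi m)
          (a k + R k * w) = ∑ m ∈ Finset.univ.erase k, ρ m * sRefl a R d m (a k + R k * w) :=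
        Finset.sum_congr rfl fun m hm => by
          rw [circleReflection_eq_sRefl h.pos hφ m
            (h.norm_sub_lt (Finset.ne_of_mem_erase hm) hzk)]
      rw [h4] at h2
      convert! h1 using 1
      · funext i; rw [add_mul]
      · linear_combination -lam * h2 + h3
    have h1 := coeff_eq_zero_of_hasSum h0 (i + 1)
    have h2 := he1 i
    simp only at h1
    have h3 : (R k : ℂ) * (lam * (((i + 1 : ℕ) : ℂ) * d (k, i) + ∑' q, reflMat a R ρ (k, i) q *
        conj (d q)) - ∑' q, bergMat a R ρ (k, i) q * d q) = 0 := by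
      linear_combination ((i + 1 : ℕ) : ℂ) * h1 - h2
    exact sub_eq_zero.1 ((mul_eq_zero.1 h3).resolve_left (hR0 k))

/-- Combining the equation with its conjugate leaves the factor `1 - |ρ| ^ 2 ≠ 0`. This is what
allows the constant terms `φ_k (a_k)` to be recovered. -/
theorem exists_sub_conj_eq {ρ : ℂ} (hρ : ‖ρ‖ < 1) (y : ℂ) : ∃ x : ℂ, x - ρ * conj x = y := by
  have h1 : (1 : ℂ) - ρ * conj ρ ≠ 0 := by
    rw [Complex.mul_conj, Complex.normSq_eq_norm_sq, ← Complex.ofReal_one, ← Complex.ofReal_sub]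
    have : ‖ρ‖ ^ 2 < 1 := pow_lt_one₀ (norm_nonneg _) hρ two_ne_zero
    exact_mod_cast (sub_pos.2 this).ne'
  have h2 : (1 : ℂ) - conj ρ * ρ ≠ 0 := by rwa [mul_comm (conj ρ)]
  refine ⟨(y + ρ * conj y) / (1 - ρ * conj ρ), ?_⟩
  simp only [map_div₀, map_add, map_mul, map_sub, map_one, Complex.conj_conj]
  rw [mul_comm (conj ρ) ρ]
  field_simp
  ring

theorem summable_tsum_mul {ι : Type*} {K : ι → ι → ℂ}
    (hK : Summable fun x : ι × ι => ‖K x.1 x.2‖) {e : ι → ℂ} {M : ℝ} (he : ∀ q, ‖e q‖ ≤ M) :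
    Summable fun p => ∑' q, K p q * e q := by
  have h1 := summable_mul_bounded (f := fun x : ι × ι => K x.1 x.2) hK (c := fun x => e x.2)
    fun x => he x.2
  exact h1.prod

/-- As `lam ≠ 0`, the equations express `(j + 1) d` through summable matrices applied to bounded
sequences. Bounded solutions thus gain summability, which gives continuity of the reconstructed
functions up to the circles. -/
theorem CoeffEq.summable {a : Fin n → ℂ} {R : Fin n → ℝ} (h : Admissible a R)
    {ρ : Fin n → ℂ} {lam : ℂ} (hlam : lam ≠ 0) {d : Fin n × ℕ → ℂ} {M : ℝ} (hd : ∀ q, ‖d q‖ ≤ M)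
    (hc : CoeffEq a R ρ lam d) : Summable fun p => ((p.2 + 1 : ℕ) : ℂ) * d p := by
  have hA := summable_tsum_mul (K := reflMat a R ρ) (summable_reflMat ρ h)
    (e := fun q => conj (d q)) (M := M) fun q => by rw [RCLike.norm_conj]; exact hd q
  have hB := summable_tsum_mul (K := bergMat a R ρ) (summable_bergMat ρ h) hd
  refine ((hB.mul_left lam⁻¹).sub hA).congr fun p => ?_
  rw [← hc p, inv_mul_cancel_left₀ hlam]; ring

/-- A nonzero solution of the coefficient equations yields an eigensolution. -/
theorem CoeffEq.exists_eigensolution {a : Fin n → ℂ} {R : Fin n → ℝ} (h : Admissible a R)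
    {ρ : Fin n → ℂ} (hρ : ∀ k, ‖ρ k‖ < 1) {lam : ℂ} (hlam : lam ≠ 0) {d : Fin n × ℕ → ℂ} {M : ℝ}
    (hd : ∀ q, ‖d q‖ ≤ M) (hc : CoeffEq a R ρ lam d)
    (hinj : ¬∀ p : Fin n × ℕ,
      ((p.2 + 1 : ℕ) : ℂ) * d p + ∑' q, reflMat a R ρ p q * conj (d q) = 0) :
    ∃ φ φi φ0, IsEigensolution a R ρ lam φ φi φ0 ∧ Represents a R ρ lam d φi φ0 := by
  have hR0 : ∀ k, (R k : ℂ) ≠ 0 := fun k => by exact_mod_cast (h.pos k).ne'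
  have hball : ∀ k (w : ℂ), ‖(R k : ℂ) * w‖ = R k * ‖w‖ := fun k w => by
    rw [norm_mul, Complex.norm_real, Real.norm_eq_abs, abs_of_pos (h.pos k)]
  have hclam : conj lam ≠ 0 := (map_ne_zero _).2 hlam
  have hdsum : ∀ k, Summable fun j => d (k, j) := by
    intro k
    refine Summable.of_norm_bounded ((hc.summable h hlam hd).prod_factor k).norm fun j => ?_
    rw [norm_mul, Complex.norm_natCast]
    exact le_mul_of_one_le_left (norm_nonneg _) (by push_cast; linarith [j.cast_nonneg (α := ℝ)])
  have hcsum : ∀ k, Summable fun j => conj (d (k, j)) := fun k =>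
    Complex.hasSum_conj'.mpr ((hdsum k).hasSum) |>.summable
  have hcd : ∀ q, ‖conj (d q)‖ ≤ M := fun q => by rw [RCLike.norm_conj]; exact hd q
  choose e he he1 using fun k => exists_coeff ρ h hd lam k
  have he2 : ∀ k i, e k (i + 1) = -(lam * R k * d (k, i)) := by
    intro k i
    have h1 := he1 k i
    have h2 := hc (k, i)
    simp only at h2
    have h3 : ((i + 1 : ℕ) : ℂ) ≠ 0 := by exact_mod_cast Nat.succ_ne_zero i
    refine mul_left_cancel₀ h3 ?_
    linear_combination h1 + R k * h2
  -- `x k` will be `φ_k (a_k)`, chosen so that the constant term of the functional equation in the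
  -- disk `k` cancels.
  choose x hx using fun k => exists_sub_conj_eq (hρ k) (-(lam⁻¹ * e k 0))
  have hfun : ∀ k, ∀ ζ : ℂ, ‖ζ‖ ≤ 1 →
      lam * (x k - ρ k * conj (x k) + R k * pser (fun j => d (k, j)) ζ +
        ∑ m ∈ Finset.univ.erase k, ρ m * sRefl a R d m (a k + R k * ζ)) -
          ∑ m, conj (ρ m) * uRefl a R d m (a k + R k * ζ) = 0 := by
    intro k ζ hζ
    have h1 := he k ζ hζ
    have h2 := h1.tsum_eq
    rw [h1.summable.tsum_eq_zero_add] at h2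
    have h3 : ∑' i, e k (i + 1) * ζ ^ (i + 1) = -(lam * R k) * pser (fun j => d (k, j)) ζ := by
      rw [pser, ← tsum_mul_left]
      exact tsum_congr fun i => by rw [he2]; ring
    rw [h3, pow_zero, mul_one] at h2
    have h4 : lam * (-(lam⁻¹ * e k 0)) = -e k 0 := by
      rw [mul_neg, mul_inv_cancel_left₀ hlam]
    linear_combination lam * hx k + h4 - h2
  -- regularity of the pieces
  have hsw : ∀ m (z : ℂ), R m ≤ ‖z - a m‖ → ‖(R m : ℂ) / (z - a m)‖ ≤ 1 := by
    intro m z hz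
    rw [norm_div, Complex.norm_real, Real.norm_eq_abs, abs_of_pos (h.pos m)]
    exact (div_le_one ((h.pos m).trans_le hz)).2 hz
  have hsw' : ∀ m (z : ℂ), R m < ‖z - a m‖ → ‖(R m : ℂ) / (z - a m)‖ < 1 := by
    intro m z hz
    rw [norm_div, Complex.norm_real, Real.norm_eq_abs, abs_of_pos (h.pos m)]
    exact (div_lt_one ((h.pos m).trans hz)).2 hz
  have hsc : ∀ m, ContinuousOn (sRefl a R d m) {z | R m ≤ ‖z - a m‖} := by
    intro m
    refine continuousOn_const.mul ((pser_continuousOn (hcsum m)).comp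
      (continuousOn_const.div (by fun_prop) ?_) ?_)
    · intro z hz; exact norm_pos_iff.1 ((h.pos m).trans_le hz)
    · intro z hz; simpa using hsw m z hz
  have hsd : ∀ m (z : ℂ), R m < ‖z - a m‖ → DifferentiableAt ℂ (sRefl a R d m) z := by
    intro m z hz
    have h1 : DifferentiableAt ℂ (pser fun j => conj (d (m, j))) (R m / (z - a m)) :=
      (pser_differentiableOn fun j => hcd (m, j)).differentiableAt
        (isOpen_ball.mem_nhds (by simpa using hsw' m z hz))
    have h2 : DifferentiableAt ℂ (fun z => (R m : ℂ) / (z - a m)) z := by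
      have : z - a m ≠ 0 := norm_pos_iff.1 ((h.pos m).trans hz)
      fun_prop (disch := exact this)
    exact (h1.comp z h2).const_mul _
  have hsinf : ∀ m, Tendsto (sRefl a R d m) (cocompact ℂ) (𝓝 0) := by
    intro m
    have h1 : Tendsto (fun z : ℂ => (R m : ℂ) / (z - a m)) (cocompact ℂ) (𝓝 0) := by
      have h3 : Tendsto (fun z : ℂ => z - a m) (cocompact ℂ) (cocompact ℂ) :=
        (Homeomorph.subRight (a m)).isClosedEmbedding.tendsto_cocompact
      have h2 := ((tendsto_inv₀_cobounded (α := ℂ)).comp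
        (h3.mono_right (Metric.cobounded_eq_cocompact (α := ℂ)).ge)).const_mul (R m : ℂ)
      simpa [div_eq_mul_inv] using h2
    have h2 := ((hasDerivAt_pser_zero fun j => hcd (m, j)).continuousAt.tendsto.comp h1).const_mul
      (R m : ℂ)
    have h3 : sRefl a R d m = fun z => R m * pser (fun j => conj (d (m, j))) (R m / (z - a m)) :=
      rfl
    rw [h3]
    simpa [pser_zero] using h2
  have hden : ∀ m (z : ℂ), ‖z‖ ≤ 1 → R m < ‖1 - conj (a m) * z‖ := by
    intro m z hz
    have h1 : ‖conj (a m) * z‖ ≤ ‖a m‖ := by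
      rw [norm_mul, RCLike.norm_conj]; exact mul_le_of_le_one_right (norm_nonneg _) hz
    have h2 := norm_sub_norm_le (1 : ℂ) (conj (a m) * z)
    rw [norm_one] at h2
    linarith [h.lt_one m]
  have hud : ∀ m (z : ℂ), ‖z‖ ≤ 1 → DifferentiableAt ℂ (uRefl a R d m) z := by
    intro m z hz
    have h0 := hden m z hz
    have h3 : (1 : ℂ) - conj (a m) * z ≠ 0 := norm_pos_iff.1 ((h.pos m).trans h0)
    have h1 : DifferentiableAt ℂ (pser fun j => d (m, j))
        (R m * (z * (1 - conj (a m) * z)⁻¹)) := by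
      refine (pser_differentiableOn fun j => hd (m, j)).differentiableAt
        (isOpen_ball.mem_nhds ?_)
      rw [mem_ball_zero_iff, hball, norm_mul, norm_inv]
      calc R m * (‖z‖ * ‖1 - conj (a m) * z‖⁻¹) ≤ R m * (1 * ‖1 - conj (a m) * z‖⁻¹) := by
            have := (h.pos m).le
            gcongr
        _ = R m / ‖1 - conj (a m) * z‖ := by rw [one_mul, div_eq_mul_inv]
        _ < 1 := (div_lt_one ((h.pos m).trans h0)).2 h0
    have h2 : DifferentiableAt ℂ (fun z => (R m : ℂ) * (z * (1 - conj (a m) * z)⁻¹)) z := by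
      fun_prop (disch := exact h3)
    exact (h1.comp z h2).const_mul _
  set S : ℂ → ℂ := fun z => ∑ m, ρ m * sRefl a R d m z with hS
  set U : ℂ → ℂ := fun z => ∑ m, conj (ρ m) * uRefl a R d m z with hU
  have hSd : ∀ z, (∀ m, R m < ‖z - a m‖) → DifferentiableAt ℂ S z := fun z hz =>
    DifferentiableAt.fun_sum fun m _ => (hsd m z (hz m)).const_mul _
  have hSc : ContinuousOn S {z | ∀ m, R m ≤ ‖z - a m‖} :=
    continuousOn_finsetSum _ fun m _ => ((hsc m).mono fun z (hz : ∀ m, R m ≤ ‖z - a m‖) => hz m).const_mul _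
  have hUd : ∀ z : ℂ, ‖z‖ ≤ 1 → DifferentiableAt ℂ U z := fun z hz =>
    DifferentiableAt.fun_sum fun m _ => (hud m z hz).const_mul _
  have hSU : ∀ z : ℂ, z ≠ 0 → conj (S (conj z)⁻¹) = U z := by
    intro z hz
    simp only [hS, hU, map_sum, map_mul, conj_sRefl a R d _ hz]
  -- The two definitions are forced: `φ0` by the outer functional equation, and `φ` by the vanishing
  -- of the glued function in the perforated disk.
  set φ0 : ℂ → ℂ := fun z => -((conj lam)⁻¹ * S z) with hφ0
  set φ : ℂ → ℂ := fun z => lam⁻¹ * U z - S z with hφ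
  set φi : Fin n → ℂ → ℂ := fun k z => x k + R k * pser (fun j => d (k, j)) ((z - a k) / R k)
    with hφi
  have hφiw : ∀ k w, φi k (a k + R k * w) = x k + R k * pser (fun j => d (k, j)) w := by
    intro k w
    simp only [hφi, add_sub_cancel_left, mul_div_cancel_left₀ _ (hR0 k)]
  have hφia : ∀ k, φi k (a k) = x k := fun k => by simp [hφi, pser_zero]
  have hnorm_div : ∀ k (z : ℂ), ‖(z - a k) / R k‖ = ‖z - a k‖ / R k := fun k z => by
    rw [norm_div, Complex.norm_real, Real.norm_eq_abs, abs_of_pos (h.pos k)]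
  have hrep : Represents a R ρ lam d φi φ0 := by
    refine ⟨fun k => deriv_of_pser (fun j => hd (k, j)) (h.pos k) fun w hw => ?_, fun z hz => ?_⟩
    · rw [hφiw, hφia]
    · simp only [hφ0, hS, mul_neg, mul_inv_cancel_left₀ hclam]
  refine ⟨φ, φi, φ0, ⟨hlam, ⟨?_, ?_, ?_, ?_, ?_, ?_, ?_, ?_, ?_⟩, ?_⟩, hrep⟩
  · intro z hz
    exact (((hUd z hz.1.le).const_mul _).sub (hSd z hz.2)).differentiableWithinAt
  · refine ContinuousOn.sub (fun z hz => ?_) (hSc.mono fun z hz => hz.2)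
    exact ((hUd z hz.1).continuousAt.const_mul _).continuousWithinAt
  · intro k
    refine ((pser_differentiableOn fun j => hd (k, j)).comp (by fun_prop) fun z hz => ?_).const_mul _
      |>.const_add _
    rw [mem_ball, dist_eq_norm] at hz
    rw [mem_ball_zero_iff, hnorm_div]
    exact (div_lt_one (h.pos k)).2 hz
  · intro k
    refine continuousOn_const.add (((pser_continuousOn (hdsum k)).comp (by fun_prop)
      fun z hz => ?_).const_mul _)
    rw [mem_closedBall, dist_eq_norm] at hz
    rw [mem_closedBall_zero_iff, hnorm_div]
    exact (div_le_one (h.pos k)).2 hz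
  · intro z hz
    exact ((hSd z fun m => h.lt_norm_sub m (le_of_lt hz)).const_mul _).neg.differentiableWithinAt
  · exact ((hSc.mono fun z hz m => (h.lt_norm_sub m hz).le).const_mul _).neg
  · have h1 : Tendsto S (cocompact ℂ) (𝓝 0) := by
      have := tendsto_finsetSum Finset.univ fun m _ => (hsinf m).const_mul (ρ m)
      simpa using this
    simpa using (h1.const_mul (conj lam)⁻¹).neg
  · intro k t ht
    have htk : ‖t - a k‖ = R k := by simpa [dist_eq_norm] using ht
    set ζ : ℂ := (t - a k) / R k with hζ
    have hζ1 : ‖ζ‖ = 1 := by rw [hζ, hnorm_div, htk, div_self (h.pos k).ne']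
    have ht2 : t = a k + R k * ζ := by rw [hζ, mul_div_cancel₀ _ (hR0 k), add_sub_cancel]
    have h1 := hfun k ζ hζ1.le
    rw [← ht2] at h1
    have hsk : sRefl a R d k t = conj (R k * pser (fun j => d (k, j)) ζ) := by
      have h2 : conj ζ = R k / (t - a k) := by
        have h3 : ζ * conj ζ = 1 := by rw [Complex.mul_conj, Complex.normSq_eq_norm_sq, hζ1]; simp
        have h4 : t - a k = R k * ζ := by rw [ht2]; ring
        rw [h4, eq_div_iff (mul_ne_zero (hR0 k) (norm_pos_iff.1 (hζ1 ▸ one_pos)))]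
        linear_combination (R k : ℂ) * h3
      rw [sRefl, map_mul, Complex.conj_ofReal, conj_pser, h2]
    have h5 : S t = ρ k * sRefl a R d k t +
        ∑ m ∈ Finset.univ.erase k, ρ m * sRefl a R d m t := by
      rw [hS, Finset.add_sum_erase _ (fun m => ρ m * sRefl a R d m t) (Finset.mem_univ k)]
    have h6 : φi k t = x k + R k * pser (fun j => d (k, j)) ζ := by rw [ht2, hφiw]
    have h7 : lam⁻¹ * U t = x k - ρ k * conj (x k) + R k * pser (fun j => d (k, j)) ζ +
        ∑ m ∈ Finset.univ.erase k, ρ m * sRefl a R d m t := by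
      rw [inv_mul_eq_iff_eq_mul₀ hlam]
      linear_combination -h1
    rw [h6, map_add, ← hsk]
    simp only [hφ]
    rw [h7, h5]
    ring
  · intro t ht
    have ht0 : t ≠ 0 := norm_pos_iff.1 (ht ▸ one_pos)
    have h1 : (conj t)⁻¹ = t := by
      rw [inv_eq_iff_eq_inv, Complex.inv_def, Complex.normSq_eq_norm_sq, ht]; simp
    have h2 := hSU t ht0
    rw [h1] at h2
    simp only [hφ, hφ0, mul_neg, mul_inv_cancel_left₀ hclam, map_neg, map_mul, map_inv₀,
      Complex.conj_conj, h2]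
    ring
  -- If `φ0` vanished, then so would `S` outside and, by reflection, `U` in the unit disk. The
  -- Bergman side of the coefficient equations would be zero, and `lam ≠ 0` would contradict `hinj`.
  · by_contra! hcon
    refine hinj fun p => ?_
    have hS0 : ∀ z : ℂ, 1 ≤ ‖z‖ → S z = 0 := by
      intro z hz
      have := hcon z hz
      simpa [hφ0, hlam] using this
    have hU0 : ∀ z : ℂ, ‖z‖ ≤ 1 → U z = 0 := by
      intro z hz
      by_cases hz0 : z = 0
      · simp [hU, hz0, uRefl_zero]
      · rw [← hSU z hz0, hS0, map_zero]
        rw [norm_inv, RCLike.norm_conj]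
        exact (one_le_inv₀ (norm_pos_iff.2 hz0)).2 hz
    -- The parameter `0` isolates the Bergman term.
    obtain ⟨c, hc1, hc2⟩ := exists_coeff ρ h hd 0 p.1
    have h1 : ∀ w : ℂ, ‖w‖ < 1 → HasSum (fun i => c i * w ^ i) 0 := by
      intro w hw
      have h2 := hc1 w hw.le
      have h3 : U (a p.1 + R p.1 * w) = 0 := by
        refine hU0 _ (h.norm_lt_one (k := p.1) ?_).le
        rw [add_sub_cancel_left, hball]
        exact mul_le_of_le_one_right (h.pos _).le hw.le
      simp only [hU] at h3
      rwa [h3, zero_mul, sub_zero] at h2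
    have h2 := hc2 p.2
    rw [coeff_eq_zero_of_hasSum h1, mul_zero, zero_mul, zero_sub, eq_comm, mul_eq_zero,
      or_iff_right (hR0 _), neg_eq_zero] at h2
    have h3 := hc p
    rw [h2, mul_eq_zero, or_iff_right hlam] at h3
    exact h3

/-! ### Bounds uniform in the ratios of the radii -/

/-- Quantitative separation of the centres from each other and from the unit circle. -/
structure Separated (a : Fin n → ℂ) (s : ℝ) : Prop where
  pos : 0 < s
  lt_one : s < 1
  norm_le : ∀ k, ‖a k‖ + 2 * s ≤ 1
  dist_ge : ∀ k m, k ≠ m → 4 * s ≤ ‖a k - a m‖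

theorem exists_separated {a : Fin n → ℂ} (ha : ∀ k, ‖a k‖ < 1) (hinj : Function.Injective a) :
    ∃ s, Separated a s := by
  have h1 : ∀ᶠ s in 𝓝[>] (0 : ℝ), ∀ k, ‖a k‖ + 2 * s ≤ 1 := by
    rw [eventually_all]
    intro k
    have : Tendsto (fun s : ℝ => ‖a k‖ + 2 * s) (𝓝[>] 0) (𝓝 (‖a k‖ + 2 * 0)) :=
      (Continuous.tendsto (by fun_prop) 0).mono_left nhdsWithin_le_nhds
    filter_upwards [this.eventually (gt_mem_nhds (show ‖a k‖ + 2 * 0 < 1 by simpa using ha k))] with s hs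
    exact hs.le
  have h2 : ∀ᶠ s in 𝓝[>] (0 : ℝ), ∀ k m, k ≠ m → 4 * s ≤ ‖a k - a m‖ := by
    rw [eventually_all]; intro k
    rw [eventually_all]; intro m
    by_cases hkm : k = m
    · simp [hkm]
    have : Tendsto (fun s : ℝ => 4 * s) (𝓝[>] 0) (𝓝 (4 * 0)) :=
      (Continuous.tendsto (by fun_prop) 0).mono_left nhdsWithin_le_nhds
    filter_upwards [this.eventually (gt_mem_nhds (show 4 * 0 < ‖a k - a m‖ by
      rw [mul_zero]; exact norm_pos_iff.2 (sub_ne_zero.2 (hinj.ne hkm))))] with s hs _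
    exact hs.le
  have h3 : ∀ᶠ s in 𝓝[>] (0 : ℝ), s < 1 :=
    nhdsWithin_le_nhds (gt_mem_nhds one_pos)
  obtain ⟨s, hs1, hs2, hs3, hs4⟩ := (h1.and (h2.and (h3.and self_mem_nhdsWithin))).exists
  exact ⟨s, hs4, hs3, hs1, hs2⟩

theorem Separated.admissible {a : Fin n → ℂ} {s : ℝ} (h : Separated a s) {R : Fin n → ℝ}
    (hR : ∀ k, 0 < R k ∧ R k ≤ s) : Admissible a R where
  pos k := (hR k).1
  lt_one k := by linarith [h.norm_le k, (hR k).2, h.pos]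
  disjoint k m hkm := by linarith [h.dist_ge k m hkm, (hR k).2, (hR m).2, h.pos]

theorem radii_pos {ν : Fin n → ℝ} (hν : IsRatio ν) {r : ℝ} (hr : 0 < r) (k : Fin n) :
    0 < radii ν r k := mul_pos hr (Real.sqrt_pos.2 (hν.1 k).1)

theorem radii_le {ν : Fin n → ℝ} (hν : IsRatio ν) {r : ℝ} (hr : 0 < r) (k : Fin n) :
    radii ν r k ≤ r :=
  mul_le_of_le_one_right hr.le (Real.sqrt_le_one.2 (hν.1 k).2)

theorem radii_sq {ν : Fin n → ℝ} (hν : IsRatio ν) (r : ℝ) (k : Fin n) :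
    radii ν r k ^ 2 = r ^ 2 * ν k := by
  rw [radii, mul_pow, Real.sq_sqrt (hν.1 k).1.le]

/-- The factor `R_m ^ 2` makes the sum of order `r ^ 2`; one power of `r` is given up so that the
constant is the same as in `Separated.bergRest_bound`. -/
theorem Separated.tsum_reflMat_le {a : Fin n → ℂ} {s : ℝ} (h : Separated a s) {ρ : Fin n → ℂ}
    (hρ : ∀ k, ‖ρ k‖ < 1) {ν : Fin n → ℝ} (hν : IsRatio ν) {r : ℝ} (hr : 0 < r) (hrs : r ≤ s) :
    ∑' x : (Fin n × ℕ) × (Fin n × ℕ), ‖reflMat a (radii ν r) ρ x.1 x.2‖ ≤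
      (n : ℝ) ^ 2 / s ^ 3 * r := by
  have hR0 := radii_pos hν hr
  have hRr := radii_le hν hr
  have hs := h.pos
  have h1 : ∀ k m, ∃ S ≤ r / s ^ 3, HasSum (fun p : ℕ × ℕ =>
      ‖reflMat a (radii ν r) ρ (k, p.1) (m, p.2)‖) S := by
    intro k m
    by_cases hkm : m = k
    · exact ⟨0, by positivity, by simp [reflMat, hkm, hasSum_zero]⟩
    · have hα := h.dist_ge k m (Ne.symm hkm)
      have hα0 : 0 < ‖a k - a m‖ := by linarith
      refine ⟨_, ?_, hasSum_norm_reflMat ρ hR0 hkm (by linarith [hRr k, hRr m])⟩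
      have hX : ∀ i, radii ν r i / ‖a k - a m‖ ≤ r / (4 * s) := fun i => by
        have := hRr i; gcongr
      have hX0 : ∀ i, 0 ≤ radii ν r i / ‖a k - a m‖ := fun i => div_nonneg (hR0 i).le hα0.le
      have hr4 : r / (4 * s) ≤ 1 / 4 := by
        rw [div_le_div_iff₀ (by positivity) (by norm_num)]; linarith
      have h2 : ((1 - (radii ν r k / ‖a k - a m‖ + radii ν r m / ‖a k - a m‖)) ^ 2)⁻¹ ≤ 4 := by
        have h3 : (1 : ℝ) / 2 ≤ 1 - (radii ν r k / ‖a k - a m‖ + radii ν r m / ‖a k - a m‖) := by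
          linarith [hX k, hX m]
        rw [inv_le_comm₀ (by positivity) (by norm_num)]
        nlinarith
      have h4 : ‖ρ m‖ * (radii ν r m / ‖a k - a m‖) ^ 2 ≤ 1 * (r / (4 * s)) ^ 2 := by
        have := hX m; have := hX0 m; have := (hρ m).le
        gcongr
      calc _ ≤ 1 * (r / (4 * s)) ^ 2 * 4 := by gcongr
        _ = (r / s ^ 3) * (r * s / 4) := by field_simp
        _ ≤ (r / s ^ 3) * 1 := by
          have := h.lt_one
          gcongr
          nlinarith
        _ = _ := mul_one _
  choose S hS hsum using h1
  have h2 := hasSum_pairs (g := fun x => ‖reflMat a (radii ν r) ρ x.1 x.2‖)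
    (fun x => norm_nonneg _) hsum
  rw [h2.tsum_eq]
  calc ∑ k, ∑ m, S k m ≤ ∑ _k : Fin n, ∑ _m : Fin n, r / s ^ 3 :=
        Finset.sum_le_sum fun k _ => Finset.sum_le_sum fun m _ => hS k m
    _ = _ := by simp; ring

/-- The part of `bergMat`, scaled, that is small with the radii. -/
noncomputable def bergRest (a : Fin n → ℂ) (ν : Fin n → ℝ) (r : ℝ) (ρ : Fin n → ℂ)
    (p q : Fin n × ℕ) : ℂ :=
  if p.2 = 0 ∧ q.2 = 0 then 0
  else ((p.2 + 1 : ℕ) : ℂ)⁻¹ * (((r : ℂ) ^ 2)⁻¹ * bergMat a (radii ν r) ρ p q)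

theorem norm_natCast_succ_inv_le (i : ℕ) : ‖((i + 1 : ℕ) : ℂ)⁻¹‖ ≤ 1 := by
  rw [norm_inv, Complex.norm_natCast]
  exact inv_le_one_of_one_le₀ (by exact_mod_cast Nat.succ_pos i)

/-- Division by `r ^ 2` uses up the factor `R_m ^ 2`. Without the entries `(0, 0)` a power `R_k ^ i
R_m ^ j` with `i + j ≥ 1` remains; compared with `s ^ (i + j)` it yields `r / s`. The Bergman sum is
then taken at the fixed radius `s`, where `‖a m‖ + 2 s ≤ 1` permits `t = 1 - s`. -/
theorem Separated.bergRest_bound {a : Fin n → ℂ} {s : ℝ} (h : Separated a s) {ρ : Fin n → ℂ}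
    (hρ : ∀ k, ‖ρ k‖ < 1) {ν : Fin n → ℝ} (hν : IsRatio ν) {r : ℝ} (hr : 0 < r) (hrs : r ≤ s) :
    (Summable fun x : (Fin n × ℕ) × (Fin n × ℕ) => ‖bergRest a ν r ρ x.1 x.2‖) ∧
    ∑' x : (Fin n × ℕ) × (Fin n × ℕ), ‖bergRest a ν r ρ x.1 x.2‖ ≤ (n : ℝ) ^ 2 / s ^ 3 * r := by
  have hR0 := radii_pos hν hr
  have hRr := radii_le hν hr
  have hs := h.pos
  have h1 : ∀ k m, ∃ S ≤ r / s ^ 3, HasSum (fun p : ℕ × ℕ =>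
      ‖bergRest a ν r ρ (k, p.1) (m, p.2)‖) S := by
    intro k m
    obtain ⟨S, hS, hsum⟩ := hasSum_norm_bergmanCoeff a hs hs (k := k) (m := m) (t := 1 - s)
      (by linarith [h.norm_le k]) (by linarith [h.norm_le m]) (by linarith)
    have hle : ∀ p : ℕ × ℕ, ‖bergRest a ν r ρ (k, p.1) (m, p.2)‖ ≤
        r / s * (s ^ p.1 * s ^ p.2 * ‖bergmanCoeff a (k, p.1) (m, p.2)‖) := by
      rintro ⟨i, j⟩
      by_cases hij : i = 0 ∧ j = 0
      · simp only [bergRest, if_pos hij, norm_zero]; positivity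
      · simp only [bergRest, if_neg hij]
        rw [norm_mul, norm_mul, norm_bergMat ρ hR0]
        have h2 : ‖((r : ℂ) ^ 2)⁻¹‖ = (r ^ 2)⁻¹ := by
          rw [norm_inv, norm_pow, Complex.norm_real, Real.norm_eq_abs, sq_abs]
        rw [h2]
        have h3 : radii ν r k ^ i * radii ν r m ^ j ≤ r / s * (s ^ i * s ^ j) := by
          have h4 : radii ν r k ^ i * radii ν r m ^ j ≤ r ^ i * r ^ j := by
            have := hRr k; have := hRr m; have := (hR0 k).le; have := (hR0 m).le
            gcongr
          have h5 : (r / s) ^ (i + j) ≤ r / s :=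
            pow_le_of_le_one (by positivity) ((div_le_one hs).2 hrs) (by omega)
          calc _ ≤ r ^ i * r ^ j := h4
            _ = (r / s) ^ (i + j) * (s ^ i * s ^ j) := by
              rw [← pow_add, ← pow_add, ← mul_pow, div_mul_cancel₀ _ hs.ne']
            _ ≤ _ := by gcongr
        have h6 : ‖ρ m‖ * radii ν r m ^ 2 ≤ 1 * r ^ 2 := by
          have := hRr m; have := (hR0 m).le; have := (hρ m).le
          gcongr
        have h7 := norm_natCast_succ_inv_le i
        have h8 := (hR0 k).le
        have h9 := (hR0 m).le
        calc _ ≤ 1 * ((r ^ 2)⁻¹ * (1 * r ^ 2 * (r / s * (s ^ i * s ^ j) *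
              ‖bergmanCoeff a (k, i) (m, j)‖))) := by gcongr
          _ = _ := by field_simp
    have hs1 := Summable.of_nonneg_of_le (fun p => norm_nonneg _) hle (hsum.mul_left _).summable
    refine ⟨_, (hasSum_le hle hs1.hasSum (hsum.mul_left _)).trans ?_, hs1.hasSum⟩
    rw [sub_sub_cancel] at hS
    calc r / s * S ≤ r / s * (s ^ 2)⁻¹ := by gcongr
      _ = r / s ^ 3 := by field_simp
  choose S hS hsum using h1
  have h2 := hasSum_pairs (g := fun x => ‖bergRest a ν r ρ x.1 x.2‖) (fun x => norm_nonneg _) hsum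
  refine ⟨h2.summable, ?_⟩
  rw [h2.tsum_eq]
  calc ∑ k, ∑ m, S k m ≤ ∑ _k : Fin n, ∑ _m : Fin n, r / s ^ 3 :=
        Finset.sum_le_sum fun k _ => Finset.sum_le_sum fun m _ => hS k m
    _ = _ := by simp; ring

/-! ### The coefficient equations as an operator pencil -/

/-- The operator on bounded sequences given by an absolutely summable matrix. -/
theorem exists_matrix_operator {ι : Type*} [TopologicalSpace ι] [DiscreteTopology ι]
    {K : ι → ι → ℂ} (hK : Summable fun x : ι × ι => ‖K x.1 x.2‖) {S : ℝ}
    (hS : ∑' x : ι × ι, ‖K x.1 x.2‖ ≤ S) (e : ℂ →L[ℝ] ℂ) (he : ∀ z, ‖e z‖ ≤ ‖z‖) :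
    ∃ T : (ι →ᵇ ℂ) →L[ℝ] (ι →ᵇ ℂ), (∀ d p, T d p = ∑' q, K p q * e (d q)) ∧ ‖T‖ ≤ S := by
  have hS0 : 0 ≤ S := (tsum_nonneg fun _ => norm_nonneg _).trans hS
  have hed : ∀ (d : ι →ᵇ ℂ) q, ‖e (d q)‖ ≤ ‖d‖ := fun d q => (he _).trans (d.norm_coe_le_norm q)
  have hsum : ∀ (d : ι →ᵇ ℂ) p, Summable fun q => K p q * e (d q) := fun d p =>
    summable_mul_bounded (f := fun q => K p q) (hK.prod_factor p) (hed d)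
  have hbound : ∀ (d : ι →ᵇ ℂ) p, ‖∑' q, K p q * e (d q)‖ ≤ S * ‖d‖ := by
    intro d p
    have h1 := ((hK.prod_factor p).mul_right ‖d‖).hasSum
    refine (tsum_of_norm_bounded h1 fun q => ?_).trans ?_
    · rw [norm_mul]; exact mul_le_mul_of_nonneg_left (hed d q) (norm_nonneg _)
    · rw [tsum_mul_right]
      refine mul_le_mul_of_nonneg_right (le_trans ?_ hS) (norm_nonneg _)
      have h2 := hK.hasSum.prod_fiberwise fun p => (hK.prod_factor p).hasSum
      exact le_hasSum h2 p fun _ _ => tsum_nonneg fun _ => norm_nonneg _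
  refine ⟨LinearMap.mkContinuous
    { toFun := fun d => BoundedContinuousFunction.ofNormedAddCommGroupDiscrete
        (fun p => ∑' q, K p q * e (d q)) (S * ‖d‖) (hbound d)
      map_add' := fun d d' => ?_
      map_smul' := fun t d => ?_ } S fun d => ?_, fun d p => rfl, ?_⟩
  · ext p
    change ∑' q, K p q * e ((d + d') q) = ∑' q, K p q * e (d q) + ∑' q, K p q * e (d' q)
    rw [← (hsum d p).tsum_add (hsum d' p)]
    exact tsum_congr fun q => by rw [BoundedContinuousFunction.add_apply, map_add, mul_add]
  · ext p
    change ∑' q, K p q * e ((t • d) q) = t • ∑' q, K p q * e (d q)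
    rw [← tsum_const_smul'']
    exact tsum_congr fun q => by
      rw [BoundedContinuousFunction.coe_smul, map_smul, mul_smul_comm]
  · exact (BoundedContinuousFunction.norm_le (by positivity)).2 (hbound d)
  · exact LinearMap.mkContinuous_norm_le _ hS0 _

/-- Bounded families of Taylor coefficients. -/
abbrev CoeffSpace (n : ℕ) : Type := (Fin n × ℕ) →ᵇ ℂ

/-- The embedding of the leading coefficients. -/
noncomputable def leadEmb (n : ℕ) : (Fin n → ℂ) →L[ℝ] CoeffSpace n :=
  LinearMap.mkContinuous
    { toFun := fun u => BoundedContinuousFunction.ofNormedAddCommGroupDiscrete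
        (fun p => if p.2 = 0 then u p.1 else 0) ‖u‖ fun p => by
          split_ifs
          · exact norm_le_pi_norm u p.1
          · simp
      map_add' := fun u w => by
        ext p
        change (if p.2 = 0 then u p.1 + w p.1 else 0) =
          (if p.2 = 0 then u p.1 else 0) + (if p.2 = 0 then w p.1 else 0)
        split_ifs <;> simp
      map_smul' := fun t u => by
        ext p
        change (if p.2 = 0 then t • u p.1 else 0) = t • (if p.2 = 0 then u p.1 else 0)
        split_ifs <;> simp } 1 fun u => by
    rw [one_mul]
    refine (BoundedContinuousFunction.norm_le (norm_nonneg _)).2 fun p => ?_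
    change ‖if p.2 = 0 then u p.1 else 0‖ ≤ ‖u‖
    split_ifs
    · exact norm_le_pi_norm u p.1
    · simp

theorem leadEmb_apply (u : Fin n → ℂ) (p : Fin n × ℕ) :
    leadEmb n u p = if p.2 = 0 then u p.1 else 0 := rfl

theorem norm_leadEmb_le (u : Fin n → ℂ) : ‖leadEmb n u‖ ≤ ‖u‖ := by
  simpa using (leadEmb n).le_of_opNorm_le (LinearMap.mkContinuous_norm_le _ zero_le_one _) u

/-- The leading coefficients. -/
noncomputable def leadCoeff (n : ℕ) : CoeffSpace n →L[ℝ] (Fin n → ℂ) :=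
  LinearMap.mkContinuous
    { toFun := fun d k => d (k, 0)
      map_add' := fun _ _ => rfl
      map_smul' := fun _ _ => rfl } 1 fun d => by
    rw [one_mul]
    exact (pi_norm_le_iff_of_nonneg (norm_nonneg _)).2 fun k => d.norm_coe_le_norm _

theorem leadCoeff_apply (d : CoeffSpace n) (k : Fin n) : leadCoeff n d k = d (k, 0) := rfl

theorem norm_leadCoeff_le (d : CoeffSpace n) : ‖leadCoeff n d‖ ≤ ‖d‖ :=
  (pi_norm_le_iff_of_nonneg (norm_nonneg _)).2 fun _ => d.norm_coe_le_norm _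

theorem leadCoeff_leadEmb (u : Fin n → ℂ) : leadCoeff n (leadEmb n u) = u := rfl

theorem leadCoeff_smul (c : ℂ) (d : CoeffSpace n) : leadCoeff n (c • d) = c • leadCoeff n d := rfl

theorem leadEmb_smul (c : ℂ) (u : Fin n → ℂ) : leadEmb n (c • u) = c • leadEmb n u := by
  ext p
  change _ = c • leadEmb n u p
  rw [leadEmb_apply, leadEmb_apply]
  split_ifs <;> simp

/-- The transpose of the matrix `F`, as an operator. -/
noncomputable def opF (a : Fin n → ℂ) (ρ : Fin n → ℂ) (ν : Fin n → ℝ) :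
    (Fin n → ℂ) →L[ℝ] (Fin n → ℂ) :=
  (LinearMap.toContinuousLinearMap (Matrix.toLin' (matF a ρ ν)ᵀ)).restrictScalars ℝ

theorem opF_apply (a : Fin n → ℂ) (ρ : Fin n → ℂ) (ν : Fin n → ℝ) (u : Fin n → ℂ) (k : Fin n) :
    opF a ρ ν u k = ∑ m, matF a ρ ν m k * u m := by
  change (Matrix.toLin' (matF a ρ ν)ᵀ u) k = _
  rw [Matrix.toLin'_apply]; rfl

theorem opF_smul (a : Fin n → ℂ) (ρ : Fin n → ℂ) (ν : Fin n → ℝ) (c : ℂ) (u : Fin n → ℂ) :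
    opF a ρ ν (c • u) = c • opF a ρ ν u := map_smul (Matrix.toLin' (matF a ρ ν)ᵀ) c u

/-- The operator `κ (1 + A) - J F Q - G` on the coefficient space. -/
noncomputable def pencil (a : Fin n → ℂ) (ρ : Fin n → ℂ) (ν : Fin n → ℝ)
    (A G : CoeffSpace n →L[ℝ] CoeffSpace n) (κ : ℂ) (d : CoeffSpace n) : CoeffSpace n :=
  κ • (d + A d) - leadEmb n (opF a ρ ν (leadCoeff n d)) - G d

/-- The perturbations `A`, `G` realize the coefficient equations for radii of size `r`. -/
structure Realizes (a : Fin n → ℂ) (ρ : Fin n → ℂ) (ν : Fin n → ℝ) (r C : ℝ)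
    (A G : CoeffSpace n →L[ℝ] CoeffSpace n) : Prop where
  norm_A : ‖A‖ ≤ C * r
  norm_G : ‖G‖ ≤ C * r
  A_eq : ∀ d p, ((p.2 + 1 : ℕ) : ℂ) * A d p = ∑' q, reflMat a (radii ν r) ρ p q * conj (d q)
  pencil_eq : ∀ κ d p, ((p.2 + 1 : ℕ) : ℂ) * pencil a ρ ν A G κ d p =
    κ * (((p.2 + 1 : ℕ) : ℂ) * d p + ∑' q, reflMat a (radii ν r) ρ p q * conj (d q)) -
      ((r : ℂ) ^ 2)⁻¹ * ∑' q, bergMat a (radii ν r) ρ p q * d q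

/-- The series is `∑ (l + 1) (conj (a m) * a k) ^ l`; this is the origin of the matrix `F`. -/
theorem bergmanCoeff_zero {a : Fin n → ℂ} (ha : ∀ k, ‖a k‖ < 1) (k m : Fin n) :
    bergmanCoeff a (k, 0) (m, 0) = 1 / (1 - conj (a m) * a k) ^ 2 := by
  have h1 : ‖conj (a m) * a k‖ < 1 := by
    rw [norm_mul, RCLike.norm_conj]
    exact mul_lt_one_of_nonneg_of_lt_one_left (norm_nonneg _) (ha m) (ha k).le
  have h2 := one_sub_inv_pow h1 1
  rw [bergmanCoeff, one_div, ← inv_pow, ← h2.tsum_eq]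
  refine tsum_congr fun l => ?_
  simp only [Nat.choose_zero_right, Nat.sub_zero, Nat.cast_one, one_mul]
  rw [Nat.choose_succ_self_right, mul_pow]
  ring

theorem bergMat_zero {a : Fin n → ℂ} (ha : ∀ k, ‖a k‖ < 1) (ρ : Fin n → ℂ) {ν : Fin n → ℝ}
    (hν : IsRatio ν) (r : ℝ) (k m : Fin n) :
    bergMat a (radii ν r) ρ (k, 0) (m, 0) = (r : ℂ) ^ 2 * matF a ρ ν m k := by
  have h : (radii ν r m : ℂ) ^ 2 = (r : ℂ) ^ 2 * ν m := by
    rw [← Complex.ofReal_pow, radii_sq hν]; push_cast; rfl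
  simp only [bergMat, bergmanCoeff_zero ha, matF, Matrix.of_apply, zero_add, pow_zero, one_mul, h]
  ring

/-- Each row is divided by `i + 1`, which does not increase norms. `A` is then `reflMat` composed
with conjugation and `G` is `bergRest`; the entries omitted from `bergRest` form the term with `F`.
-/
theorem Separated.exists_realizes {a : Fin n → ℂ} {s : ℝ} (h : Separated a s) {ρ : Fin n → ℂ}
    (hρ : ∀ k, ‖ρ k‖ < 1) {ν : Fin n → ℝ} (hν : IsRatio ν) {r : ℝ} (hr : 0 < r) (hrs : r ≤ s) :
    ∃ A G, Realizes a ρ ν r ((n : ℝ) ^ 2 / s ^ 3) A G := by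
  have hadm : Admissible a (radii ν r) :=
    h.admissible fun k => ⟨radii_pos hν hr k, (radii_le hν hr k).trans hrs⟩
  have ha : ∀ k, ‖a k‖ < 1 := fun k => by linarith [h.norm_le k, h.pos]
  have hr0 : (r : ℂ) ^ 2 ≠ 0 := pow_ne_zero _ (by exact_mod_cast hr.ne')
  have hcast : ∀ i : ℕ, ((i + 1 : ℕ) : ℂ) ≠ 0 := fun i => by exact_mod_cast Nat.succ_ne_zero i
  have hle : ∀ x : (Fin n × ℕ) × (Fin n × ℕ), ‖((x.1.2 + 1 : ℕ) : ℂ)⁻¹ *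
      reflMat a (radii ν r) ρ x.1 x.2‖ ≤ ‖reflMat a (radii ν r) ρ x.1 x.2‖ := fun x => by
    rw [norm_mul]
    exact mul_le_of_le_one_left (norm_nonneg _) (norm_natCast_succ_inv_le _)
  have hsA := summable_reflMat ρ hadm
  have hsA' := Summable.of_nonneg_of_le (fun _ => norm_nonneg _) hle hsA
  obtain ⟨A, hA, hAn⟩ := exists_matrix_operator
    (K := fun p q => ((p.2 + 1 : ℕ) : ℂ)⁻¹ * reflMat a (radii ν r) ρ p q) hsA'
    ((hsA'.tsum_le_tsum hle hsA).trans (h.tsum_reflMat_le hρ hν hr hrs))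
    Complex.conjCLE.toContinuousLinearMap (fun z => (RCLike.norm_conj z).le)
  obtain ⟨hsG, hGle⟩ := h.bergRest_bound hρ hν hr hrs
  obtain ⟨G, hG, hGn⟩ := exists_matrix_operator (K := bergRest a ν r ρ) hsG hGle
    (ContinuousLinearMap.id ℝ ℂ) (fun z => le_rfl)
  have hA_eq : ∀ d p, ((p.2 + 1 : ℕ) : ℂ) * A d p =
      ∑' q, reflMat a (radii ν r) ρ p q * conj (d q) := by
    intro d p
    rw [hA, ← tsum_mul_left]
    refine tsum_congr fun q => ?_
    rw [mul_assoc, mul_inv_cancel_left₀ (hcast _)]; rfl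
  have hG_eq : ∀ d p, ((p.2 + 1 : ℕ) : ℂ) * (leadEmb n (opF a ρ ν (leadCoeff n d)) p + G d p) =
      ((r : ℂ) ^ 2)⁻¹ * ∑' q, bergMat a (radii ν r) ρ p q * d q := by
    rintro d ⟨k, i⟩
    have hsB : Summable fun q => bergMat a (radii ν r) ρ (k, i) q * d q :=
      summable_mul_bounded ((summable_bergMat ρ hadm).prod_factor (k, i)) d.norm_coe_le_norm
    have hsR : Summable fun q => bergRest a ν r ρ (k, i) q * d q :=
      summable_mul_bounded (hsG.prod_factor (k, i)) d.norm_coe_le_norm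
    rw [hG, leadEmb_apply, ← tsum_mul_left]
    simp only [ContinuousLinearMap.id_apply]
    by_cases hi : i = 0
    · subst hi
      simp only [if_true, zero_add, Nat.cast_one, one_mul]
      have h2 : ∑' q, (((r : ℂ) ^ 2)⁻¹ * (bergMat a (radii ν r) ρ (k, 0) q * d q) -
          bergRest a ν r ρ (k, 0) q * d q) = opF a ρ ν (leadCoeff n d) k := by
        rw [tsum_fin_prod ((hsB.mul_left _).sub hsR), opF_apply]
        refine Finset.sum_congr rfl fun m _ => ?_
        rw [tsum_eq_single 0]
        · simp only [bergRest, if_true, and_self, zero_mul, sub_zero, bergMat_zero ha ρ hν,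
            leadCoeff_apply]
          rw [mul_assoc, inv_mul_cancel_left₀ hr0]
        · intro j hj
          simp [bergRest, hj, mul_assoc]
      rw [(hsB.mul_left _).tsum_sub hsR] at h2
      linear_combination -h2
    · simp only [if_neg hi, zero_add]
      rw [← tsum_mul_left]
      refine tsum_congr fun q => ?_
      simp only [bergRest, hi, false_and, if_false]
      rw [mul_assoc, mul_inv_cancel_left₀ (hcast _), mul_assoc]
  refine ⟨A, G, hAn, hGn, hA_eq, fun κ d p => ?_⟩
  have h1 : pencil a ρ ν A G κ d p =
      κ * (d p + A d p) - leadEmb n (opF a ρ ν (leadCoeff n d)) p - G d p := rfl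
  rw [h1]
  linear_combination κ * hA_eq d p - hG_eq d p

theorem Realizes.pencil_eq_zero_iff {a : Fin n → ℂ} {ρ : Fin n → ℂ} {ν : Fin n → ℝ} {r C : ℝ}
    {A G : CoeffSpace n →L[ℝ] CoeffSpace n} (h : Realizes a ρ ν r C A G) (hr : 0 < r) (κ : ℂ)
    (d : CoeffSpace n) :
    pencil a ρ ν A G κ d = 0 ↔ CoeffEq a (radii ν r) ρ ((r : ℂ) ^ 2 * κ) d := by
  have hr0 : (r : ℂ) ^ 2 ≠ 0 := pow_ne_zero _ (by exact_mod_cast hr.ne')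
  rw [DFunLike.ext_iff]
  refine forall_congr' fun p => ?_
  have hp : ((p.2 + 1 : ℕ) : ℂ) ≠ 0 := by exact_mod_cast Nat.succ_ne_zero p.2
  have h1 := h.pencil_eq κ d p
  rw [BoundedContinuousFunction.coe_zero, Pi.zero_apply]
  constructor
  · intro h0
    rw [h0, mul_zero, eq_comm, sub_eq_zero, eq_inv_mul_iff_mul_eq₀ hr0] at h1
    rw [mul_assoc, h1]
  · intro h0
    rw [mul_assoc, ← eq_inv_mul_iff_mul_eq₀ hr0] at h0
    rw [h0, sub_self] at h1
    exact (mul_eq_zero.1 h1).resolve_left hp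

theorem Realizes.of_eigensolution {a : Fin n → ℂ} {ρ : Fin n → ℂ} {ν : Fin n → ℝ} {r C : ℝ}
    {A G : CoeffSpace n →L[ℝ] CoeffSpace n} (h : Realizes a ρ ν r C A G) (hr : 0 < r)
    (hadm : Admissible a (radii ν r)) {lam : ℂ} {φ : ℂ → ℂ} {φi : Fin n → ℂ → ℂ} {φ0 : ℂ → ℂ}
    (hs : IsEigensolution a (radii ν r) ρ lam φ φi φ0) :
    ∃ d : CoeffSpace n, d ≠ 0 ∧ pencil a ρ ν A G (((r : ℂ) ^ 2)⁻¹ * lam) d = 0 ∧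
      Represents a (radii ν r) ρ lam d φi φ0 := by
  obtain ⟨d, M, hM, hd0, hd, hrep⟩ := hs.exists_coeffEq hadm
  have hr0 : (r : ℂ) ^ 2 ≠ 0 := pow_ne_zero _ (by exact_mod_cast hr.ne')
  refine ⟨BoundedContinuousFunction.ofNormedAddCommGroupDiscrete d M hM, fun h0 => hd0 ?_, ?_, hrep⟩
  · funext p
    exact congrArg (fun f : CoeffSpace n => f p) h0
  · rw [h.pencil_eq_zero_iff hr, mul_inv_cancel_left₀ hr0]
    exact hd

/-- The condition `C * r < 1` makes `1 + A` injective, which excludes the degenerate case of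
`CoeffEq.exists_eigensolution`. -/
theorem Realizes.exists_eigensolution {a : Fin n → ℂ} {ρ : Fin n → ℂ} (hρ : ∀ k, ‖ρ k‖ < 1)
    {ν : Fin n → ℝ} {r C : ℝ}
    {A G : CoeffSpace n →L[ℝ] CoeffSpace n} (h : Realizes a ρ ν r C A G) (hr : 0 < r)
    (hCr : C * r < 1) (hadm : Admissible a (radii ν r)) {κ : ℂ} (hκ : κ ≠ 0) {d : CoeffSpace n}
    (hd0 : d ≠ 0) (hd : pencil a ρ ν A G κ d = 0) :
    ∃ φ φi φ0, IsEigensolution a (radii ν r) ρ ((r : ℂ) ^ 2 * κ) φ φi φ0 ∧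
      Represents a (radii ν r) ρ ((r : ℂ) ^ 2 * κ) d φi φ0 := by
  have hr0 : (r : ℂ) ^ 2 ≠ 0 := pow_ne_zero _ (by exact_mod_cast hr.ne')
  refine CoeffEq.exists_eigensolution hadm hρ (mul_ne_zero hr0 hκ) d.norm_coe_le_norm
    ((h.pencil_eq_zero_iff hr κ d).1 hd) fun hinj => hd0 ?_
  have h1 : d + A d = 0 := by
    ext p
    have hp : ((p.2 + 1 : ℕ) : ℂ) ≠ 0 := by exact_mod_cast Nat.succ_ne_zero p.2
    have h2 := hinj p
    rw [← h.A_eq, ← mul_add] at h2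
    exact (mul_eq_zero.1 h2).resolve_left hp
  have h2 : ‖d‖ ≤ C * r * ‖d‖ := by
    calc ‖d‖ = ‖A d‖ := by conv_lhs => rw [eq_neg_of_add_eq_zero_left h1, norm_neg]
      _ ≤ _ := A.le_of_opNorm_le h.norm_A d
  by_contra h0
  have h3 : 0 < ‖d‖ := norm_pos_iff.2 h0
  nlinarith

theorem norm_sub_leadEmb_le (d : CoeffSpace n) : ‖d - leadEmb n (leadCoeff n d)‖ ≤ ‖d‖ := by
  refine (BoundedContinuousFunction.norm_le (norm_nonneg _)).2 fun p => ?_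
  change ‖d p - leadEmb n (leadCoeff n d) p‖ ≤ ‖d‖
  rw [leadEmb_apply, leadCoeff_apply]
  split_ifs with h
  · rw [← h]; simp
  · simpa using d.norm_coe_le_norm p

/-- Projecting the kernel equation to the higher coefficients removes the term with `F`, so these
coefficients are at most `e (1 + c⁻¹) ‖d‖`. Hence the leading ones control `d`, and their own
equation is the eigenvector equation with an error of order `e`. -/
theorem pencil_kernel_estimates {a : Fin n → ℂ} {ρ : Fin n → ℂ} {ν : Fin n → ℝ}
    {A G : CoeffSpace n →L[ℝ] CoeffSpace n} {c e : ℝ} (hc : 0 < c) (he : 0 ≤ e)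
    (hec : e * (1 + c⁻¹) ≤ 1 / 4) (hA : ‖A‖ ≤ e) (hG : ‖G‖ ≤ e) {κ : ℂ} (hκ : c ≤ ‖κ‖)
    {d : CoeffSpace n} (hd : pencil a ρ ν A G κ d = 0) :
    ‖d‖ ≤ 2 * ‖leadCoeff n d‖ ∧
    ‖d - leadEmb n (leadCoeff n d)‖ ≤ 2 * (e * (1 + c⁻¹)) * ‖leadCoeff n d‖ ∧
    ‖κ • leadCoeff n d - opF a ρ ν (leadCoeff n d)‖ ≤ 2 * e * (1 + ‖κ‖) * ‖leadCoeff n d‖ := by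
  set u := leadCoeff n d with hu
  have hκ0 : 0 < ‖κ‖ := hc.trans_le hκ
  have hκ1 : κ ≠ 0 := norm_pos_iff.1 hκ0
  have hA' := A.le_of_opNorm_le hA d
  have hG' := G.le_of_opNorm_le hG d
  have hd1 : κ • (d + A d) = leadEmb n (opF a ρ ν u) + G d := by
    rw [pencil, sub_sub, sub_eq_zero] at hd; exact hd
  have h1 : d - leadEmb n u = κ⁻¹ • (G d - leadEmb n (leadCoeff n (G d))) -
      (A d - leadEmb n (leadCoeff n (A d))) := by
    have h2 := congrArg (fun x => κ⁻¹ • (x - leadEmb n (leadCoeff n x))) hd1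
    simp only [map_add, leadCoeff_smul, leadEmb_smul, leadCoeff_leadEmb, ← smul_sub,
      inv_smul_smul₀ hκ1, ← hu] at h2
    rw [show leadEmb n (opF a ρ ν u) + G d - (leadEmb n (opF a ρ ν u) +
      leadEmb n (leadCoeff n (G d))) = G d - leadEmb n (leadCoeff n (G d)) by abel] at h2
    rw [← h2]; abel
  have hy : ‖d - leadEmb n u‖ ≤ e * (1 + c⁻¹) * ‖d‖ := by
    rw [h1]
    have h3 : ‖κ⁻¹ • (G d - leadEmb n (leadCoeff n (G d)))‖ ≤ c⁻¹ * (e * ‖d‖) := by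
      rw [norm_smul, norm_inv]
      have := (norm_sub_leadEmb_le (G d)).trans hG'
      gcongr
    have h4 := (norm_sub_leadEmb_le (A d)).trans hA'
    calc _ ≤ c⁻¹ * (e * ‖d‖) + e * ‖d‖ := (norm_sub_le _ _).trans (add_le_add h3 h4)
      _ = _ := by ring
  have hdu : ‖d‖ ≤ 2 * ‖u‖ := by
    have h3 : ‖d‖ ≤ ‖d - leadEmb n u‖ + ‖leadEmb n u‖ := norm_le_norm_sub_add _ _
    have h4 := norm_leadEmb_le u
    have h5 : e * (1 + c⁻¹) * ‖d‖ ≤ 1 / 4 * ‖d‖ := by gcongr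
    linarith [norm_nonneg d]
  refine ⟨hdu, ?_, ?_⟩
  · calc _ ≤ e * (1 + c⁻¹) * ‖d‖ := hy
      _ ≤ e * (1 + c⁻¹) * (2 * ‖u‖) := by gcongr
      _ = _ := by ring
  · have h2 := congrArg (leadCoeff n) hd1
    rw [leadCoeff_smul, map_add, map_add, leadCoeff_leadEmb, ← hu] at h2
    have h3 : κ • u - opF a ρ ν u = leadCoeff n (G d) - κ • leadCoeff n (A d) := by
      rw [smul_add] at h2
      rw [sub_eq_sub_iff_add_eq_add, h2]; abel
    rw [h3]
    have h4 := (norm_leadCoeff_le (G d)).trans hG'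
    have h5 : ‖κ • leadCoeff n (A d)‖ ≤ ‖κ‖ * (e * ‖d‖) := by
      rw [norm_smul]
      have := (norm_leadCoeff_le (A d)).trans hA'
      gcongr
    calc _ ≤ e * ‖d‖ + ‖κ‖ * (e * ‖d‖) := (norm_sub_le _ _).trans (add_le_add h4 h5)
      _ = e * (1 + ‖κ‖) * ‖d‖ := by ring
      _ ≤ e * (1 + ‖κ‖) * (2 * ‖u‖) := by gcongr
      _ = _ := by ring

/-! ### Eigenvalues that are not small lie near roots -/

theorem Separated.norm_matF_le {a : Fin n → ℂ} {s : ℝ} (h : Separated a s) {ρ : Fin n → ℂ}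
    (hρ : ∀ k, ‖ρ k‖ < 1) {ν : Fin n → ℝ} (hν : IsRatio ν) (m k : Fin n) :
    ‖matF a ρ ν m k‖ ≤ 1 / s ^ 2 := by
  have hs := h.pos
  have h1 : s ≤ ‖1 - conj (a m) * a k‖ := by
    have h2 := norm_sub_norm_le (1 : ℂ) (conj (a m) * a k)
    have h3 : ‖conj (a m) * a k‖ ≤ ‖a k‖ := by
      rw [norm_mul, RCLike.norm_conj]
      exact mul_le_of_le_one_left (norm_nonneg _) (by linarith [h.norm_le m])
    rw [norm_one] at h2
    linarith [h.norm_le k]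
  simp only [matF, Matrix.of_apply, norm_div, norm_mul, RCLike.norm_conj, norm_pow,
    Complex.norm_real, Real.norm_eq_abs, abs_of_pos (hν.1 m).1]
  have h4 : ‖ρ m‖ * ν m ≤ 1 := mul_le_one₀ (hρ m).le (hν.1 m).1.le (hν.1 m).2
  gcongr

theorem Separated.norm_opF_le {a : Fin n → ℂ} {s : ℝ} (h : Separated a s) {ρ : Fin n → ℂ}
    (hρ : ∀ k, ‖ρ k‖ < 1) {ν : Fin n → ℝ} (hν : IsRatio ν) (u : Fin n → ℂ) :
    ‖opF a ρ ν u‖ ≤ n / s ^ 2 * ‖u‖ := by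
  have hs := h.pos
  refine (pi_norm_le_iff_of_nonneg (by positivity)).2 fun k => ?_
  rw [opF_apply]
  calc _ ≤ ∑ m : Fin n, 1 / s ^ 2 * ‖u‖ := norm_sum_le_of_le _ fun m _ => by
        rw [norm_mul]
        exact mul_le_mul (h.norm_matF_le hρ hν m k) (norm_le_pi_norm u m) (norm_nonneg _)
          (by positivity)
    _ = _ := by simp; ring

theorem isRootF_iff {a : Fin n → ℂ} {ρ : Fin n → ℂ} {ν : Fin n → ℝ} {μ : ℂ} :
    IsRootF a ρ ν μ ↔ (matF a ρ ν).charpoly.IsRoot μ := by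
  rw [IsRootF, Polynomial.IsRoot, Matrix.eval_charpoly, Matrix.smul_one_eq_diagonal,
    Matrix.scalar_apply]

/-- The determinant is the product of `κ - μ` over the `n` roots; were all factors at least `e`, it
would be at least `e ^ n`. -/
theorem exists_root_norm_sub_lt {M : Matrix (Fin n) (Fin n) ℂ} {κ : ℂ} {e : ℝ} (he : 0 ≤ e)
    (h : ‖(κ • (1 : Matrix (Fin n) (Fin n) ℂ) - M).det‖ < e ^ n) :
    ∃ μ, M.charpoly.IsRoot μ ∧ ‖κ - μ‖ < e := by
  by_contra! hcon
  have h1 : (κ • (1 : Matrix (Fin n) (Fin n) ℂ) - M).det =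
      (M.charpoly.roots.map fun μ => κ - μ).prod := by
    rw [← (IsAlgClosed.splits M.charpoly).eval_eq_prod_roots_of_monic M.charpoly_monic,
      Matrix.eval_charpoly, Matrix.smul_one_eq_diagonal, Matrix.scalar_apply]
  have hcard : M.charpoly.roots.card = n := by
    rw [← (IsAlgClosed.splits M.charpoly).natDegree_eq_card_roots, Matrix.charpoly_natDegree_eq_dim,
      Fintype.card_fin]
  have h2 : ∀ s : Multiset ℂ, (∀ μ ∈ s, e ≤ ‖κ - μ‖) →
      e ^ s.card ≤ ‖(s.map fun μ => κ - μ).prod‖ := by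
    intro s
    induction s using Multiset.induction with
    | empty => simp
    | cons x s ih =>
      intro hs
      rw [Multiset.card_cons, Multiset.map_cons, Multiset.prod_cons, norm_mul, pow_succ, mul_comm]
      exact mul_le_mul (hs x (Multiset.mem_cons_self x s))
        (ih fun μ hμ => hs μ (Multiset.mem_cons_of_mem hμ)) (by positivity) (norm_nonneg _)
  have h3 := h2 M.charpoly.roots fun μ hμ =>
    hcon μ ((Polynomial.mem_roots M.charpoly_monic.ne_zero).1 hμ)
  rw [hcard, ← h1] at h3
  exact absurd h (not_lt.2 h3)

/-- Multiplying `Mᵀ u` by the transposed adjugate gives `det M` times `u`, so an approximate null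
vector forces a small determinant. -/
theorem norm_det_mul_le {M : Matrix (Fin n) (Fin n) ℂ} {K : ℝ}
    (hK : ∀ i j, ‖M.adjugate i j‖ ≤ K) (u : Fin n → ℂ) :
    ‖M.det‖ * ‖u‖ ≤ n * K * ‖Mᵀ *ᵥ u‖ := by
  by_cases hn : n = 0
  · subst hn
    rw [Subsingleton.elim u 0]; simp
  have hK0 : 0 ≤ K := (norm_nonneg _).trans (hK ⟨0, Nat.pos_of_ne_zero hn⟩ ⟨0, Nat.pos_of_ne_zero hn⟩)
  have h1 : M.det • u = M.adjugateᵀ *ᵥ (Mᵀ *ᵥ u) := by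
    rw [Matrix.mulVec_mulVec, ← Matrix.transpose_mul, Matrix.mul_adjugate, Matrix.transpose_smul,
      Matrix.transpose_one, Matrix.smul_mulVec, Matrix.one_mulVec]
  rw [← norm_smul, h1]
  refine (pi_norm_le_iff_of_nonneg (by positivity)).2 fun k => ?_
  calc ‖∑ m, M.adjugate m k * (Mᵀ *ᵥ u) m‖ ≤ ∑ m : Fin n, K * ‖Mᵀ *ᵥ u‖ :=
        norm_sum_le_of_le _ fun m _ => by
          rw [norm_mul]
          exact mul_le_mul (hK m k) (norm_le_pi_norm _ m) (norm_nonneg _) hK0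
    _ = _ := by simp; ring

theorem continuous_matF (a : Fin n → ℂ) (ρ : Fin n → ℂ) :
    Continuous fun ν : Fin n → ℝ => matF a ρ ν := by
  refine continuous_matrix fun m k => ?_
  simp only [matF, Matrix.of_apply]
  refine Continuous.div_const (continuous_const.mul ?_) _
  exact Complex.continuous_ofReal.comp (continuous_apply m)

/-- Uniformity in the ratios comes from letting them range over the compact cube `[0, 1] ^ n`, which
contains all admissible ones. -/
theorem exists_adjugate_bound (a : Fin n → ℂ) (ρ : Fin n → ℂ) (K₀ : ℝ) :
    ∃ K > 0, ∀ ν : Fin n → ℝ, IsRatio ν → ∀ κ : ℂ, ‖κ‖ ≤ K₀ → ∀ i j,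
      ‖(κ • (1 : Matrix (Fin n) (Fin n) ℂ) - matF a ρ ν).adjugate i j‖ ≤ K := by
  have hcomp : IsCompact (closedBall (0 : ℂ) K₀ ×ˢ
      Set.pi Set.univ fun _ : Fin n => Set.Icc (0 : ℝ) 1) :=
    (isCompact_closedBall _ _).prod (isCompact_univ_pi fun _ => isCompact_Icc)
  have hcont : Continuous fun x : ℂ × (Fin n → ℝ) => fun i j =>
      (x.1 • (1 : Matrix (Fin n) (Fin n) ℂ) - matF a ρ x.2).adjugate i j := by
    have h1 : Continuous fun x : ℂ × (Fin n → ℝ) =>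
        (x.1 • (1 : Matrix (Fin n) (Fin n) ℂ) - matF a ρ x.2).adjugate :=
      Continuous.matrix_adjugate ((continuous_fst.smul continuous_const).sub
        ((continuous_matF a ρ).comp continuous_snd))
    exact continuous_pi fun i => continuous_pi fun j => h1.matrix_elem i j
  obtain ⟨K, hK⟩ := hcomp.exists_bound_of_continuousOn hcont.continuousOn
  refine ⟨max K 1, lt_max_of_lt_right one_pos, fun ν hν κ hκ i j => ?_⟩
  have h1 := hK (κ, ν) ⟨by simpa using hκ, fun k _ => ⟨(hν.1 k).1.le, (hν.1 k).2⟩⟩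
  exact ((norm_le_pi_norm (fun j => _) j).trans (norm_le_pi_norm (fun i j => _) i)).trans
    (h1.trans (le_max_left _ _))

theorem transpose_mulVec_eq (a : Fin n → ℂ) (ρ : Fin n → ℂ) (ν : Fin n → ℝ) (κ : ℂ)
    (u : Fin n → ℂ) :
    (κ • (1 : Matrix (Fin n) (Fin n) ℂ) - matF a ρ ν)ᵀ *ᵥ u = κ • u - opF a ρ ν u := by
  rw [Matrix.transpose_sub, Matrix.transpose_smul, Matrix.transpose_one, Matrix.sub_mulVec,
    Matrix.smul_mulVec, Matrix.one_mulVec]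
  rfl

theorem leadCoeff_ne_zero {d : CoeffSpace n} (hd : d ≠ 0) (h : ‖d‖ ≤ 2 * ‖leadCoeff n d‖) :
    0 < ‖leadCoeff n d‖ := by
  have := norm_pos_iff.2 hd
  linarith

theorem norm_kappa_le {u w : Fin n → ℂ} (hu : 0 < ‖u‖) {κ : ℂ} {N e : ℝ}
    (hw : ‖w‖ ≤ N * ‖u‖) (he : 2 * e ≤ 1 / 2) (h : ‖κ • u - w‖ ≤ 2 * e * (1 + ‖κ‖) * ‖u‖) :
    ‖κ‖ ≤ 2 * N + 1 := by
  have h1 : ‖κ‖ * ‖u‖ ≤ ‖κ • u - w‖ + ‖w‖ := by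
    rw [← norm_smul]; exact norm_le_norm_sub_add _ _
  have h2 : ‖κ‖ * ‖u‖ ≤ (1 / 2 * (1 + ‖κ‖) + N) * ‖u‖ := by
    have : 2 * e * (1 + ‖κ‖) * ‖u‖ ≤ 1 / 2 * (1 + ‖κ‖) * ‖u‖ := by gcongr
    linarith
  have h3 := le_of_mul_le_mul_right h2 hu
  linarith

theorem exists_root_near {a : Fin n → ℂ} {s : ℝ} (h : Separated a s) {ρ : Fin n → ℂ}
    (hρ : ∀ k, ‖ρ k‖ < 1) {c : ℝ} (hc : 0 < c) {ε : ℝ} (hε : 0 < ε) :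
    ∃ δ > (0 : ℝ), ∀ ν : Fin n → ℝ, IsRatio ν → ∀ r : ℝ, 0 < r → r < δ → ∀ lam : ℂ,
      IsEigenvalue a (radii ν r) ρ lam → c * r ^ 2 ≤ ‖lam‖ →
        ∃ μ : ℂ, μ ≠ 0 ∧ IsRootF a ρ ν μ ∧ ‖lam - (r : ℂ) ^ 2 * μ‖ ≤ ε * r ^ 2 := by
  have hs := h.pos
  set C : ℝ := (n : ℝ) ^ 2 / s ^ 3 with hC
  have hC0 : 0 ≤ C := by positivity
  set N : ℝ := n / s ^ 2 with hN
  have hN0 : 0 ≤ N := by positivity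
  obtain ⟨K, hK0, hK⟩ := exists_adjugate_bound a ρ (2 * N + 1)
  -- The bound by `c` keeps the root nonzero: `|κ| ≥ c` and `|κ - μ| < c`.
  set e : ℝ := min ε c with he
  have he0 : 0 < e := lt_min hε hc
  have hsmall : ∀ᶠ r in 𝓝[>] (0 : ℝ), r < s ∧ C * r * (1 + c⁻¹) < 1 / 4 ∧
      n * K * (2 * (C * r) * (1 + (2 * N + 1))) < e ^ n := by
    have h1 : Tendsto (fun r : ℝ => C * r * (1 + c⁻¹)) (𝓝[>] 0) (𝓝 (C * 0 * (1 + c⁻¹))) :=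
      (Continuous.tendsto (by fun_prop) 0).mono_left nhdsWithin_le_nhds
    have h2 : Tendsto (fun r : ℝ => n * K * (2 * (C * r) * (1 + (2 * N + 1)))) (𝓝[>] 0)
        (𝓝 (n * K * (2 * (C * 0) * (1 + (2 * N + 1))))) :=
      (Continuous.tendsto (by fun_prop) 0).mono_left nhdsWithin_le_nhds
    refine Filter.Eventually.and (nhdsWithin_le_nhds (gt_mem_nhds hs)) ((h1.eventually (gt_mem_nhds ?_)).and
      (h2.eventually (gt_mem_nhds ?_)))
    · norm_num
    · simp only [mul_zero, zero_mul]; positivity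
  obtain ⟨δ, hδ, hδs⟩ := mem_nhdsGT_iff_exists_Ioo_subset.1 hsmall
  refine ⟨δ, hδ, fun ν hν r hr hrδ lam hlam hclam => ?_⟩
  obtain ⟨hrs, hr1, hr2⟩ := hδs ⟨hr, hrδ⟩
  obtain ⟨A, G, hAG⟩ := h.exists_realizes hρ hν hr hrs.le
  have hadm : Admissible a (radii ν r) :=
    h.admissible fun k => ⟨radii_pos hν hr k, (radii_le hν hr k).trans hrs.le⟩
  obtain ⟨φ, φi, φ0, hsol⟩ := hlam
  obtain ⟨d, hd0, hd, -⟩ := hAG.of_eigensolution hr hadm hsol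
  have hr0 : (r : ℂ) ^ 2 ≠ 0 := pow_ne_zero _ (by exact_mod_cast hr.ne')
  have hnr : ‖(r : ℂ) ^ 2‖ = r ^ 2 := by
    rw [norm_pow, Complex.norm_real, Real.norm_eq_abs, sq_abs]
  set κ := ((r : ℂ) ^ 2)⁻¹ * lam with hκ
  have hlamκ : lam = (r : ℂ) ^ 2 * κ := by rw [hκ, mul_inv_cancel_left₀ hr0]
  have hcκ : c ≤ ‖κ‖ := by
    rw [hlamκ, norm_mul, hnr, mul_comm] at hclam
    exact le_of_mul_le_mul_left hclam (by positivity)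
  obtain ⟨hdu, -, hu⟩ := pencil_kernel_estimates hc (by positivity : 0 ≤ C * r) hr1.le
    hAG.norm_A hAG.norm_G hcκ hd
  have hu0 := leadCoeff_ne_zero hd0 hdu
  have hCr : 2 * (C * r) ≤ 1 / 2 := by
    have : 0 ≤ C * r * c⁻¹ := by positivity
    nlinarith
  have hκN := norm_kappa_le hu0 (h.norm_opF_le hρ hν _) hCr hu
  have hdet := norm_det_mul_le (hK ν hν κ hκN) (leadCoeff n d)
  rw [transpose_mulVec_eq] at hdet
  have hdet2 : ‖(κ • (1 : Matrix (Fin n) (Fin n) ℂ) - matF a ρ ν).det‖ < e ^ n := by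
    refine lt_of_le_of_lt (le_of_mul_le_mul_right (hdet.trans ?_) hu0) hr2
    calc _ ≤ n * K * (2 * (C * r) * (1 + ‖κ‖) * ‖leadCoeff n d‖) := by gcongr
      _ ≤ n * K * (2 * (C * r) * (1 + (2 * N + 1)) * ‖leadCoeff n d‖) := by gcongr
      _ = _ := by ring
  obtain ⟨μ, hμ, hμκ⟩ := exists_root_norm_sub_lt he0.le hdet2
  refine ⟨μ, ?_, isRootF_iff.2 hμ, ?_⟩
  · rintro rfl
    rw [sub_zero] at hμκ
    exact absurd (hμκ.trans_le (min_le_right _ _)) (not_lt.2 hcκ)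
  · rw [hlamκ, ← mul_sub, norm_mul, hnr, mul_comm]
    have := hμκ.le.trans (min_le_left ε c)
    gcongr

/-! ### Leading order of the exterior function -/

theorem Separated.two_mul_le_norm_sub {a : Fin n → ℂ} {s : ℝ} (h : Separated a s) (m : Fin n)
    {z : ℂ} (hz : 1 ≤ ‖z‖) : 2 * s ≤ ‖z - a m‖ := by
  have := norm_sub_norm_le z (a m)
  linarith [h.norm_le m]

/-- With `w = R_m / (z - a_m)`, the first term of the series is the claimed main term up to the
error of `d (m, 0)`. The rest is quadratic in `w`, and the prefactor `R_m` raises it to order `r ^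
3`. Separation ensures `|w| ≤ 1 / 2`. -/
theorem Separated.norm_sRefl_sub_le {a : Fin n → ℂ} {s : ℝ} (h : Separated a s)
    {ν : Fin n → ℝ} (hν : IsRatio ν) {r : ℝ} (hr : 0 < r) (hrs : r ≤ s)
    {d : Fin n × ℕ → ℂ} {v : Fin n → ℂ} {K : ℝ} (hK : 0 ≤ K) (m : Fin n)
    (h2 : ‖d (m, 0) - v m‖ ≤ K * r * ‖v‖) (h3 : ∀ j, ‖d (m, j + 1)‖ ≤ K * ‖v‖)
    {z : ℂ} (hz : 1 ≤ ‖z‖) :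
    ‖sRefl a (radii ν r) d m z - (r : ℂ) ^ 2 * ((ν m : ℂ) / (z - a m) * conj (v m))‖ ≤
      K * (1 / s ^ 2) * r ^ 3 * ‖v‖ := by
  have hs := h.pos
  have hzm := h.two_mul_le_norm_sub m hz
  have hzm0 : 0 < ‖z - a m‖ := by linarith
  have hRp := radii_pos hν hr m
  have hRr := radii_le hν hr m
  set w : ℂ := (radii ν r m : ℂ) / (z - a m) with hw
  have hwn : ‖w‖ ≤ r / (2 * s) := by
    rw [hw, norm_div, Complex.norm_real, Real.norm_eq_abs, abs_of_pos hRp]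
    gcongr
  have hw2 : ‖w‖ ≤ 1 / 2 := hwn.trans (by
    rw [div_le_div_iff₀ (by positivity) two_pos]; linarith)
  have hp := norm_pser_sub_le (c := fun j => conj (d (m, j))) (M := K * ‖v‖)
    (fun j => by rw [RCLike.norm_conj]; exact h3 j) hw2
  have hRw : (radii ν r m : ℂ) * w = (r : ℂ) ^ 2 * ((ν m : ℂ) / (z - a m)) := by
    have : (radii ν r m : ℂ) ^ 2 = (r : ℂ) ^ 2 * ν m := by
      rw [← Complex.ofReal_pow, radii_sq hν]; push_cast; rfl
    rw [hw, mul_div_assoc', ← sq, this, mul_div_assoc]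
  have hsplit : sRefl a (radii ν r) d m z - (r : ℂ) ^ 2 * ((ν m : ℂ) / (z - a m) * conj (v m)) =
      radii ν r m * (pser (fun j => conj (d (m, j))) w - conj (d (m, 0)) * w) +
        radii ν r m * w * conj (d (m, 0) - v m) := by
    rw [sRefl, map_sub, ← mul_assoc ((r : ℂ) ^ 2), ← hRw]; ring
  rw [hsplit]
  have hRn : ‖(radii ν r m : ℂ)‖ ≤ r := by
    rw [Complex.norm_real, Real.norm_eq_abs, abs_of_pos hRp]; exact hRr
  have t1 : ‖(radii ν r m : ℂ) * (pser (fun j => conj (d (m, j))) w - conj (d (m, 0)) * w)‖ ≤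
      r * (2 * (K * ‖v‖) * (r / (2 * s)) ^ 2) := by
    rw [norm_mul]
    have : 2 * (K * ‖v‖) * ‖w‖ ^ 2 ≤ 2 * (K * ‖v‖) * (r / (2 * s)) ^ 2 := by gcongr
    exact mul_le_mul hRn (hp.trans this) (norm_nonneg _) hr.le
  have t2 : ‖(radii ν r m : ℂ) * w * conj (d (m, 0) - v m)‖ ≤ r * (r / (2 * s)) * (K * r * ‖v‖) := by
    rw [norm_mul, norm_mul, RCLike.norm_conj]
    gcongr
  calc _ ≤ r * (2 * (K * ‖v‖) * (r / (2 * s)) ^ 2) + r * (r / (2 * s)) * (K * r * ‖v‖) :=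
        (norm_add_le _ _).trans (add_le_add t1 t2)
    _ = K * r ^ 3 * ‖v‖ * ((1 + s) / (2 * s ^ 2)) := by field_simp
    _ ≤ K * r ^ 3 * ‖v‖ * (2 / (2 * s ^ 2)) := by
      have := h.lt_one
      gcongr
      linarith
    _ = _ := by field_simp

theorem Represents.leadingOrder {a : Fin n → ℂ} {s : ℝ} (h : Separated a s) {ρ : Fin n → ℂ}
    (hρ : ∀ k, ‖ρ k‖ < 1) {ν : Fin n → ℝ} (hν : IsRatio ν) {r : ℝ} (hr : 0 < r) (hrs : r ≤ s)
    {κ μ : ℂ} {d : Fin n × ℕ → ℂ} {φi : Fin n → ℂ → ℂ} {φ0 : ℂ → ℂ}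
    (hrep : Represents a (radii ν r) ρ ((r : ℂ) ^ 2 * κ) d φi φ0) {v : Fin n → ℂ} {K : ℝ}
    (hK : 0 ≤ K) (h1 : ‖κ - μ‖ ≤ K * r) (h2 : ∀ k, ‖d (k, 0) - v k‖ ≤ K * r * ‖v‖)
    (h3 : ∀ k j, ‖d (k, j + 1)‖ ≤ K * ‖v‖) :
    LeadingOrder a ρ ν μ v (K * (1 + n / s ^ 2)) r ((r : ℂ) ^ 2 * κ) φi φ0 := by
  have hs := h.pos
  have hKC : K ≤ K * (1 + n / s ^ 2) := le_mul_of_one_le_right hK (by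
    have : 0 ≤ (n : ℝ) / s ^ 2 := by positivity
    linarith)
  refine ⟨?_, fun k => ?_, fun z hz => ?_⟩
  · rw [← mul_sub, norm_mul, norm_pow, Complex.norm_real, Real.norm_eq_abs, sq_abs]
    calc r ^ 2 * ‖κ - μ‖ ≤ r ^ 2 * (K * r) := by gcongr
      _ = K * r ^ 3 := by ring
      _ ≤ _ := by gcongr
  · rw [hrep.deriv_eq k]
    exact (h2 k).trans (by gcongr)
  · rw [hrep.exterior_eq z hz]
    have hsplit : -∑ m, ρ m * sRefl a (radii ν r) d m z -
        -((r : ℂ) ^ 2 * ∑ m, ρ m * (ν m : ℂ) / (z - a m) * conj (v m)) =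
        -∑ m, ρ m * (sRefl a (radii ν r) d m z -
          (r : ℂ) ^ 2 * ((ν m : ℂ) / (z - a m) * conj (v m))) := by
      simp only [mul_sub, Finset.sum_sub_distrib, Finset.mul_sum]
      rw [sub_neg_eq_add, neg_add_eq_sub, neg_sub]
      congr 1
      exact Finset.sum_congr rfl fun m _ => by ring
    rw [hsplit, norm_neg]
    calc _ ≤ ∑ m : Fin n, 1 * (K * (1 / s ^ 2) * r ^ 3 * ‖v‖) := norm_sum_le_of_le _ fun m _ => by
          rw [norm_mul]
          exact mul_le_mul (hρ m).le (h.norm_sRefl_sub_le hν hr hrs hK m (h2 m) (h3 m) hz)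
            (norm_nonneg _) zero_le_one
      _ = K * (n / s ^ 2) * r ^ 3 * ‖v‖ := by simp; ring
      _ ≤ _ := by
        gcongr
        linarith

/-! ### Perturbation at a simple nonzero root -/

theorem isEigenvectorF_iff {a : Fin n → ℂ} {ρ : Fin n → ℂ} {ν : Fin n → ℝ} {μ : ℂ}
    {v : Fin n → ℂ} : IsEigenvectorF a ρ ν μ v ↔ v ≠ 0 ∧ μ • v = opF a ρ ν v := by
  refine and_congr_right fun _ => ?_
  rw [funext_iff]
  exact forall_congr' fun k => by rw [opF_apply]; rfl

theorem exists_eigenvectorF {a : Fin n → ℂ} {ρ : Fin n → ℂ} {ν : Fin n → ℝ} {μ : ℂ}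
    (hμ : IsRootF a ρ ν μ) : ∃ v, IsEigenvectorF a ρ ν μ v := by
  have h1 : (μ • (1 : Matrix (Fin n) (Fin n) ℂ) - matF a ρ ν)ᵀ.det = 0 := by
    rw [Matrix.det_transpose]; exact hμ
  obtain ⟨v, hv, hv0⟩ := Matrix.exists_mulVec_eq_zero_iff.2 h1
  refine ⟨v, isEigenvectorF_iff.2 ⟨hv, ?_⟩⟩
  rw [transpose_mulVec_eq, sub_eq_zero] at hv0
  exact hv0

theorem IsSimpleNonzeroRootF.isRootF {a : Fin n → ℂ} {ρ : Fin n → ℂ} {ν : Fin n → ℝ} {μ : ℂ}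
    (hμ : IsSimpleNonzeroRootF a ρ ν μ) : IsRootF a ρ ν μ := by
  rw [isRootF_iff, ← Polynomial.rootMultiplicity_pos (Matrix.charpoly_monic _).ne_zero, hμ.2]
  exact one_pos

/-- A simple eigenvalue has a one-dimensional eigenspace and a left eigenvector not orthogonal
to it. -/
theorem IsSimpleNonzeroRootF.exists_functional {a : Fin n → ℂ} {ρ : Fin n → ℂ} {ν : Fin n → ℝ}
    {μ : ℂ} (hμ : IsSimpleNonzeroRootF a ρ ν μ) {v : Fin n → ℂ} (hv : IsEigenvectorF a ρ ν μ v) :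
    ∃ l : (Fin n → ℂ) →ₗ[ℂ] ℂ, l v = 1 ∧ (∀ u, l (μ • u - opF a ρ ν u) = 0) ∧
      ∀ u, μ • u = opF a ρ ν u → ∃ c : ℂ, u = c • v := by
  obtain ⟨hv0, hvF⟩ := isEigenvectorF_iff.1 hv
  set f : Module.End ℂ (Fin n → ℂ) := Matrix.toLin' (matF a ρ ν)ᵀ with hf
  have hfF : ∀ u, f u = opF a ρ ν u := fun u => rfl
  have hrank : Module.finrank ℂ (f.maxGenEigenspace μ) = 1 := by
    rw [LinearMap.finrank_maxGenEigenspace_eq, hf, Matrix.charpoly_toLin',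
      Matrix.charpoly_transpose, hμ.2]
  have hker : ∀ u, μ • u = opF a ρ ν u → (f - μ • (1 : Module.End ℂ (Fin n → ℂ))) u = 0 := by
    intro u hu
    rw [LinearMap.sub_apply, LinearMap.smul_apply, Module.End.one_apply, hfF, hu, sub_self]
  have hmem : ∀ u, μ • u = opF a ρ ν u → u ∈ f.maxGenEigenspace μ := fun u hu =>
    (Module.End.mem_maxGenEigenspace f μ u).2 ⟨1, by rw [pow_one, hker u hu]⟩
  have hspan : ∀ u ∈ f.maxGenEigenspace μ, ∃ c : ℂ, u = c • v := by
    intro u hu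
    obtain ⟨c, hc⟩ := exists_smul_eq_of_finrank_eq_one hrank
      (x := (⟨v, hmem v hvF⟩ : f.maxGenEigenspace μ)) (fun h => hv0 (congrArg Subtype.val h)) ⟨u, hu⟩
    exact ⟨c, (congrArg Subtype.val hc).symm⟩
  -- If `v = (f - μ) w`, then `w` is a generalized eigenvector, hence a multiple of `v`, and `(f -
  -- μ) w = 0`.
  have hnot : v ∉ LinearMap.range (f - μ • (1 : Module.End ℂ (Fin n → ℂ))) := by
    rintro ⟨w, hw⟩
    have hw2 : w ∈ f.maxGenEigenspace μ :=
      (Module.End.mem_maxGenEigenspace f μ w).2 ⟨2, by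
        rw [pow_two, Module.End.mul_apply, hw, hker v hvF]⟩
    obtain ⟨c, rfl⟩ := hspan w hw2
    rw [map_smul, hker v hvF, smul_zero] at hw
    exact hv0 hw.symm
  obtain ⟨l, hlv, hl⟩ := Submodule.exists_le_ker_of_notMem hnot
  refine ⟨(l v)⁻¹ • l, ?_, fun u => ?_, fun u hu => hspan u (hmem u hu)⟩
  · rw [LinearMap.smul_apply, smul_eq_mul, inv_mul_cancel₀ hlv]
  · have h1 : l ((f - μ • (1 : Module.End ℂ (Fin n → ℂ))) u) = 0 := hl ⟨u, rfl⟩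
    rw [LinearMap.sub_apply, LinearMap.smul_apply, Module.End.one_apply, hfF, ← neg_sub,
      map_neg, neg_eq_zero] at h1
    rw [LinearMap.smul_apply, h1, smul_zero]

/-- The linear map `u ↦ (μ u - F u, l u)`. -/
theorem exists_complement_bound {a : Fin n → ℂ} {ρ : Fin n → ℂ} {ν : Fin n → ℝ} {μ : ℂ}
    {v : Fin n → ℂ} {l : (Fin n → ℂ) →ₗ[ℂ] ℂ} (hlv : l v = 1)
    (hker : ∀ u, μ • u = opF a ρ ν u → ∃ c : ℂ, u = c • v) :
    ∃ B > (0 : ℝ), ∀ w, l w = 0 → ‖w‖ ≤ B * ‖μ • w - opF a ρ ν w‖ := by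
  set g : (Fin n → ℂ) →ₗ[ℝ] (Fin n → ℂ) × ℂ :=
    (LinearMap.prod ((μ • LinearMap.id (R := ℂ)) - Matrix.toLin' (matF a ρ ν)ᵀ) l).restrictScalars ℝ
    with hg
  have hgw : ∀ w, g w = (μ • w - opF a ρ ν w, l w) := fun w => rfl
  have hgk : LinearMap.ker g = ⊥ := by
    rw [LinearMap.ker_eq_bot']
    intro w hw
    rw [hgw, Prod.mk_eq_zero, sub_eq_zero] at hw
    obtain ⟨c, rfl⟩ := hker w hw.1
    have h1 := hw.2
    rw [map_smul, hlv, smul_eq_mul, mul_one] at h1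
    rw [h1, zero_smul]
  obtain ⟨K, hK0, hK⟩ := g.exists_antilipschitzWith hgk
  refine ⟨K, hK0, fun w hw => ?_⟩
  have h1 := hK.le_mul_norm_sub w 0
  rw [map_zero, add_zero, add_zero, norm_neg, norm_neg, hgw, hw, Prod.norm_def, norm_zero,
    max_eq_left (norm_nonneg _)] at h1
  exact h1

/-- The bordered map `(w, τ) ↦ (μ w - F w + τ v, l w)` is injective between spaces of equal finite
dimension: `l` detects `τ`, and then `w` is a multiple of `v` with `l w = 0`. So it is surjective.
-/
theorem exists_solution_of_simple {a : Fin n → ℂ} {ρ : Fin n → ℂ} {ν : Fin n → ℝ}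
    {μ : ℂ} {v : Fin n → ℂ} {l : (Fin n → ℂ) →ₗ[ℂ] ℂ} (hlv : l v = 1)
    (hl : ∀ u, l (μ • u - opF a ρ ν u) = 0)
    (hker : ∀ u, μ • u = opF a ρ ν u → ∃ c : ℂ, u = c • v) (e : Fin n → ℂ) :
    ∃ (w : Fin n → ℂ) (τ : ℂ), τ • v + (μ • w - opF a ρ ν w) = e := by
  set g : (Fin n → ℂ) × ℂ →ₗ[ℂ] (Fin n → ℂ) × ℂ :=
    LinearMap.prod (LinearMap.coprod ((μ • LinearMap.id) - Matrix.toLin' (matF a ρ ν)ᵀ)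
      (LinearMap.toSpanSingleton ℂ _ v)) (l.comp (LinearMap.fst ℂ _ _)) with hg
  have hgw : ∀ w τ, g (w, τ) = ((μ • w - opF a ρ ν w) + τ • v, l w) := fun w τ => rfl
  have hinj : Function.Injective g := by
    rw [← LinearMap.ker_eq_bot, LinearMap.ker_eq_bot']
    rintro ⟨w, τ⟩ hw
    rw [hgw, Prod.mk_eq_zero] at hw
    have h1 := congrArg l hw.1
    rw [map_add, hl, map_smul, hlv, map_zero, zero_add, smul_eq_mul, mul_one] at h1
    have h2 := hw.1
    rw [h1, zero_smul, add_zero, sub_eq_zero] at h2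
    obtain ⟨c, rfl⟩ := hker w h2
    have h3 := hw.2
    rw [map_smul, hlv, smul_eq_mul, mul_one] at h3
    rw [h1, h3, zero_smul]; rfl
  obtain ⟨⟨w, τ⟩, hw⟩ := (LinearMap.injective_iff_surjective.1 hinj) (e, 0)
  rw [hgw, Prod.mk.injEq] at hw
  exact ⟨w, τ, by rw [add_comm]; exact hw.1⟩

/-- Expansion at `(μ, J v)`: every term of the last bracket is either the product `τ • w` or
contains one of the small operators `A`, `G`. -/
theorem pencil_linearization {a : Fin n → ℂ} {ρ : Fin n → ℂ} {ν : Fin n → ℝ} {μ : ℂ}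
    {v : Fin n → ℂ} (hv : μ • v = opF a ρ ν v) (A G : CoeffSpace n →L[ℝ] CoeffSpace n) (τ : ℂ)
    (w : CoeffSpace n) :
    pencil a ρ ν A G (μ + τ) (leadEmb n v + w) =
      τ • leadEmb n v + (μ • w - leadEmb n (opF a ρ ν (leadCoeff n w))) +
        (τ • w + (μ + τ) • A (leadEmb n v + w) - G (leadEmb n v + w)) := by
  have h : leadEmb n (opF a ρ ν v) = μ • leadEmb n v := by rw [← hv, leadEmb_smul]
  rw [pencil, map_add (leadCoeff n), leadCoeff_leadEmb, map_add (opF a ρ ν), map_add (leadEmb n), h]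
  module

/-- Near a simple nonzero eigenvalue of `F` a slightly perturbed pencil has a kernel. -/
theorem exists_pencil_kernel {a : Fin n → ℂ} {ρ : Fin n → ℂ} {ν : Fin n → ℝ} {μ : ℂ}
    (hμ : IsSimpleNonzeroRootF a ρ ν μ) {v : Fin n → ℂ} (hv : IsEigenvectorF a ρ ν μ v) :
    ∃ K > (0 : ℝ), ∃ e₀ > (0 : ℝ), ∀ e, 0 ≤ e → e ≤ e₀ →
      ∀ A G : CoeffSpace n →L[ℝ] CoeffSpace n, ‖A‖ ≤ e → ‖G‖ ≤ e →
        ∃ (κ : ℂ) (d : CoeffSpace n), κ ≠ 0 ∧ d ≠ 0 ∧ pencil a ρ ν A G κ d = 0 ∧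
          ‖κ - μ‖ ≤ K * e ∧ (∀ k, ‖d (k, 0) - v k‖ ≤ K * e * ‖v‖) ∧
          ∀ k j, ‖d (k, j + 1)‖ ≤ ‖v‖ := by
  obtain ⟨hv0, hvF⟩ := isEigenvectorF_iff.1 hv
  obtain ⟨l, hlv, hl, hker⟩ := hμ.exists_functional hv
  have hμ0 := hμ.1
  have hvp : 0 < ‖v‖ := norm_pos_iff.2 hv0
  set D : ℂ × CoeffSpace n →L[ℝ] CoeffSpace n :=
    (ContinuousLinearMap.fst ℝ ℂ (CoeffSpace n)).smulRight (leadEmb n v) +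
      (μ • ContinuousLinearMap.snd ℝ ℂ (CoeffSpace n) -
        (leadEmb n).comp ((opF a ρ ν).comp ((leadCoeff n).comp
          (ContinuousLinearMap.snd ℝ ℂ (CoeffSpace n))))) with hD
  have hDx : ∀ x : ℂ × CoeffSpace n, D x = x.1 • leadEmb n v +
      (μ • x.2 - leadEmb n (opF a ρ ν (leadCoeff n x.2))) := fun x => rfl
  -- The leading coefficients are solved for by the bordered system; on the higher ones `D` is
  -- multiplication by `μ ≠ 0`.
  have hsurj : (D : ℂ × CoeffSpace n →ₗ[ℝ] CoeffSpace n).range = ⊤ := by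
    rw [LinearMap.range_eq_top]
    intro y
    obtain ⟨w, τ, hw⟩ := exists_solution_of_simple hlv hl hker (leadCoeff n y)
    refine ⟨(τ, leadEmb n w + μ⁻¹ • (y - leadEmb n (leadCoeff n y))), ?_⟩
    change D _ = y
    have hz : leadCoeff n (μ⁻¹ • (y - leadEmb n (leadCoeff n y))) = 0 := by
      rw [leadCoeff_smul, map_sub, leadCoeff_leadEmb, sub_self, smul_zero]
    have h1 := congrArg (leadEmb n) hw
    rw [map_add, map_sub, leadEmb_smul, leadEmb_smul] at h1
    rw [hDx]
    simp only
    rw [map_add (leadCoeff n), hz, add_zero, leadCoeff_leadEmb, smul_add, smul_inv_smul₀ hμ0]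
    calc _ = τ • leadEmb n v + (μ • leadEmb n w - leadEmb n (opF a ρ ν w)) +
          (y - leadEmb n (leadCoeff n y)) := by abel
      _ = y := by rw [h1]; abel
  set S := D.nonlinearRightInverseOfSurjective hsurj with hS
  have hSp : (0 : ℝ) < S.nnnorm := by
    exact_mod_cast D.nonlinearRightInverseOfSurjective_nnnorm_pos hsurj
  obtain ⟨N, hN⟩ : ∃ N : ℝ, N = S.nnnorm := ⟨_, rfl⟩
  rw [← hN] at hSp
  -- The residual at the origin is at most `(‖μ‖ + 1) e ‖v‖`. A right inverse of size `N` and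
  -- Lipschitz error `N⁻¹ / 2` cover targets at distance `ϱ / (2 N)`, hence the radius `ϱ = k₀ ‖v‖
  -- e`.
  set k₀ : ℝ := 2 * N * (‖μ‖ + 1) with hk₀
  have hk₀p : 0 < k₀ := by positivity
  set M : ℝ := ‖v‖ + ‖μ‖ + 3 with hM
  have hMp : 0 < M := by positivity
  have hμp : 0 < ‖μ‖ := norm_pos_iff.2 hμ0
  -- The four bounds ensure, in order: a nonzero kernel element, `ϱ ≤ 1`, `κ ≠ 0`, and the Lipschitz
  -- error `N⁻¹ / 2`, where `M` collects the coefficients of `e`.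
  set e₀ : ℝ := min (min (1 / (2 * k₀)) (1 / (k₀ * ‖v‖)))
    (min (‖μ‖ / (2 * (k₀ * ‖v‖))) (N⁻¹ / 2 / (2 * (k₀ * ‖v‖) + M))) with he₀
  refine ⟨k₀ * (1 + ‖v‖), by positivity, e₀, by positivity, fun e he hee A G hA hG => ?_⟩
  have b1 : k₀ * e ≤ 1 / 2 := by
    have := hee.trans ((min_le_left _ _).trans (min_le_left _ _))
    rw [le_div_iff₀ (by positivity)] at this; linarith
  have b2 : k₀ * ‖v‖ * e ≤ 1 := by
    have := hee.trans ((min_le_left _ _).trans (min_le_right _ _))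
    rw [le_div_iff₀ (by positivity)] at this; linarith
  have b3 : k₀ * ‖v‖ * e ≤ ‖μ‖ / 2 := by
    have := hee.trans ((min_le_right _ _).trans (min_le_left _ _))
    rw [le_div_iff₀ (by positivity)] at this; linarith
  have b4 : 2 * (k₀ * ‖v‖ * e) + M * e ≤ N⁻¹ / 2 := by
    have := hee.trans ((min_le_right _ _).trans (min_le_right _ _))
    rw [le_div_iff₀ (by positivity)] at this; linarith
  set ϱ : ℝ := k₀ * ‖v‖ * e with hϱ
  have hϱ0 : 0 ≤ ϱ := by positivity
  set f : ℂ × CoeffSpace n → CoeffSpace n := fun x =>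
    pencil a ρ ν A G (μ + x.1) (leadEmb n v + x.2) with hf
  have hJv := norm_leadEmb_le v
  have happ : ApproximatesLinearOn f D (closedBall 0 ϱ) (S.nnnorm⁻¹ / 2) := by
    intro x hx y hy
    rw [mem_closedBall_zero_iff] at hx hy
    have hx2 : ‖x.2‖ ≤ ϱ := (norm_snd_le x).trans hx
    have hy1 : ‖y.1‖ ≤ ϱ := (norm_fst_le y).trans hy
    have hd1 : ‖x.1 - y.1‖ ≤ ‖x - y‖ := norm_fst_le (x - y)
    have hd2 : ‖x.2 - y.2‖ ≤ ‖x - y‖ := norm_snd_le (x - y)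
    have hdec : f x - f y - D (x - y) = (x.1 - y.1) • x.2 + y.1 • (x.2 - y.2) +
        (x.1 - y.1) • A (leadEmb n v + x.2) + (μ + y.1) • A (x.2 - y.2) - G (x.2 - y.2) := by
      rw [map_sub D, hDx, hDx, hf]
      simp only
      rw [pencil_linearization hvF, pencil_linearization hvF, map_sub A, map_sub G,
        map_add A, map_add A, map_add G, map_add G]
      module
    rw [hdec]
    have t1 : ‖(x.1 - y.1) • x.2‖ ≤ ‖x - y‖ * ϱ := by rw [norm_smul]; gcongr
    have t2 : ‖y.1 • (x.2 - y.2)‖ ≤ ϱ * ‖x - y‖ := by rw [norm_smul]; gcongr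
    have t3 : ‖(x.1 - y.1) • A (leadEmb n v + x.2)‖ ≤ ‖x - y‖ * (e * (‖v‖ + 1)) := by
      rw [norm_smul]
      have : ‖leadEmb n v + x.2‖ ≤ ‖v‖ + 1 := (norm_add_le _ _).trans (by linarith)
      have := (A.le_of_opNorm_le hA (leadEmb n v + x.2)).trans
        (mul_le_mul_of_nonneg_left this he)
      gcongr
    have t4 : ‖(μ + y.1) • A (x.2 - y.2)‖ ≤ (‖μ‖ + 1) * (e * ‖x - y‖) := by
      rw [norm_smul]
      have h1 : ‖μ + y.1‖ ≤ ‖μ‖ + 1 := (norm_add_le _ _).trans (by linarith)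
      have := (A.le_of_opNorm_le hA (x.2 - y.2)).trans (mul_le_mul_of_nonneg_left hd2 he)
      gcongr
    have t5 : ‖G (x.2 - y.2)‖ ≤ e * ‖x - y‖ :=
      (G.le_of_opNorm_le hG (x.2 - y.2)).trans (mul_le_mul_of_nonneg_left hd2 he)
    calc _ ≤ ‖x - y‖ * ϱ + ϱ * ‖x - y‖ + ‖x - y‖ * (e * (‖v‖ + 1)) +
          (‖μ‖ + 1) * (e * ‖x - y‖) + e * ‖x - y‖ :=
        norm_sub_le_of_le (norm_add_le_of_le (norm_add_le_of_le (norm_add_le_of_le t1 t2) t3) t4) t5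
      _ = (2 * ϱ + M * e) * ‖x - y‖ := by rw [hM]; ring
      _ ≤ (N⁻¹ / 2) * ‖x - y‖ := by gcongr
      _ = _ := by rw [hN]; push_cast; rfl
  have hsur := happ.surjOn_closedBall_of_nonlinearRightInverse S hϱ0 subset_rfl
  have hf0 : f 0 = μ • A (leadEmb n v) - G (leadEmb n v) := by
    rw [hf]
    simp only [Prod.fst_zero, Prod.snd_zero]
    rw [pencil_linearization hvF]
    simp
  have hf0n : ‖f 0‖ ≤ (‖μ‖ + 1) * (e * ‖v‖) := by
    rw [hf0]
    have h1 := (A.le_of_opNorm_le hA (leadEmb n v)).trans (mul_le_mul_of_nonneg_left hJv he)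
    have h2 := (G.le_of_opNorm_le hG (leadEmb n v)).trans (mul_le_mul_of_nonneg_left hJv he)
    calc _ ≤ ‖μ‖ * (e * ‖v‖) + e * ‖v‖ :=
          norm_sub_le_of_le (by rw [norm_smul]; gcongr) h2
      _ = _ := by ring
  obtain ⟨x, hx, hx0⟩ : (0 : CoeffSpace n) ∈ f '' closedBall 0 ϱ := by
    refine hsur ?_
    rw [mem_closedBall, dist_comm, dist_zero_right]
    refine hf0n.trans (le_of_eq ?_)
    push_cast
    rw [hϱ, hk₀, ← hN]
    field_simp
    ring
  rw [mem_closedBall_zero_iff] at hx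
  have hx1 : ‖x.1‖ ≤ ϱ := (norm_fst_le x).trans hx
  have hx2 : ‖x.2‖ ≤ ϱ := (norm_snd_le x).trans hx
  refine ⟨μ + x.1, leadEmb n v + x.2, ?_, ?_, hx0, ?_, fun k => ?_, fun k j => ?_⟩
  · intro h0
    have : ‖μ‖ = ‖x.1‖ := by rw [eq_neg_of_add_eq_zero_left h0, norm_neg]
    linarith
  · intro h0
    have h1 := congrArg (leadCoeff n) h0
    rw [map_add, map_zero, leadCoeff_leadEmb] at h1
    have h2 : ‖v‖ = ‖leadCoeff n x.2‖ := by rw [eq_neg_of_add_eq_zero_left h1, norm_neg]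
    have h3 := (norm_leadCoeff_le x.2).trans hx2
    have h4 : ϱ ≤ 1 / 2 * ‖v‖ := by
      calc ϱ = k₀ * e * ‖v‖ := by rw [hϱ]; ring
        _ ≤ _ := by gcongr
    linarith
  · rw [add_sub_cancel_left]
    refine hx1.trans ?_
    have : 0 ≤ k₀ * e := by positivity
    rw [hϱ]; nlinarith
  · have h1 : (leadEmb n v + x.2) (k, 0) - v k = x.2 (k, 0) := by
      change leadEmb n v (k, 0) + x.2 (k, 0) - v k = _
      rw [leadEmb_apply]; simp
    rw [h1]
    refine ((x.2.norm_coe_le_norm _).trans hx2).trans ?_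
    have : 0 ≤ k₀ * e * ‖v‖ * ‖v‖ := by positivity
    rw [hϱ]; nlinarith
  · have h1 : (leadEmb n v + x.2) (k, j + 1) = x.2 (k, j + 1) := by
      change leadEmb n v (k, j + 1) + x.2 (k, j + 1) = _
      rw [leadEmb_apply]; simp
    rw [h1]
    refine ((x.2.norm_coe_le_norm _).trans hx2).trans ?_
    rw [hϱ]; nlinarith

/-- Kernels of slightly perturbed pencils near a simple nonzero eigenvalue of `F` are close to
eigenvectors of `F`. -/
theorem pencil_kernel_near_eigenvector {a : Fin n → ℂ} {ρ : Fin n → ℂ} {ν : Fin n → ℝ} {μ : ℂ}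
    (hμ : IsSimpleNonzeroRootF a ρ ν μ) :
    ∃ K > (0 : ℝ), ∃ e₀ > (0 : ℝ), ∃ η > (0 : ℝ), ∀ e, 0 ≤ e → e ≤ e₀ →
      ∀ A G : CoeffSpace n →L[ℝ] CoeffSpace n, ‖A‖ ≤ e → ‖G‖ ≤ e →
        ∀ (κ : ℂ) (d : CoeffSpace n), d ≠ 0 → pencil a ρ ν A G κ d = 0 → ‖κ - μ‖ ≤ η →
          ∃ v, IsEigenvectorF a ρ ν μ v ∧ ‖κ - μ‖ ≤ K * e ∧
            (∀ k, ‖d (k, 0) - v k‖ ≤ K * e * ‖v‖) ∧ ∀ k j, ‖d (k, j + 1)‖ ≤ ‖v‖ := by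
  obtain ⟨v₀, hv⟩ := exists_eigenvectorF hμ.isRootF
  obtain ⟨hv0, hvF⟩ := isEigenvectorF_iff.1 hv
  obtain ⟨l, hlv, hl, hker⟩ := hμ.exists_functional hv
  obtain ⟨B, hB, hBw⟩ := exists_complement_bound hlv hker
  have hμp : 0 < ‖μ‖ := norm_pos_iff.2 hμ.1
  set Lc := LinearMap.toContinuousLinearMap l with hLc
  set P : ℝ := ‖Lc‖ * ‖v₀‖ with hP
  have hlP : ∀ y, ‖l y • v₀‖ ≤ P * ‖y‖ := fun y => by
    rw [norm_smul]
    calc _ ≤ ‖Lc‖ * ‖y‖ * ‖v₀‖ := by gcongr; exact Lc.le_opNorm y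
      _ = _ := by rw [hP]; ring
  have hP0 : 0 ≤ P := by positivity
  set c : ℝ := ‖μ‖ / 2 with hc
  have hcp : 0 < c := by positivity
  set E₁ : ℝ := 2 * (1 + 2 * ‖μ‖) with hE₁
  have hE₁p : 0 < E₁ := by positivity
  set W : ℝ := 2 * B * ((1 + P) * E₁) with hW
  have hWp : 0 < W := by positivity
  refine ⟨2 * P * E₁ + 2 * W, by positivity, min (1 / (4 * (1 + c⁻¹))) (1 / (2 * W)), by positivity,
    min (‖μ‖ / 2) (1 / (2 * B)), by positivity, fun e he hee A G hA hG κ d hd0 hd hκη => ?_⟩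
  have b1 : e * (1 + c⁻¹) ≤ 1 / 4 := by
    have := hee.trans (min_le_left _ _)
    rw [le_div_iff₀ (by positivity)] at this; linarith
  have b2 : W * e ≤ 1 / 2 := by
    have := hee.trans (min_le_right _ _)
    rw [le_div_iff₀ (by positivity)] at this; linarith
  have hη1 : ‖κ - μ‖ ≤ ‖μ‖ / 2 := hκη.trans (min_le_left _ _)
  have hη2 : B * ‖κ - μ‖ ≤ 1 / 2 := by
    have := hκη.trans (min_le_right _ _)
    rw [le_div_iff₀ (by positivity)] at this; linarith
  have hκ1 : c ≤ ‖κ‖ := by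
    have := norm_sub_norm_le μ κ
    rw [norm_sub_rev] at this
    rw [hc]; linarith
  have hκ2 : ‖κ‖ ≤ 2 * ‖μ‖ := by
    have := norm_sub_norm_le κ μ
    linarith
  obtain ⟨hdu, hy, herr⟩ := pencil_kernel_estimates hcp he b1 hA hG hκ1 hd
  have hu0 := leadCoeff_ne_zero hd0 hdu
  set u := leadCoeff n d with hu
  set z := κ • u - opF a ρ ν u with hz
  have hzn : ‖z‖ ≤ E₁ * e * ‖u‖ := herr.trans (by
    have : 2 * e * (1 + ‖κ‖) ≤ E₁ * e := by rw [hE₁]; nlinarith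
    gcongr)
  -- The leading part is split along the eigenvector and the kernel of `l`, where
  -- `exists_complement_bound` applies.
  set v := l u • v₀ with hvdef
  set w := u - v with hw
  have hvv : μ • v = opF a ρ ν v := by rw [hvdef, opF_smul, ← hvF, smul_comm]
  have hlw : l w = 0 := by
    rw [hw, map_sub, hvdef, map_smul, hlv, smul_eq_mul, mul_one, sub_self]
  -- `l` annihilates the range of `μ - F`, so applied to the residual it leaves only the shift `κ -
  -- μ`. This bounds the shift by a multiple of `e`.
  have hlz : (κ - μ) • v = l z • v₀ := by
    have h1 : z = (κ - μ) • u + (μ • u - opF a ρ ν u) := by rw [hz]; module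
    rw [h1, map_add, hl, add_zero, map_smul, smul_eq_mul, hvdef, smul_smul]
  have hweq : μ • w - opF a ρ ν w = z - l z • v₀ - (κ - μ) • w := by
    rw [← hlz, hw, map_sub, ← hvv, hz]
    module
  -- The term `(κ - μ) • w` is absorbed on the left because `B * ‖κ - μ‖ ≤ 1 / 2`, by the choice of
  -- `η`.
  have hwn : ‖w‖ ≤ W * e * ‖u‖ := by
    have h1 := hBw w hlw
    have h2 : ‖μ • w - opF a ρ ν w‖ ≤ (1 + P) * (E₁ * e * ‖u‖) + ‖κ - μ‖ * ‖w‖ := by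
      rw [hweq]
      calc _ ≤ ‖z‖ + P * ‖z‖ + ‖κ - μ‖ * ‖w‖ :=
            norm_sub_le_of_le (norm_sub_le_of_le le_rfl (hlP z)) (norm_smul _ _).le
        _ ≤ _ := by nlinarith
    have h3 : B * ‖κ - μ‖ * ‖w‖ ≤ 1 / 2 * ‖w‖ := by gcongr
    have h4 := h1.trans (mul_le_mul_of_nonneg_left h2 hB.le)
    rw [hW]
    nlinarith
  have huv : ‖u‖ ≤ 2 * ‖v‖ := by
    have h1 : ‖u‖ ≤ ‖w‖ + ‖v‖ := norm_le_norm_sub_add _ _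
    have h2 : W * e * ‖u‖ ≤ 1 / 2 * ‖u‖ := by gcongr
    linarith
  have hvp : 0 < ‖v‖ := by linarith
  refine ⟨v, isEigenvectorF_iff.2 ⟨norm_pos_iff.1 hvp, hvv⟩, ?_, fun k => ?_, fun k j => ?_⟩
  · have h1 : ‖κ - μ‖ * ‖v‖ ≤ 2 * P * E₁ * e * ‖v‖ := by
      rw [← norm_smul, hlz]
      calc _ ≤ P * (E₁ * e * (2 * ‖v‖)) := (hlP z).trans (by gcongr; exact hzn.trans (by gcongr))
        _ = _ := by ring
    have h2 := le_of_mul_le_mul_right h1 hvp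
    have : 0 ≤ W * e := by positivity
    linarith
  · have h1 : d (k, 0) - v k = w k := rfl
    rw [h1]
    have h2 : W * e * ‖u‖ ≤ W * e * (2 * ‖v‖) := by gcongr
    have h3 : 0 ≤ P * E₁ * e * ‖v‖ := by positivity
    linarith [norm_le_pi_norm w k]
  · have h1 : d (k, j + 1) = (d - leadEmb n u) (k, j + 1) := by
      change _ = d (k, j + 1) - leadEmb n u (k, j + 1)
      rw [leadEmb_apply]; simp
    rw [h1]
    refine ((BoundedContinuousFunction.norm_coe_le_norm _ _).trans hy).trans ?_
    have h2 : 2 * (e * (1 + c⁻¹)) * ‖u‖ ≤ 1 / 2 * ‖u‖ := by gcongr; linarith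
    linarith

theorem exists_pos_forall_mul_le {C e : ℝ} (hC : 0 ≤ C) (he : 0 < e) :
    ∃ δ > (0 : ℝ), ∀ r, 0 < r → r < δ → C * r ≤ e := by
  refine ⟨e / (C + 1), by positivity, fun r hr hrδ => ?_⟩
  rw [lt_div_iff₀ (by positivity)] at hrδ
  nlinarith

theorem Separated.admissible_radii {a : Fin n → ℂ} {s : ℝ} (h : Separated a s) {ν : Fin n → ℝ}
    (hν : IsRatio ν) {r : ℝ} (hr : 0 < r) (hrs : r ≤ s) : Admissible a (radii ν r) :=
  h.admissible fun k => ⟨radii_pos hν hr k, (radii_le hν hr k).trans hrs⟩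

theorem exists_eigensolution_near {a : Fin n → ℂ} {s : ℝ} (h : Separated a s) {ρ : Fin n → ℂ}
    (hρ : ∀ k, ‖ρ k‖ < 1) {ν : Fin n → ℝ} (hν : IsRatio ν) {μ : ℂ}
    (hμ : IsSimpleNonzeroRootF a ρ ν μ) {v : Fin n → ℂ} (hv : IsEigenvectorF a ρ ν μ v) :
    ∃ C > (0 : ℝ), ∃ δ > (0 : ℝ), ∀ r : ℝ, 0 < r → r < δ →
      ∃ (lam : ℂ) (φ : ℂ → ℂ) (φi : Fin n → ℂ → ℂ) (φ0 : ℂ → ℂ),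
        IsEigensolution a (radii ν r) ρ lam φ φi φ0 ∧ LeadingOrder a ρ ν μ v C r lam φi φ0 := by
  have hs := h.pos
  obtain ⟨K, hK, e₀, he₀, hker⟩ := exists_pencil_kernel hμ hv
  set C₀ : ℝ := (n : ℝ) ^ 2 / s ^ 3 with hC₀
  have hC₀0 : 0 ≤ C₀ := by positivity
  obtain ⟨δ, hδ, hδe⟩ := exists_pos_forall_mul_le hC₀0 (lt_min he₀ (by norm_num : (0 : ℝ) < 1 / 2))
  refine ⟨(K * C₀ + 1) * (1 + n / s ^ 2), by positivity, min δ s, lt_min hδ hs, fun r hr hrδ => ?_⟩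
  have hrs : r ≤ s := hrδ.le.trans (min_le_right _ _)
  have hre := hδe r hr (hrδ.trans_le (min_le_left _ _))
  obtain ⟨A, G, hAG⟩ := h.exists_realizes hρ hν hr hrs
  have hadm := h.admissible_radii hν hr hrs
  obtain ⟨κ, d, hκ, hd0, hd, h1, h2, h3⟩ := hker (C₀ * r) (by positivity)
    (hre.trans (min_le_left _ _)) A G hAG.norm_A hAG.norm_G
  obtain ⟨φ, φi, φ0, hsol, hrep⟩ := hAG.exists_eigensolution hρ hr
    ((hre.trans (min_le_right _ _)).trans_lt (by norm_num)) hadm hκ hd0 hd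
  have hKr : K * (C₀ * r) ≤ (K * C₀ + 1) * r := by nlinarith
  have hK1 : 1 ≤ K * C₀ + 1 := by
    have : 0 ≤ K * C₀ := by positivity
    linarith
  exact ⟨_, φ, φi, φ0, hsol, hrep.leadingOrder h hρ hν hr hrs (by positivity) (h1.trans hKr)
    (fun k => (h2 k).trans (by gcongr))
    fun k j => (h3 k j).trans (le_mul_of_one_le_left (norm_nonneg _) hK1)⟩

theorem eigensolution_near_leadingOrder {a : Fin n → ℂ} {s : ℝ} (h : Separated a s)
    {ρ : Fin n → ℂ} (hρ : ∀ k, ‖ρ k‖ < 1) {ν : Fin n → ℝ} (hν : IsRatio ν) {μ : ℂ}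
    (hμ : IsSimpleNonzeroRootF a ρ ν μ) :
    ∃ C > (0 : ℝ), ∃ δ > (0 : ℝ), ∃ η > (0 : ℝ), ∀ r : ℝ, 0 < r → r < δ →
      ∀ (lam : ℂ) (φ : ℂ → ℂ) (φi : Fin n → ℂ → ℂ) (φ0 : ℂ → ℂ),
        IsEigensolution a (radii ν r) ρ lam φ φi φ0 →
        ‖lam - (r : ℂ) ^ 2 * μ‖ ≤ η * r ^ 2 →
        ∃ v : Fin n → ℂ, IsEigenvectorF a ρ ν μ v ∧ LeadingOrder a ρ ν μ v C r lam φi φ0 := by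
  have hs := h.pos
  obtain ⟨K, hK, e₀, he₀, η, hη, hker⟩ := pencil_kernel_near_eigenvector hμ
  set C₀ : ℝ := (n : ℝ) ^ 2 / s ^ 3 with hC₀
  have hC₀0 : 0 ≤ C₀ := by positivity
  obtain ⟨δ, hδ, hδe⟩ := exists_pos_forall_mul_le hC₀0 he₀
  refine ⟨(K * C₀ + 1) * (1 + n / s ^ 2), by positivity, min δ s, lt_min hδ hs, η, hη,
    fun r hr hrδ lam φ φi φ0 hsol hlam => ?_⟩
  have hrs : r ≤ s := hrδ.le.trans (min_le_right _ _)
  have hre := hδe r hr (hrδ.trans_le (min_le_left _ _))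
  obtain ⟨A, G, hAG⟩ := h.exists_realizes hρ hν hr hrs
  have hadm := h.admissible_radii hν hr hrs
  obtain ⟨d, hd0, hd, hrep⟩ := hAG.of_eigensolution hr hadm hsol
  have hr0 : (r : ℂ) ^ 2 ≠ 0 := pow_ne_zero _ (by exact_mod_cast hr.ne')
  set κ := ((r : ℂ) ^ 2)⁻¹ * lam with hκ
  have hlamκ : lam = (r : ℂ) ^ 2 * κ := by rw [hκ, mul_inv_cancel_left₀ hr0]
  rw [hlamκ] at hlam hrep ⊢
  have hκη : ‖κ - μ‖ ≤ η := by
    rw [← mul_sub, norm_mul, norm_pow, Complex.norm_real, Real.norm_eq_abs, sq_abs, mul_comm] at hlam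
    exact le_of_mul_le_mul_right hlam (by positivity)
  obtain ⟨v, hv, h1, h2, h3⟩ := hker (C₀ * r) (by positivity) hre A G hAG.norm_A hAG.norm_G κ d
    hd0 hd hκη
  have hKr : K * (C₀ * r) ≤ (K * C₀ + 1) * r := by nlinarith
  have hK1 : 1 ≤ K * C₀ + 1 := by
    have : 0 ≤ K * C₀ := by positivity
    linarith
  exact ⟨v, hv, hrep.leadingOrder h hρ hν hr hrs (by positivity) (h1.trans hKr)
    (fun k => (h2 k).trans (by gcongr))
    fun k j => (h3 k j).trans (le_mul_of_one_le_left (norm_nonneg _) hK1)⟩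

/-! ### Schur complement and a kernel parameter of largest modulus -/

/-- The projection onto the higher coefficients. -/
noncomputable def higherProj (n : ℕ) : CoeffSpace n →L[ℝ] CoeffSpace n :=
  1 - (leadEmb n).comp (leadCoeff n)

theorem higherProj_apply (d : CoeffSpace n) :
    higherProj n d = d - leadEmb n (leadCoeff n d) := rfl

theorem leadCoeff_higherProj (d : CoeffSpace n) : leadCoeff n (higherProj n d) = 0 := by
  rw [higherProj_apply, map_sub, leadCoeff_leadEmb, sub_self]

/-- The operator that determines the higher coefficients of a kernel element of the pencil from
the leading ones. -/
noncomputable def schurOp (A G : CoeffSpace n →L[ℝ] CoeffSpace n) (κ : ℂ) :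
    CoeffSpace n →L[ℝ] CoeffSpace n := 1 + (higherProj n).comp (A - κ⁻¹ • G)

theorem schurOp_apply (A G : CoeffSpace n →L[ℝ] CoeffSpace n) (κ : ℂ) (d : CoeffSpace n) :
    schurOp A G κ d = d + higherProj n (A d - κ⁻¹ • G d) := rfl

theorem norm_higherProj_le_quarter {A G : CoeffSpace n →L[ℝ] CoeffSpace n} {c e : ℝ} (hc : 0 < c)
    (hec : e * (1 + c⁻¹) ≤ 1 / 4) (hA : ‖A‖ ≤ e) (hG : ‖G‖ ≤ e) {κ : ℂ}
    (hκ : c ≤ ‖κ‖) (d : CoeffSpace n) : ‖higherProj n (A d - κ⁻¹ • G d)‖ ≤ 1 / 4 * ‖d‖ := by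
  have hA' := A.le_of_opNorm_le hA d
  have hG' := G.le_of_opNorm_le hG d
  have h1 : ‖κ⁻¹ • G d‖ ≤ c⁻¹ * (e * ‖d‖) := by
    rw [norm_smul, norm_inv]
    have : ‖κ‖⁻¹ ≤ c⁻¹ := inv_anti₀ hc hκ
    exact mul_le_mul this hG' (norm_nonneg _) (by positivity)
  calc _ ≤ ‖A d - κ⁻¹ • G d‖ := norm_sub_leadEmb_le _
    _ ≤ e * ‖d‖ + c⁻¹ * (e * ‖d‖) := norm_sub_le_of_le hA' h1
    _ = e * (1 + c⁻¹) * ‖d‖ := by ring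
    _ ≤ _ := by gcongr

theorem isUnit_schurOp {A G : CoeffSpace n →L[ℝ] CoeffSpace n} {c e : ℝ} (hc : 0 < c)
    (hec : e * (1 + c⁻¹) ≤ 1 / 4) (hA : ‖A‖ ≤ e) (hG : ‖G‖ ≤ e) {κ : ℂ}
    (hκ : c ≤ ‖κ‖) : IsUnit (schurOp A G κ) := by
  have h1 : schurOp A G κ = 1 - -(higherProj n).comp (A - κ⁻¹ • G) := by
    rw [schurOp, sub_neg_eq_add]
  rw [h1]
  refine isUnit_one_sub_of_norm_lt_one (R := CoeffSpace n →L[ℝ] CoeffSpace n) ?_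
  rw [norm_neg]
  refine (ContinuousLinearMap.opNorm_le_bound _ (by norm_num : (0 : ℝ) ≤ 1 / 4) fun d => ?_).trans_lt
    (by norm_num)
  exact norm_higherProj_le_quarter hc hec hA hG hκ d

/-- The element with prescribed leading coefficients that solves the higher equations. -/
noncomputable def schurLift (A G : CoeffSpace n →L[ℝ] CoeffSpace n) (κ : ℂ) :
    (Fin n → ℂ) →L[ℝ] CoeffSpace n := (Ring.inverse (schurOp A G κ)).comp (leadEmb n)

/-- The reduced operator on the leading coefficients. -/
noncomputable def reducedOp (a : Fin n → ℂ) (ρ : Fin n → ℂ) (ν : Fin n → ℝ)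
    (A G : CoeffSpace n →L[ℝ] CoeffSpace n) (κ : ℂ) : (Fin n → ℂ) →L[ℝ] (Fin n → ℂ) :=
  (leadCoeff n).comp ((κ • (1 + A) - (leadEmb n).comp ((opF a ρ ν).comp (leadCoeff n)) - G).comp
    (schurLift A G κ))

theorem reducedOp_apply (a : Fin n → ℂ) (ρ : Fin n → ℂ) (ν : Fin n → ℝ)
    (A G : CoeffSpace n →L[ℝ] CoeffSpace n) (κ : ℂ) (u : Fin n → ℂ) :
    reducedOp a ρ ν A G κ u = leadCoeff n (pencil a ρ ν A G κ (schurLift A G κ u)) := rfl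

/-- The projection removes the term with `F`, so the higher equations, divided by `κ`, involve only
`schurOp` and the leading coefficients. -/
theorem higherProj_pencil (a : Fin n → ℂ) (ρ : Fin n → ℂ) (ν : Fin n → ℝ)
    (A G : CoeffSpace n →L[ℝ] CoeffSpace n) {κ : ℂ} (hκ : κ ≠ 0) (d : CoeffSpace n) :
    higherProj n (pencil a ρ ν A G κ d) = κ • (schurOp A G κ d - leadEmb n (leadCoeff n d)) := by
  rw [schurOp_apply, pencil, higherProj_apply, higherProj_apply]
  simp only [map_sub, map_add, leadCoeff_smul, leadEmb_smul, leadCoeff_leadEmb, smul_sub, smul_add,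
    smul_inv_smul₀ hκ]
  abel

section
variable {a : Fin n → ℂ} {ρ : Fin n → ℂ} {ν : Fin n → ℝ} {A G : CoeffSpace n →L[ℝ] CoeffSpace n}
  {κ : ℂ}

theorem schurOp_schurLift (hT : IsUnit (schurOp A G κ)) (u : Fin n → ℂ) :
    schurOp A G κ (schurLift A G κ u) = leadEmb n u :=
  congrArg (fun X : CoeffSpace n →L[ℝ] CoeffSpace n => X (leadEmb n u)) (Ring.mul_inverse_cancel _ hT)

theorem leadCoeff_schurLift (hT : IsUnit (schurOp A G κ)) (u : Fin n → ℂ) :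
    leadCoeff n (schurLift A G κ u) = u := by
  have h := congrArg (leadCoeff n) (schurOp_schurLift hT u)
  rwa [schurOp_apply, map_add, leadCoeff_higherProj, add_zero, leadCoeff_leadEmb] at h

theorem pencil_schurLift (hκ : κ ≠ 0) (hT : IsUnit (schurOp A G κ)) (u : Fin n → ℂ) :
    pencil a ρ ν A G κ (schurLift A G κ u) = leadEmb n (reducedOp a ρ ν A G κ u) := by
  have h := higherProj_pencil a ρ ν A G hκ (schurLift A G κ u)
  rw [schurOp_schurLift hT, leadCoeff_schurLift hT, sub_self, smul_zero, higherProj_apply,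
    sub_eq_zero] at h
  exact h

/-- Invertibility of `schurOp` makes the higher coefficients a function of the leading ones, which
leaves a finite-dimensional problem. Normalization uses a real factor, since the reduced operator is
only real-linear. -/
theorem exists_pencil_kernel_iff (hκ : κ ≠ 0) (hT : IsUnit (schurOp A G κ)) :
    (∃ d, d ≠ 0 ∧ pencil a ρ ν A G κ d = 0) ↔ ∃ u, ‖u‖ = 1 ∧ reducedOp a ρ ν A G κ u = 0 := by
  constructor
  · rintro ⟨d, hd0, hd⟩
    have h1 : schurOp A G κ d = leadEmb n (leadCoeff n d) := by
      have h := higherProj_pencil a ρ ν A G hκ d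
      rw [hd, map_zero, eq_comm, smul_eq_zero_iff_right hκ, sub_eq_zero] at h
      exact h
    have h2 : schurLift A G κ (leadCoeff n d) = d := by
      change Ring.inverse (schurOp A G κ) (leadEmb n (leadCoeff n d)) = d
      rw [← h1]
      exact congrArg (fun X : CoeffSpace n →L[ℝ] CoeffSpace n => X d) (Ring.inverse_mul_cancel _ hT)
    have hu : leadCoeff n d ≠ 0 := fun h0 => hd0 (by rw [← h2, h0, map_zero])
    refine ⟨(‖leadCoeff n d‖⁻¹ : ℝ) • leadCoeff n d, ?_, ?_⟩
    · rw [norm_smul, norm_inv, norm_norm, inv_mul_cancel₀ (norm_ne_zero_iff.2 hu)]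
    · rw [map_smul, reducedOp_apply, h2, hd, map_zero, smul_zero]
  · rintro ⟨u, hu, h⟩
    refine ⟨schurLift A G κ u, fun h0 => ?_, by rw [pencil_schurLift hκ hT, h, map_zero]⟩
    have h1 := leadCoeff_schurLift hT u
    rw [h0, map_zero] at h1
    rw [← h1, norm_zero] at hu
    exact zero_ne_one hu

theorem norm_reducedOp_sub_le {c e : ℝ} (hc : 0 < c)
    (he : 0 ≤ e) (hec : e * (1 + c⁻¹) ≤ 1 / 4) (hA : ‖A‖ ≤ e) (hG : ‖G‖ ≤ e)
    (hκ : c ≤ ‖κ‖) (u : Fin n → ℂ) :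
    ‖reducedOp a ρ ν A G κ u - (κ • u - opF a ρ ν u)‖ ≤ 2 * e * (1 + ‖κ‖) * ‖u‖ := by
  have hT := isUnit_schurOp hc hec hA hG hκ
  set d := schurLift A G κ u with hd
  have hdu : ‖d‖ ≤ 2 * ‖u‖ := by
    have h1 := schurOp_schurLift hT u
    rw [← hd, schurOp_apply, ← eq_sub_iff_add_eq] at h1
    have h2 : ‖d‖ ≤ ‖u‖ + 1 / 4 * ‖d‖ := by
      conv_lhs => rw [h1]
      exact norm_sub_le_of_le (norm_leadEmb_le u) (norm_higherProj_le_quarter hc hec hA hG hκ d)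
    linarith [norm_nonneg u]
  have h1 : reducedOp a ρ ν A G κ u - (κ • u - opF a ρ ν u) =
      κ • leadCoeff n (A d) - leadCoeff n (G d) := by
    rw [reducedOp_apply, ← hd, pencil, map_sub, map_sub, leadCoeff_smul, map_add, leadCoeff_leadEmb,
      hd, leadCoeff_schurLift hT, smul_add]
    abel
  rw [h1]
  have h4 := (norm_leadCoeff_le (G d)).trans (G.le_of_opNorm_le hG d)
  have h5 : ‖κ • leadCoeff n (A d)‖ ≤ ‖κ‖ * (e * ‖d‖) := by
    rw [norm_smul]
    have := (norm_leadCoeff_le (A d)).trans (A.le_of_opNorm_le hA d)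
    gcongr
  calc _ ≤ ‖κ‖ * (e * ‖d‖) + e * ‖d‖ := norm_sub_le_of_le h5 h4
    _ = e * (1 + ‖κ‖) * ‖d‖ := by ring
    _ ≤ e * (1 + ‖κ‖) * (2 * ‖u‖) := by gcongr
    _ = _ := by ring

theorem continuousOn_reducedOp {c e : ℝ} (hc : 0 < c)
    (hec : e * (1 + c⁻¹) ≤ 1 / 4) (hA : ‖A‖ ≤ e) (hG : ‖G‖ ≤ e) :
    ContinuousOn (reducedOp a ρ ν A G) {κ | c ≤ ‖κ‖} := by
  have hinv : ContinuousOn (fun κ : ℂ => κ⁻¹) {κ | c ≤ ‖κ‖} :=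
    continuousOn_inv₀.mono fun κ (hκ : c ≤ ‖κ‖) => norm_pos_iff.1 (hc.trans_le hκ)
  have hT : ContinuousOn (schurOp A G) {κ | c ≤ ‖κ‖} :=
    continuousOn_const.add (continuousOn_const.clm_comp
      (continuousOn_const.sub (hinv.smul continuousOn_const)))
  have hTi : ContinuousOn (fun κ => Ring.inverse (schurOp A G κ)) {κ | c ≤ ‖κ‖} := fun κ hκ => by
    obtain ⟨x, hx⟩ := isUnit_schurOp hc hec hA hG hκ
    have h1 := NormedRing.inverse_continuousAt (R := CoeffSpace n →L[ℝ] CoeffSpace n) x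
    rw [hx] at h1
    exact h1.comp_continuousWithinAt (hT κ hκ)
  exact continuousOn_const.clm_comp ((((continuousOn_id.smul continuousOn_const).sub
    continuousOn_const).sub continuousOn_const).clm_comp (hTi.clm_comp continuousOn_const))

/-- Among the spectral parameters bounded below by `c` there is one of largest modulus, as soon as
there is one at all. -/
theorem exists_max_kernel {c e N : ℝ} (hc : 0 < c)
    (he : 0 ≤ e) (hec : e * (1 + c⁻¹) ≤ 1 / 4) (hA : ‖A‖ ≤ e) (hG : ‖G‖ ≤ e)
    (hN : ∀ u, ‖opF a ρ ν u‖ ≤ N * ‖u‖)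
    (hne : ∃ κ, c ≤ ‖κ‖ ∧ ∃ d, d ≠ 0 ∧ pencil a ρ ν A G κ d = 0) :
    ∃ κ, c ≤ ‖κ‖ ∧ (∃ d, d ≠ 0 ∧ pencil a ρ ν A G κ d = 0) ∧
      ∀ κ', c ≤ ‖κ'‖ → (∃ d, d ≠ 0 ∧ pencil a ρ ν A G κ' d = 0) → ‖κ'‖ ≤ ‖κ‖ := by
  -- Kernel parameters with `|κ| ≥ c` have modulus at most `2 N + 1`, so pairs of parameter and unit
  -- null vector form a compact set, on which `|κ|` is maximized.
  set S : Set (ℂ × (Fin n → ℂ)) := (closedBall 0 (2 * N + 1) ∩ {κ | c ≤ ‖κ‖}) ×ˢ sphere 0 1 with hS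
  have hScomp : IsCompact S := ((isCompact_closedBall _ _).inter_right
    (isClosed_le continuous_const continuous_norm)).prod (isCompact_sphere _ _)
  have hcont : ContinuousOn (fun x : ℂ × (Fin n → ℂ) => reducedOp a ρ ν A G x.1 x.2) S :=
    ((continuousOn_reducedOp hc hec hA hG).comp continuousOn_fst fun x hx => hx.1.2).clm_apply
      continuousOn_snd
  have hZ : IsCompact (S ∩ (fun x : ℂ × (Fin n → ℂ) => reducedOp a ρ ν A G x.1 x.2) ⁻¹' {0}) :=
    hScomp.of_isClosed_subset (hcont.preimage_isClosed_of_isClosed hScomp.isClosed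
      isClosed_singleton) inter_subset_left
  have hmem : ∀ κ, c ≤ ‖κ‖ → (∃ d, d ≠ 0 ∧ pencil a ρ ν A G κ d = 0) →
      ∃ u, (κ, u) ∈ S ∩ (fun x : ℂ × (Fin n → ℂ) => reducedOp a ρ ν A G x.1 x.2) ⁻¹' {0} := by
    intro κ hκ hd
    have hκ0 : κ ≠ 0 := norm_pos_iff.1 (hc.trans_le hκ)
    obtain ⟨u, hu, hu0⟩ := (exists_pencil_kernel_iff hκ0 (isUnit_schurOp hc hec hA hG hκ)).1 hd
    obtain ⟨d, hd0, hd⟩ := hd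
    obtain ⟨hdu, -, hest⟩ := pencil_kernel_estimates hc he hec hA hG hκ hd
    have hle : 2 * e ≤ 1 / 2 := by
      have : 0 ≤ e * c⁻¹ := by positivity
      linarith
    have hκN := norm_kappa_le (leadCoeff_ne_zero hd0 hdu) (hN _) hle hest
    exact ⟨u, ⟨⟨by simpa using hκN, hκ⟩, by simpa using hu⟩, hu0⟩
  obtain ⟨κ₁, hκ₁, hd₁⟩ := hne
  obtain ⟨u₁, hu₁⟩ := hmem κ₁ hκ₁ hd₁
  obtain ⟨⟨κ, u⟩, hx, hmax⟩ := hZ.exists_isMaxOn ⟨_, hu₁⟩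
    (f := fun x => ‖x.1‖) (continuous_norm.comp continuous_fst).continuousOn
  have hκc : c ≤ ‖κ‖ := hx.1.1.2
  refine ⟨κ, hκc, (exists_pencil_kernel_iff (norm_pos_iff.1 (hc.trans_le hκc))
    (isUnit_schurOp hc hec hA hG hκc)).2 ⟨u, by simpa using hx.1.2, hx.2⟩, fun κ' hκ' hd' => ?_⟩
  obtain ⟨u', hu'⟩ := hmem κ' hκ' hd'
  exact hmax hu'

end

/-! ### Symmetry of the reduced operator for equal real contrasts -/

theorem tsum_mul_tsum_comm {ι : Type*} {K : ι → ι → ℂ}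
    (hK : Summable fun x : ι × ι => ‖K x.1 x.2‖) {x y : ι → ℂ} {M N : ℝ} (hx : ∀ q, ‖x q‖ ≤ M)
    (hy : ∀ q, ‖y q‖ ≤ N) :
    ∑' p, y p * ∑' q, K p q * x q = ∑' q, x q * ∑' p, K p q * y p := by
  simp only [← tsum_mul_left]
  have h1 : Summable fun z : ι × ι => y z.1 * (K z.1 z.2 * x z.2) := by
    refine (summable_mul_bounded (f := fun z : ι × ι => K z.1 z.2) hK
      (c := fun z => y z.1 * x z.2) (M := N * M) fun z => ?_).congr fun z => mul_left_comm _ _ _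
    rw [norm_mul]
    exact mul_le_mul (hy _) (hx _) (norm_nonneg _) ((norm_nonneg _).trans (hy z.1))
  refine (Summable.tsum_comm (f := fun p q => y p * (K p q * x q)) h1).symm.trans ?_
  refine tsum_congr fun q => tsum_congr fun p => ?_
  ring

/-- With real weights and parameters, the diagonal and `L` terms are Hermitian forms, so exchanging
`x` and `y` conjugates them; the antilinear `K` term is a symmetric bilinear form in `conj x`, `conj
y` and does not change. Only the real part is symmetric for all three. -/
theorem re_form_symm {ι : Type*} {W D : ι → ℝ} (hW : ∀ p, ‖W p‖ ≤ 1) {K L : ι → ι → ℂ}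
    (hK : Summable fun x : ι × ι => ‖K x.1 x.2‖) (hL : Summable fun x : ι × ι => ‖L x.1 x.2‖)
    (hKs : ∀ p q, W p * K p q = W q * K q p) (hLs : ∀ p q, conj (W p * L p q) = W q * L q p)
    {x y : ι → ℂ} {M N : ℝ} (hx : ∀ q, ‖x q‖ ≤ M) (hy : ∀ q, ‖y q‖ ≤ N)
    (hDx : Summable fun p => (D p : ℂ) * x p) (hDy : Summable fun p => (D p : ℂ) * y p) (t s : ℝ) :
    (∑' p, W p * conj (y p) * (t * (D p * x p + ∑' q, K p q * conj (x q)) -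
      s * ∑' q, L p q * x q)).re =
    (∑' p, W p * conj (x p) * (t * (D p * y p + ∑' q, K p q * conj (y q)) -
      s * ∑' q, L p q * y q)).re := by
  have hWK : ∀ {K : ι → ι → ℂ}, (Summable fun x : ι × ι => ‖K x.1 x.2‖) →
      Summable fun x : ι × ι => ‖W x.1 * K x.1 x.2‖ := fun hK =>
    hK.of_nonneg_of_le (fun _ => norm_nonneg _) fun z => by
      rw [norm_mul, Complex.norm_real]
      exact mul_le_of_le_one_left (norm_nonneg _) (hW _)
  have hc : ∀ {x : ι → ℂ} {M : ℝ}, (∀ q, ‖x q‖ ≤ M) → ∀ q, ‖conj (x q)‖ ≤ M := fun h q => by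
    rw [RCLike.norm_conj]; exact h q
  have hsplit : ∀ {x y : ι → ℂ} {M N : ℝ}, (∀ q, ‖x q‖ ≤ M) → (∀ q, ‖y q‖ ≤ N) →
      (Summable fun p => (D p : ℂ) * x p) →
      ∑' p, W p * conj (y p) * (t * (D p * x p + ∑' q, K p q * conj (x q)) -
        s * ∑' q, L p q * x q) =
      t * ∑' p, conj (y p) * (W p * (D p * x p)) +
        t * ∑' p, conj (y p) * ∑' q, (W p * K p q) * conj (x q) -
        s * ∑' p, conj (y p) * ∑' q, (W p * L p q) * x q := by
    intro x y M N hx hy hDx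
    have s1 : Summable fun p => conj (y p) * (W p * (D p * x p)) :=
      (summable_mul_bounded hDx.norm (c := fun p => W p * conj (y p)) (M := 1 * N) fun p => by
        rw [norm_mul, Complex.norm_real]
        exact mul_le_mul (hW p) (hc hy p) (norm_nonneg _) zero_le_one).congr fun p => by ring
    have s2 : Summable fun p => conj (y p) * ∑' q, (W p * K p q) * conj (x q) :=
      (summable_mul_bounded (summable_tsum_mul (K := fun p q => W p * K p q) (hWK hK)
        (hc hx)).norm (hc hy)).congr fun p => mul_comm _ _
    have s3 : Summable fun p => conj (y p) * ∑' q, (W p * L p q) * x q :=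
      (summable_mul_bounded (summable_tsum_mul (K := fun p q => W p * L p q) (hWK hL)
        hx).norm (hc hy)).congr fun p => mul_comm _ _
    rw [← tsum_mul_left, ← tsum_mul_left, ← tsum_mul_left,
      ← (s1.mul_left _).tsum_add (s2.mul_left _),
      ← ((s1.mul_left _).add (s2.mul_left _)).tsum_sub (s3.mul_left _)]
    refine tsum_congr fun p => ?_
    simp only [mul_assoc, tsum_mul_left]
    ring
  have e1 : ∑' p, conj (x p) * (W p * (D p * y p)) =
      conj (∑' p, conj (y p) * (W p * (D p * x p))) := by
    rw [Complex.conj_tsum]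
    refine tsum_congr fun p => ?_
    simp only [map_mul, Complex.conj_conj, Complex.conj_ofReal]
    ring
  have e2 : ∑' p, conj (x p) * ∑' q, (W p * K p q) * conj (y q) =
      ∑' p, conj (y p) * ∑' q, (W p * K p q) * conj (x q) := by
    rw [tsum_mul_tsum_comm (K := fun p q => W p * K p q) (hWK hK) (hc hy) (hc hx)]
    refine tsum_congr fun q => congrArg _ (tsum_congr fun p => ?_)
    rw [hKs]
  have e3 : ∑' p, conj (x p) * ∑' q, (W p * L p q) * y q =
      conj (∑' p, conj (y p) * ∑' q, (W p * L p q) * x q) := by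
    rw [tsum_mul_tsum_comm (K := fun p q => W p * L p q) (hWK hL) hy (hc hx), Complex.conj_tsum]
    refine tsum_congr fun q => ?_
    rw [map_mul, Complex.conj_conj, Complex.conj_tsum]
    refine congrArg _ (tsum_congr fun p => ?_)
    rw [map_mul, hLs]
  rw [hsplit hx hy hDx, hsplit hy hx hDy, e1, e2, e3]
  simp only [Complex.sub_re, Complex.add_re, Complex.re_ofReal_mul, Complex.conj_re]

/-- Exchanging the indices changes `a_k - a_m` by a sign, and `(-1) ^ (i + j + 2)` turns `(-1) ^ (i
+ 1)` into `(-1) ^ (j + 1)`. -/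
theorem reflMat_weight_symm (a : Fin n → ℂ) (R : Fin n → ℝ) (c : ℂ) (p q : Fin n × ℕ) :
    ((R p.1 ^ 2 : ℝ) : ℂ) * reflMat a R (fun _ => c) p q =
      ((R q.1 ^ 2 : ℝ) : ℂ) * reflMat a R (fun _ => c) q p := by
  obtain ⟨k, i⟩ := p
  obtain ⟨m, j⟩ := q
  simp only [reflMat]
  by_cases h : m = k
  · subst h; simp
  rw [if_neg h, if_neg (Ne.symm h), ← neg_sub (a m) (a k), inv_neg, neg_pow ((a m - a k)⁻¹),
    add_comm j i, Nat.choose_symm_add (a := i) (b := j)]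
  have h1 : (-1 : ℂ) ^ (i + 1) * (-1) ^ (i + j + 2) = (-1) ^ (j + 1) := by
    rw [← pow_add, show i + 1 + (i + j + 2) = 2 * (i + 1) + (j + 1) by ring, pow_add, pow_mul]
    norm_num
  push_cast
  linear_combination (R k : ℂ) ^ (i + 2) * c * (((i : ℂ) + j + 1) * ((i + j).choose j : ℂ)) *
    (R m : ℂ) ^ (j + 2) * (a m - a k)⁻¹ ^ (i + j + 2) * h1

theorem conj_bergmanCoeff (a : Fin n → ℂ) (p q : Fin n × ℕ) :
    conj (bergmanCoeff a p q) = bergmanCoeff a q p := by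
  rw [bergmanCoeff, bergmanCoeff, Complex.conj_tsum]
  refine tsum_congr fun l => ?_
  simp only [map_mul, map_pow, Complex.conj_conj, Complex.conj_natCast]
  ring

theorem bergMat_weight_symm (a : Fin n → ℂ) (R : Fin n → ℝ) (c : ℝ) (p q : Fin n × ℕ) :
    conj (((R p.1 ^ 2 : ℝ) : ℂ) * bergMat a R (fun _ => (c : ℂ)) p q) =
      ((R q.1 ^ 2 : ℝ) : ℂ) * bergMat a R (fun _ => (c : ℂ)) q p := by
  simp only [bergMat, map_mul, map_pow, Complex.conj_ofReal, conj_bergmanCoeff]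
  push_cast
  ring

/-- The pencil applied to a lifted vector has no higher coefficients, so the finite form equals the
full weighted form at the lifts, to which `re_form_symm` applies. -/
theorem Realizes.reducedOp_symm {a : Fin n → ℂ} {c : ℝ} {ν : Fin n → ℝ} {r C : ℝ}
    {A G : CoeffSpace n →L[ℝ] CoeffSpace n} (h : Realizes a (fun _ => (c : ℂ)) ν r C A G)
    (hadm : Admissible a (radii ν r)) {t : ℝ} (ht : t ≠ 0)
    (hT : IsUnit (schurOp A G (t : ℂ))) (u w : Fin n → ℂ) :
    (∑ k, ((radii ν r k ^ 2 : ℝ) : ℂ) * conj (w k) * reducedOp a (fun _ => (c : ℂ)) ν A G t u k).re =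
    (∑ k, ((radii ν r k ^ 2 : ℝ) : ℂ) * conj (u k) *
      reducedOp a (fun _ => (c : ℂ)) ν A G t w k).re := by
  have htc : (t : ℂ) ≠ 0 := by exact_mod_cast ht
  set R := radii ν r with hR
  have hRK := summable_reflMat (fun _ => (c : ℂ)) hadm
  have hRL := summable_bergMat (fun _ => (c : ℂ)) hadm
  have hform : ∀ u w : Fin n → ℂ,
      ∑ k, ((R k ^ 2 : ℝ) : ℂ) * conj (w k) * reducedOp a (fun _ => (c : ℂ)) ν A G t u k =
      ∑' p : Fin n × ℕ, ((R p.1 ^ 2 : ℝ) : ℂ) * conj (schurLift A G t w p) *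
        (t * (((p.2 + 1 : ℕ) : ℝ) * schurLift A G t u p +
          ∑' q, reflMat a R (fun _ => (c : ℂ)) p q * conj (schurLift A G t u q)) -
        ((r ^ 2)⁻¹ : ℝ) * ∑' q, bergMat a R (fun _ => (c : ℂ)) p q * schurLift A G t u q) := by
    intro u w
    rw [tsum_eq_sum (s := Finset.univ ×ˢ {0}), Finset.sum_product]
    · refine Finset.sum_congr rfl fun k _ => ?_
      have h1 := h.pencil_eq t (schurLift A G t u) (k, 0)
      have h2 : schurLift A G t w (k, 0) = w k := congrFun (leadCoeff_schurLift hT w) k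
      rw [Finset.sum_singleton, h2, reducedOp_apply, leadCoeff_apply]
      push_cast at h1 ⊢
      rw [← h1]; simp
    · rintro ⟨k, i⟩ hi
      have hi0 : i ≠ 0 := fun h0 => hi (by simp [h0])
      have h1 := h.pencil_eq t (schurLift A G t u) (k, i)
      rw [pencil_schurLift htc hT, leadEmb_apply, if_neg hi0, mul_zero] at h1
      push_cast at h1 ⊢
      rw [← h1, mul_zero]
  have hsum : ∀ u : Fin n → ℂ, Summable fun p : Fin n × ℕ =>
      (((p.2 + 1 : ℕ) : ℝ) : ℂ) * schurLift A G t u p := by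
    intro u
    have s0 : Summable fun p : Fin n × ℕ => ((p.2 + 1 : ℕ) : ℂ) *
        pencil a (fun _ => (c : ℂ)) ν A G t (schurLift A G t u) p := by
      refine summable_of_ne_finset_zero (s := Finset.univ ×ˢ {0}) ?_
      rintro ⟨k, i⟩ hi
      have hi0 : i ≠ 0 := fun h0 => hi (by simp [h0])
      rw [pencil_schurLift htc hT, leadEmb_apply, if_neg hi0, mul_zero]
    have s1 := summable_tsum_mul (K := reflMat a R (fun _ => (c : ℂ))) hRK
      (e := fun q => conj (schurLift A G t u q)) (M := ‖schurLift A G t u‖) fun q => by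
        rw [RCLike.norm_conj]; exact BoundedContinuousFunction.norm_coe_le_norm _ _
    have s2 := summable_tsum_mul (K := bergMat a R (fun _ => (c : ℂ))) hRL
      (BoundedContinuousFunction.norm_coe_le_norm (schurLift A G t u))
    refine (((s0.add (s2.mul_left ((r : ℂ) ^ 2)⁻¹)).mul_left (t : ℂ)⁻¹).sub s1).congr fun p => ?_
    rw [h.pencil_eq, sub_add_cancel, inv_mul_cancel_left₀ htc, add_sub_cancel_right]
    push_cast; rfl
  rw [hform, hform]
  refine re_form_symm (W := fun p : Fin n × ℕ => R p.1 ^ 2) (D := fun p => ((p.2 + 1 : ℕ) : ℝ))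
    (fun p => ?_) hRK hRL (reflMat_weight_symm a R c) (bergMat_weight_symm a R c)
    (BoundedContinuousFunction.norm_coe_le_norm _) (BoundedContinuousFunction.norm_coe_le_norm _)
    (hsum u) (hsum w) t _
  have h1 := hadm.pos p.1
  have h2 := hadm.lt_one p.1
  have h3 := norm_nonneg (a p.1)
  rw [Real.norm_eq_abs, abs_of_nonneg (by positivity)]
  exact pow_le_one₀ h1.le (by linarith)

/-! ### Real kernel parameters from a change of definiteness -/

/-- The real part of the weighted Hermitian inner product. -/
noncomputable def weightedInner (ν : Fin n → ℝ) : (Fin n → ℂ) →ₗ[ℝ] (Fin n → ℂ) →ₗ[ℝ] ℝ :=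
  LinearMap.mk₂ ℝ (fun u w => ∑ k, ν k * (conj (w k) * u k).re)
    (fun u u' w => by
      rw [← Finset.sum_add_distrib]
      refine Finset.sum_congr rfl fun k _ => ?_
      rw [Pi.add_apply, mul_add, Complex.add_re, mul_add])
    (fun t u w => by
      rw [smul_eq_mul, Finset.mul_sum]
      refine Finset.sum_congr rfl fun k _ => ?_
      rw [Pi.smul_apply, Complex.real_smul, mul_left_comm, Complex.re_ofReal_mul]
      ring)
    (fun u w w' => by
      rw [← Finset.sum_add_distrib]
      refine Finset.sum_congr rfl fun k _ => ?_
      rw [Pi.add_apply, map_add, add_mul, Complex.add_re, mul_add])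
    (fun t u w => by
      rw [smul_eq_mul, Finset.mul_sum]
      refine Finset.sum_congr rfl fun k _ => ?_
      rw [Pi.smul_apply, Complex.real_smul, map_mul, Complex.conj_ofReal, mul_assoc,
        Complex.re_ofReal_mul]
      ring)

theorem weightedInner_apply (ν : Fin n → ℝ) (u w : Fin n → ℂ) :
    weightedInner ν u w = ∑ k, ν k * (conj (w k) * u k).re := rfl

attribute [irreducible] weightedInner

theorem weightedInner_self (ν : Fin n → ℝ) (u : Fin n → ℂ) :
    weightedInner ν u u = ∑ k, ν k * ‖u k‖ ^ 2 := by
  rw [weightedInner_apply]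
  refine Finset.sum_congr rfl fun k _ => ?_
  rw [Complex.conj_mul', ← Complex.ofReal_pow, Complex.ofReal_re]

theorem le_weightedInner_self {ν : Fin n → ℝ} {m : ℝ} (hm : 0 < m) (hν : ∀ k, m ≤ ν k)
    (u : Fin n → ℂ) : m * ‖u‖ ^ 2 ≤ weightedInner ν u u := by
  have h0 : 0 ≤ weightedInner ν u u := by
    rw [weightedInner_self]
    exact Finset.sum_nonneg fun k _ => mul_nonneg (hm.le.trans (hν k)) (sq_nonneg _)
  have h1 : ‖u‖ ≤ Real.sqrt (weightedInner ν u u / m) := by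
    refine (pi_norm_le_iff_of_nonneg (Real.sqrt_nonneg _)).2 fun k => Real.le_sqrt_of_sq_le ?_
    rw [le_div_iff₀ hm, mul_comm, weightedInner_self]
    calc m * ‖u k‖ ^ 2 ≤ ν k * ‖u k‖ ^ 2 := by gcongr; exact hν k
      _ ≤ _ := Finset.single_le_sum (f := fun k => ν k * ‖u k‖ ^ 2)
        (fun k _ => mul_nonneg (hm.le.trans (hν k)) (sq_nonneg _)) (Finset.mem_univ k)
  have h2 := pow_le_pow_left₀ (norm_nonneg _) h1 2
  rw [Real.sq_sqrt (by positivity), le_div_iff₀ hm] at h2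
  linarith

theorem abs_weightedInner_le {ν : Fin n → ℝ} (hν : IsRatio ν) (u w : Fin n → ℂ) :
    |weightedInner ν u w| ≤ n * (‖u‖ * ‖w‖) := by
  rw [weightedInner_apply]
  have h1 : ∀ k ∈ Finset.univ, ‖ν k * (conj (w k) * u k).re‖ ≤ ‖u‖ * ‖w‖ := fun k _ => by
    rw [norm_mul, Real.norm_eq_abs, Real.norm_eq_abs, abs_of_pos (hν.1 k).1]
    calc _ ≤ 1 * ‖conj (w k) * u k‖ :=
          mul_le_mul (hν.1 k).2 (Complex.abs_re_le_norm _) (abs_nonneg _) zero_le_one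
      _ = ‖u k‖ * ‖w k‖ := by rw [one_mul, norm_mul, RCLike.norm_conj, mul_comm]
      _ ≤ _ := by gcongr <;> exact norm_le_pi_norm _ k
  simpa using norm_sum_le_of_le _ h1

/-- Compactness gives a last parameter at which the form is nonpositive at some unit vector. It is
positive definite beyond, hence semidefinite there by continuity, and a null vector of a
semidefinite symmetric form lies in the kernel. -/
theorem exists_kernel_of_forms {ν : Fin n → ℝ} {m : ℝ} (hm : 0 < m) (hν : ∀ k, m ≤ ν k)
    {c T : ℝ} (hcT : c ≤ T) {X : ℝ → (Fin n → ℂ) →L[ℝ] (Fin n → ℂ)}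
    (hX : ContinuousOn X (Icc c T))
    (hsymm : ∀ t ∈ Icc c T, ∀ u w, weightedInner ν (X t u) w = weightedInner ν (X t w) u)
    (hneg : ∃ u ≠ 0, weightedInner ν (X c u) u ≤ 0)
    (hpos : ∀ u ≠ 0, 0 < weightedInner ν (X T u) u) :
    ∃ t ∈ Icc c T, ∃ u, ‖u‖ = 1 ∧ X t u = 0 := by
  have hunit : ∀ (t : ℝ) (u : Fin n → ℂ), u ≠ 0 → ‖(‖u‖⁻¹ : ℝ) • u‖ = 1 ∧
      weightedInner ν (X t ((‖u‖⁻¹ : ℝ) • u)) ((‖u‖⁻¹ : ℝ) • u) =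
        ‖u‖⁻¹ ^ 2 * weightedInner ν (X t u) u := fun t u hu => by
    refine ⟨by rw [norm_smul, norm_inv, norm_norm, inv_mul_cancel₀ (norm_ne_zero_iff.2 hu)], ?_⟩
    rw [map_smul, map_smul, map_smul, LinearMap.smul_apply, smul_eq_mul, smul_eq_mul]
    ring
  have hform : Continuous fun x : (Fin n → ℂ) × (Fin n → ℂ) => weightedInner ν x.1 x.2 := by
    simp only [weightedInner_apply]
    fun_prop
  have hcont : ContinuousOn (fun x : ℝ × (Fin n → ℂ) => weightedInner ν (X x.1 x.2) x.2)
      (Icc c T ×ˢ sphere 0 1) :=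
    hform.comp_continuousOn (((hX.comp continuousOn_fst fun x hx => hx.1).clm_apply
      continuousOn_snd).prodMk continuousOn_snd)
  have hS : IsCompact (Icc c T ×ˢ sphere (0 : Fin n → ℂ) 1) := isCompact_Icc.prod (isCompact_sphere _ _)
  have hZ : IsCompact ((Icc c T ×ˢ sphere (0 : Fin n → ℂ) 1) ∩
      (fun x : ℝ × (Fin n → ℂ) => weightedInner ν (X x.1 x.2) x.2) ⁻¹' Iic 0) :=
    hS.of_isClosed_subset (hcont.preimage_isClosed_of_isClosed hS.isClosed isClosed_Iic)
      inter_subset_left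
  obtain ⟨u₁, hu₁, hneg₁⟩ := hneg
  obtain ⟨⟨t, u⟩, ⟨⟨ht, hu⟩, hle⟩, hmax⟩ := hZ.exists_isMaxOn
    ⟨(c, (‖u₁‖⁻¹ : ℝ) • u₁), ⟨left_mem_Icc.2 hcT, by simpa using (hunit c u₁ hu₁).1⟩, by
      rw [mem_preimage, (hunit c u₁ hu₁).2]
      exact mul_nonpos_of_nonneg_of_nonpos (by positivity) hneg₁⟩
    (f := Prod.fst) continuous_fst.continuousOn
  simp only [mem_preimage, mem_Iic, mem_sphere_zero_iff_norm] at hle hu ht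
  have hu0 : u ≠ 0 := norm_ne_zero_iff.1 (by rw [hu]; exact one_ne_zero)
  have htT : t < T := by
    refine lt_of_le_of_ne ht.2 fun h => ?_
    rw [h] at hle
    exact absurd (hpos u hu0) (not_lt.2 hle)
  have hpsd : ∀ w, 0 ≤ weightedInner ν (X t w) w := by
    intro w
    by_cases hw : w = 0
    · rw [hw, map_zero]
    have h1 : ContinuousOn (fun t => weightedInner ν (X t w) w) (Icc c T) :=
      hform.comp_continuousOn ((hX.clm_apply continuousOn_const).prodMk continuousOn_const)
    have h2 : Tendsto (fun t => weightedInner ν (X t w) w) (𝓝[Ioc t T] t)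
        (𝓝 (weightedInner ν (X t w) w)) :=
      (h1 t ht).mono fun x hx => ⟨ht.1.trans hx.1.le, hx.2⟩
    have : (𝓝[Ioc t T] t).NeBot := left_nhdsWithin_Ioc_neBot htT
    refine ge_of_tendsto h2 ?_
    filter_upwards [self_mem_nhdsWithin] with x hx
    by_contra! hneg
    have h3 : x ≤ t := hmax (a := (x, (‖w‖⁻¹ : ℝ) • w))
      ⟨⟨⟨ht.1.trans hx.1.le, hx.2⟩, by simpa using (hunit x w hw).1⟩, by
        rw [mem_preimage, (hunit x w hw).2]
        exact mul_nonpos_of_nonneg_of_nonpos (by positivity) hneg.le⟩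
    exact absurd hx.1 (not_lt.2 h3)
  have hu00 : weightedInner ν (X t u) u = 0 := le_antisymm hle (hpsd u)
  have horth : ∀ w, weightedInner ν (X t u) w = 0 := by
    intro w
    -- The form at `u + x • w` is a nonnegative quadratic in `x` without constant term, so its
    -- linear coefficient vanishes.
    have hq : ∀ x : ℝ, 0 ≤ weightedInner ν (X t w) w * (x * x) +
        2 * weightedInner ν (X t u) w * x + 0 := by
      intro x
      have h1 := hpsd (u + x • w)
      simp only [map_add, map_smul, LinearMap.add_apply, LinearMap.smul_apply, smul_eq_mul] at h1
      rw [hu00, hsymm t ht w u] at h1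
      linarith
    have h2 := discrim_le_zero hq
    rw [discrim] at h2
    nlinarith [sq_nonneg (weightedInner ν (X t u) w)]
  refine ⟨t, ht, u, hu, ?_⟩
  have h1 := le_weightedInner_self hm hν (X t u)
  rw [horth] at h1
  have h2 : ‖X t u‖ ^ 2 ≤ 0 := by nlinarith [sq_nonneg ‖X t u‖]
  exact norm_eq_zero.1 (pow_eq_zero_iff two_ne_zero |>.1 (le_antisymm h2 (sq_nonneg _)))

/-- With `σ` the sign of `c` and `κ = σ t`, the operator `X t` is close to `t - σ Fᵀ`. At `t = |c| /
2` its form is nonpositive at a coordinate vector with `ν k = 1`, because the diagonal entry of `σ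
F` is `|c| / (1 - ‖a k‖ ^ 2) ^ 2 ≥ |c|`. For large `t` the form is positive definite. -/
theorem exists_kernel_of_equal_real {a : Fin n → ℂ} {s : ℝ} (h : Separated a s) {ν : Fin n → ℝ}
    (hν : IsRatio ν) {c : ℝ} (hc0 : c ≠ 0) (hc1 : ‖(c : ℂ)‖ < 1) :
    ∃ e₀ > (0 : ℝ), ∀ r C : ℝ, 0 < r → r ≤ s → 0 ≤ C * r → C * r ≤ e₀ →
      ∀ A G, Realizes a (fun _ => (c : ℂ)) ν r C A G →
        ∃ κ : ℂ, |c| / 2 ≤ ‖κ‖ ∧ ∃ d, d ≠ 0 ∧ pencil a (fun _ => (c : ℂ)) ν A G κ d = 0 := by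
  have hs := h.pos
  have ha : ∀ k, ‖a k‖ < 1 := fun k => by linarith [h.norm_le k]
  have hcp : 0 < |c| := abs_pos.2 hc0
  have hc1' : |c| < 1 := by simpa using hc1
  obtain ⟨m, hm, hmν⟩ : ∃ m > (0 : ℝ), ∀ k, m ≤ ν k := by
    obtain ⟨k₀, -⟩ := hν.2
    have : Nonempty (Fin n) := ⟨k₀⟩
    obtain ⟨k, hk⟩ := Finite.exists_min ν
    exact ⟨ν k, (hν.1 k).1, hk⟩
  obtain ⟨σ, hσ, hσc⟩ : ∃ σ : ℝ, σ * σ = 1 ∧ σ * c = |c| := by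
    rcases abs_cases c with h | h
    · exact ⟨1, by norm_num, by rw [h.1, one_mul]⟩
    · exact ⟨-1, by norm_num, by rw [h.1]; ring⟩
  have hσa : |σ| = 1 := by
    rcases mul_self_eq_one_iff.1 hσ with h | h <;> simp [h]
  have hσ0 : σ ≠ 0 := fun h0 => by simp [h0] at hσ
  set c₀ : ℝ := |c| / 2 with hc₀
  have hc₀p : 0 < c₀ := by positivity
  set N : ℝ := n / s ^ 2 with hN
  have hN0 : 0 ≤ N := by positivity
  -- `T m` exceeds the bound `n N` for the form of `F` by enough to absorb the error `n * (2 * e *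
  -- (1 + T)) ≤ m / 4 * (1 + T)`.
  set T : ℝ := 2 * (n * N + m) / m with hT
  have hTm : T * m = 2 * (n * N + m) := by rw [hT]; field_simp
  have hT2 : 2 ≤ T := by
    rw [hT, le_div_iff₀ hm]
    have : 0 ≤ n * N := by positivity
    linarith
  refine ⟨min (1 / (4 * (1 + c₀⁻¹))) (min (m / (8 * (n + 1))) (|c| / 6)), by positivity,
    fun r C hr hrs he hee A G hAG => ?_⟩
  have hadm := h.admissible_radii hν hr hrs
  set e : ℝ := C * r with he'
  have b1 : e * (1 + c₀⁻¹) ≤ 1 / 4 := by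
    have := hee.trans (min_le_left _ _)
    rw [le_div_iff₀ (by positivity)] at this; linarith
  have b2 : 8 * (e * n) ≤ m := by
    have := hee.trans ((min_le_right _ _).trans (min_le_left _ _))
    rw [le_div_iff₀ (by positivity)] at this
    linarith
  have b3 : 6 * e ≤ |c| := by
    have := hee.trans ((min_le_right _ _).trans (min_le_right _ _))
    linarith
  set ρ : Fin n → ℂ := fun _ => (c : ℂ) with hρ
  have hnorm : ∀ t : ℝ, c₀ ≤ t → ‖((σ * t : ℝ) : ℂ)‖ = t := fun t ht => by
    rw [Complex.norm_real, Real.norm_eq_abs, abs_mul, hσa, one_mul, abs_of_pos (hc₀p.trans_le ht)]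
  have hle : ∀ t : ℝ, c₀ ≤ t → c₀ ≤ ‖((σ * t : ℝ) : ℂ)‖ := fun t ht => by rwa [hnorm t ht]
  have hU : ∀ t : ℝ, c₀ ≤ t → IsUnit (schurOp A G ((σ * t : ℝ) : ℂ)) := fun t ht =>
    isUnit_schurOp hc₀p b1 hAG.norm_A hAG.norm_G (hle t ht)
  set X : ℝ → (Fin n → ℂ) →L[ℝ] (Fin n → ℂ) := fun t =>
    σ • reducedOp a ρ ν A G ((σ * t : ℝ) : ℂ) with hX
  have herr : ∀ t : ℝ, c₀ ≤ t → ∀ u, ∃ y : Fin n → ℂ, ‖y‖ ≤ 2 * e * (1 + t) * ‖u‖ ∧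
      X t u = t • u - σ • opF a ρ ν u + σ • y := fun t ht u => by
    refine ⟨reducedOp a ρ ν A G ((σ * t : ℝ) : ℂ) u -
      (((σ * t : ℝ) : ℂ) • u - opF a ρ ν u), ?_, ?_⟩
    · have := norm_reducedOp_sub_le (a := a) (ρ := ρ) (ν := ν) hc₀p he b1 hAG.norm_A hAG.norm_G
        (hle t ht) u
      rwa [hnorm t ht] at this
    · have h1 : ((σ * t : ℝ) : ℂ) • u = (σ * t) • u := by
        ext k; simp
      have h2 : σ • (σ * t) • u = t • u := by rw [smul_smul, ← mul_assoc, hσ, one_mul]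
      change σ • reducedOp a ρ ν A G ((σ * t : ℝ) : ℂ) u = _
      rw [h1, smul_sub, smul_sub, h2]
      abel
  have hkey : ∃ t ∈ Icc c₀ T, ∃ u, ‖u‖ = 1 ∧ X t u = 0 := by
    refine exists_kernel_of_forms (ν := ν) hm hmν (by linarith) ?_ ?_ ?_ ?_
    · have h1 : ContinuousOn (fun t : ℝ => reducedOp a ρ ν A G ((σ * t : ℝ) : ℂ)) (Icc c₀ T) :=
        (continuousOn_reducedOp hc₀p b1 hAG.norm_A hAG.norm_G).comp
          (Complex.continuous_ofReal.comp (continuous_const.mul continuous_id)).continuousOn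
          fun t ht => hle t ht.1
      exact h1.const_smul σ
    · intro t ht u w
      have hsm := hAG.reducedOp_symm hadm (t := σ * t)
        (mul_ne_zero hσ0 (hc₀p.trans_le ht.1).ne') (hU t ht.1) u w
      have hw : ∀ u w : Fin n → ℂ, (∑ k, ((radii ν r k ^ 2 : ℝ) : ℂ) * conj (w k) * u k).re =
          r ^ 2 * weightedInner ν u w := fun u w => by
        rw [weightedInner_apply, Complex.re_sum, Finset.mul_sum]
        refine Finset.sum_congr rfl fun k _ => ?_
        rw [mul_assoc, Complex.re_ofReal_mul, radii_sq hν]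
        ring
      rw [hw, hw] at hsm
      have hsm' := mul_left_cancel₀ (pow_ne_zero 2 hr.ne') hsm
      change weightedInner ν (σ • _) w = weightedInner ν (σ • _) u
      rw [map_smul, map_smul, LinearMap.smul_apply, LinearMap.smul_apply]
      exact congrArg (σ • ·) hsm'
    · obtain ⟨k, hk⟩ := hν.2
      refine ⟨Pi.single k 1, fun h0 => ?_, ?_⟩
      · have := congrFun h0 k
        simp at this
      have h1 : ∀ x : Fin n → ℂ, weightedInner ν x (Pi.single k 1) = (x k).re := fun x => by
        rw [weightedInner_apply, Finset.sum_eq_single k]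
        · simp [hk]
        · intro j _ hj; simp [hj]
        · simp
      obtain ⟨y, hy, hXy⟩ := herr c₀ le_rfl (Pi.single k 1)
      have hy1 : ‖y k‖ ≤ 2 * e * (1 + c₀) := by
        refine ((norm_le_pi_norm y k).trans hy).trans (mul_le_of_le_one_right (by positivity) ?_)
        refine (pi_norm_le_iff_of_nonneg zero_le_one).2 fun j => ?_
        by_cases hj : j = k
        · subst hj; simp
        · simp [hj]
      have hyre : σ * (y k).re ≤ 2 * e * (1 + c₀) := by
        calc σ * (y k).re ≤ |σ * (y k).re| := le_abs_self _
          _ = |(y k).re| := by rw [abs_mul, hσa, one_mul]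
          _ ≤ _ := (Complex.abs_re_le_norm _).trans hy1
      have hF : opF a ρ ν (Pi.single k 1) k = ((c * ((1 - ‖a k‖ ^ 2) ^ 2)⁻¹ : ℝ) : ℂ) := by
        rw [opF_apply, Finset.sum_eq_single k]
        · rw [Pi.single_eq_same, mul_one, matF, Matrix.of_apply, hk, hρ, Complex.conj_ofReal,
            Complex.conj_mul']
          push_cast
          ring
        · intro j _ hj; simp [hj]
        · simp
      have hFge : |c| ≤ σ * (c * ((1 - ‖a k‖ ^ 2) ^ 2)⁻¹) := by
        rw [← mul_assoc, hσc]
        have h2 : 0 < 1 - ‖a k‖ ^ 2 := by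
          have := pow_lt_one₀ (norm_nonneg _) (ha k) two_ne_zero
          linarith
        refine le_mul_of_one_le_right hcp.le ((one_le_inv₀ (by positivity)).2 ?_)
        exact pow_le_one₀ h2.le (by linarith [sq_nonneg ‖a k‖])
      rw [h1, hXy]
      have h3 : (c₀ • (Pi.single k 1 : Fin n → ℂ) - σ • opF a ρ ν (Pi.single k 1) + σ • y) k =
          (c₀ : ℂ) - σ * opF a ρ ν (Pi.single k 1) k + σ * y k := by
        simp
      rw [h3, hF, Complex.add_re, Complex.sub_re, Complex.re_ofReal_mul, Complex.re_ofReal_mul,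
        Complex.ofReal_re, Complex.ofReal_re]
      have h4 : 2 * e * (1 + c₀) ≤ 3 * e := by
        have : c₀ ≤ 1 / 2 := by rw [hc₀]; linarith
        nlinarith
      linarith
    · intro u hu
      have hup : 0 < ‖u‖ := norm_pos_iff.2 hu
      obtain ⟨y, hy, hXy⟩ := herr T (by linarith) u
      rw [hXy]
      simp only [map_add, map_sub, map_smul, LinearMap.add_apply, LinearMap.sub_apply,
        LinearMap.smul_apply, smul_eq_mul]
      have h1 := le_weightedInner_self hm hmν u
      have h2 : σ * weightedInner ν (opF a ρ ν u) u ≤ n * (N * ‖u‖ * ‖u‖) := by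
        calc _ ≤ |σ * weightedInner ν (opF a ρ ν u) u| := le_abs_self _
          _ = |weightedInner ν (opF a ρ ν u) u| := by rw [abs_mul, hσa, one_mul]
          _ ≤ n * (‖opF a ρ ν u‖ * ‖u‖) := abs_weightedInner_le hν _ _
          _ ≤ _ := by
            have := h.norm_opF_le (ρ := ρ) (fun _ => hc1) hν u
            gcongr
      have h3 : -(n * (2 * e * (1 + T) * ‖u‖ * ‖u‖)) ≤ σ * weightedInner ν y u := by
        have h4 : |σ * weightedInner ν y u| ≤ n * (2 * e * (1 + T) * ‖u‖ * ‖u‖) := by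
          rw [abs_mul, hσa, one_mul]
          exact (abs_weightedInner_le hν _ _).trans (by gcongr)
        exact (abs_le.1 h4).1
      have h5 : T * (m * ‖u‖ ^ 2) ≤ T * weightedInner ν u u := by gcongr
      have h6 : 0 < (T * m - n * N - n * (2 * e * (1 + T))) * ‖u‖ ^ 2 := by
        refine mul_pos ?_ (by positivity)
        have h7 : n * (2 * e * (1 + T)) ≤ m / 4 * (1 + T) := by
          have : 2 * (e * n) * (1 + T) ≤ m / 4 * (1 + T) := by gcongr; linarith
          linarith
        have : 0 ≤ n * N := by positivity
        linarith
      linarith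
  obtain ⟨t, ht, u, hu, hXu⟩ := hkey
  have htc : c₀ ≤ ‖((σ * t : ℝ) : ℂ)‖ := hle t ht.1
  refine ⟨((σ * t : ℝ) : ℂ), htc, (exists_pencil_kernel_iff (norm_pos_iff.1 (hc₀p.trans_le htc))
    (hU t ht.1)).2 ⟨u, hu, ?_⟩⟩
  exact (smul_eq_zero.1 hXu).resolve_left hσ0

/-- If the pencils have kernels away from zero, then there are eigenvalues of largest modulus and
these are of leading order. -/
theorem maxEigenvalue_of_kernel {a : Fin n → ℂ} {s : ℝ} (h : Separated a s) {ρ : Fin n → ℂ}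
    (hρ : ∀ k, ‖ρ k‖ < 1) {ν : Fin n → ℝ} (hν : IsRatio ν) {c : ℝ} (hc : 0 < c) {e₀ : ℝ}
    (he₀ : 0 < e₀)
    (hker : ∀ r C : ℝ, 0 < r → r ≤ s → 0 ≤ C * r → C * r ≤ e₀ → ∀ A G, Realizes a ρ ν r C A G →
      ∃ κ : ℂ, c ≤ ‖κ‖ ∧ ∃ d, d ≠ 0 ∧ pencil a ρ ν A G κ d = 0) {ε : ℝ} (hε : 0 < ε) :
    ∃ δ > (0 : ℝ), ∀ r : ℝ, 0 < r → r < δ →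
      (∃ lam : ℂ, IsMaxEigenvalue a (radii ν r) ρ lam) ∧
      ∀ lam : ℂ, IsMaxEigenvalue a (radii ν r) ρ lam →
        ∃ μ : ℂ, μ ≠ 0 ∧ IsRootF a ρ ν μ ∧ ‖lam - (r : ℂ) ^ 2 * μ‖ ≤ ε * r ^ 2 := by
  have hs := h.pos
  set C : ℝ := (n : ℝ) ^ 2 / s ^ 3 with hC
  have hC0 : 0 ≤ C := by positivity
  obtain ⟨δ₁, hδ₁, hroot⟩ := exists_root_near h hρ hc hε
  obtain ⟨δ₂, hδ₂, hsmall⟩ := exists_pos_forall_mul_le hC0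
    (lt_min he₀ (by positivity : 0 < 1 / (4 * (1 + c⁻¹))))
  refine ⟨min δ₁ (min δ₂ s), by positivity, fun r hr hrδ => ?_⟩
  have hrs : r ≤ s := hrδ.le.trans ((min_le_right _ _).trans (min_le_right _ _))
  have hre := hsmall r hr (hrδ.trans_le ((min_le_right _ _).trans (min_le_left _ _)))
  have he : 0 ≤ C * r := by positivity
  have hec : C * r * (1 + c⁻¹) ≤ 1 / 4 := by
    have := hre.trans (min_le_right _ _)
    rw [le_div_iff₀ (by positivity)] at this; linarith
  have hCr : C * r < 1 := by
    have : 0 ≤ C * r * c⁻¹ := by positivity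
    linarith
  obtain ⟨A, G, hAG⟩ := h.exists_realizes hρ hν hr hrs
  have hadm := h.admissible_radii hν hr hrs
  obtain ⟨κ, hκ, ⟨d, hd0, hd⟩, hmax⟩ := exists_max_kernel hc he hec hAG.norm_A hAG.norm_G
    (h.norm_opF_le hρ hν) (hker r C hr hrs he (hre.trans (min_le_left _ _)) A G hAG)
  have hr0 : (r : ℂ) ^ 2 ≠ 0 := pow_ne_zero _ (by exact_mod_cast hr.ne')
  have hnr : ‖(r : ℂ) ^ 2‖ = r ^ 2 := by
    rw [norm_pow, Complex.norm_real, Real.norm_eq_abs, sq_abs]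
  obtain ⟨φ, φi, φ0, hsol, -⟩ := hAG.exists_eigensolution hρ hr hCr hadm
    (norm_pos_iff.1 (hc.trans_le hκ)) hd0 hd
  have heig : IsEigenvalue a (radii ν r) ρ ((r : ℂ) ^ 2 * κ) := ⟨φ, φi, φ0, hsol⟩
  refine ⟨⟨_, heig, fun lam' hlam' => ?_⟩, fun lam hlam => hroot ν hν r hr
    (hrδ.trans_le (min_le_left _ _)) lam hlam.1 ?_⟩
  · obtain ⟨φ', φi', φ0', hsol'⟩ := hlam'
    obtain ⟨d', hd0', hd', -⟩ := hAG.of_eigensolution hr hadm hsol'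
    have h1 : lam' = (r : ℂ) ^ 2 * (((r : ℂ) ^ 2)⁻¹ * lam') := by rw [mul_inv_cancel_left₀ hr0]
    rw [h1, norm_mul, norm_mul ((r : ℂ) ^ 2) κ]
    refine mul_le_mul_of_nonneg_left ?_ (norm_nonneg _)
    -- Eigenvalues below the threshold `c r ^ 2` need no compactness: the one found is already at
    -- least that large.
    rcases le_total c ‖((r : ℂ) ^ 2)⁻¹ * lam'‖ with h2 | h2
    · exact hmax _ h2 ⟨d', hd0', hd'⟩
    · exact h2.trans hκ
  -- Being maximal, `lam` is at least `c r ^ 2` in modulus, so the localization near roots applies.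
  · refine le_trans ?_ (hlam.2 _ heig)
    rw [norm_mul, hnr, mul_comm]
    gcongr

theorem exists_kernel_of_simple {a : Fin n → ℂ} {ρ : Fin n → ℂ} {ν : Fin n → ℝ} {μ : ℂ}
    (hμ : IsSimpleNonzeroRootF a ρ ν μ) :
    ∃ e₀ > (0 : ℝ), ∀ r C : ℝ, 0 ≤ C * r → C * r ≤ e₀ → ∀ A G, Realizes a ρ ν r C A G →
      ∃ κ : ℂ, ‖μ‖ / 2 ≤ ‖κ‖ ∧ ∃ d, d ≠ 0 ∧ pencil a ρ ν A G κ d = 0 := by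
  obtain ⟨v, hv⟩ := exists_eigenvectorF hμ.isRootF
  obtain ⟨K, hK, e₀, he₀, hker⟩ := exists_pencil_kernel hμ hv
  have hμp : 0 < ‖μ‖ := norm_pos_iff.2 hμ.1
  refine ⟨min e₀ (‖μ‖ / (2 * K)), by positivity, fun r C he hee A G hAG => ?_⟩
  obtain ⟨κ, d, -, hd0, hd, h1, -⟩ := hker _ he (hee.trans (min_le_left _ _)) A G hAG.norm_A
    hAG.norm_G
  refine ⟨κ, ?_, d, hd0, hd⟩
  have h2 := hee.trans (min_le_right _ _)
  rw [le_div_iff₀ (by positivity)] at h2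
  have h3 := norm_sub_norm_le μ κ
  rw [norm_sub_rev] at h3
  linarith

/-! ### Self-adjointness of `F` and reality of its roots -/

theorem matF_weighted_symm (a : Fin n → ℂ) (c : ℝ) {ν : Fin n → ℝ} (hν : IsRatio ν)
    (m k : Fin n) : (ν m : ℂ)⁻¹ * matF a (fun _ => (c : ℂ)) ν m k =
      conj ((ν k : ℂ)⁻¹ * matF a (fun _ => (c : ℂ)) ν k m) := by
  have h : ∀ k, (ν k : ℂ) ≠ 0 := fun k => by exact_mod_cast (hν.1 k).1.ne'
  simp only [matF, Matrix.of_apply, map_mul, map_div₀, map_inv₀, map_pow, map_sub, map_one,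
    Complex.conj_ofReal, Complex.conj_conj]
  rw [mul_div_assoc', mul_div_assoc', mul_left_comm, mul_left_comm _ _ (ν k : ℂ),
    inv_mul_cancel₀ (h m), inv_mul_cancel₀ (h k), mul_comm (a k)]

theorem matF_selfAdjoint (a : Fin n → ℂ) (c : ℝ) {ν : Fin n → ℝ} (hν : IsRatio ν)
    (u w : Fin n → ℂ) :
    ∑ m, (ν m : ℂ)⁻¹ * (matF a (fun _ => (c : ℂ)) ν *ᵥ u) m * conj (w m) =
      ∑ m, (ν m : ℂ)⁻¹ * u m * conj ((matF a (fun _ => (c : ℂ)) ν *ᵥ w) m) := by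
  simp only [Matrix.mulVec, dotProduct, map_sum, Finset.mul_sum, Finset.sum_mul]
  rw [Finset.sum_comm]
  refine Finset.sum_congr rfl fun k _ => Finset.sum_congr rfl fun m _ => ?_
  have h1 := matF_weighted_symm a c hν m k
  rw [map_mul, map_inv₀, Complex.conj_ofReal] at h1
  rw [map_mul]
  linear_combination u k * conj (w m) * h1

theorem matF_isHermitian (a : Fin n → ℂ) (c : ℝ) {ν : Fin n → ℝ} (hν : IsRatio ν)
    (heq : ∀ i j, ν i = ν j) : (matF a (fun _ => (c : ℂ)) ν).IsHermitian := by
  refine Matrix.IsHermitian.ext fun k m => ?_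
  have h1 := matF_weighted_symm a c hν k m
  have h : (ν k : ℂ) ≠ 0 := by exact_mod_cast (hν.1 k).1.ne'
  rw [map_mul, map_inv₀, Complex.conj_ofReal, heq m k] at h1
  exact (mul_left_cancel₀ (inv_ne_zero h) h1).symm

/-- Conjugation by the diagonal matrix of `√ν` turns `F` into a Hermitian matrix with the same
characteristic polynomial. -/
theorem matF_det_eq_prod (a : Fin n → ℂ) (c : ℝ) {ν : Fin n → ℝ} (hν : IsRatio ν) :
    ∃ x : Fin n → ℝ, ∀ μ : ℂ,
      (μ • (1 : Matrix (Fin n) (Fin n) ℂ) - matF a (fun _ => (c : ℂ)) ν).det =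
        ∏ i, (μ - (x i : ℂ)) := by
  set F := matF a (fun _ => (c : ℂ)) ν with hF
  set S : Fin n → ℂ := fun k => (Real.sqrt (ν k) : ℂ) with hS
  have hS0 : ∀ k, S k ≠ 0 := fun k => by
    exact Complex.ofReal_ne_zero.2 (Real.sqrt_pos.2 (hν.1 k).1).ne'
  have hS2 : ∀ k, S k * S k = ν k := fun k => by
    rw [hS, ← Complex.ofReal_mul, Real.mul_self_sqrt (hν.1 k).1.le]
  set H : Matrix (Fin n) (Fin n) ℂ := Matrix.of fun m k => (S m)⁻¹ * F m k * S k with hH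
  have hherm : H.IsHermitian := by
    refine Matrix.IsHermitian.ext fun k m => ?_
    have h1 := matF_weighted_symm a c hν k m
    rw [← hF, map_mul, map_inv₀, Complex.conj_ofReal, ← hS2, ← hS2] at h1
    simp only [hH, Matrix.of_apply, RCLike.star_def, map_mul, map_inv₀, hS, Complex.conj_ofReal]
    change (S m)⁻¹ * conj (F m k) * S k = (S k)⁻¹ * F k m * S m
    have hk := hS0 k
    have hm := hS0 m
    field_simp at h1 ⊢
    linear_combination -h1
  refine ⟨hherm.eigenvalues, fun μ => ?_⟩
  have hFD : (μ • (1 : Matrix (Fin n) (Fin n) ℂ) - F) * Matrix.diagonal S =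
      Matrix.diagonal S * (μ • (1 : Matrix (Fin n) (Fin n) ℂ) - H) := by
    rw [sub_mul, mul_sub, smul_mul_assoc, mul_smul_comm, one_mul, mul_one]
    congr 1
    ext m k
    rw [Matrix.mul_diagonal, Matrix.diagonal_mul, hH, Matrix.of_apply, mul_assoc,
      mul_inv_cancel_left₀ (hS0 m)]
  have hdet := congrArg Matrix.det hFD
  rw [Matrix.det_mul, Matrix.det_mul, mul_comm, Matrix.det_diagonal] at hdet
  rw [mul_left_cancel₀ (Finset.prod_ne_zero_iff.2 fun k _ => hS0 k) hdet,
    Matrix.smul_one_eq_diagonal, ← Matrix.scalar_apply, ← Matrix.eval_charpoly, hherm.charpoly_eq,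
    Polynomial.eval_prod]
  simp

end RLinear

/-! ### The main theorem -/

theorem mainTheorem2 (n : ℕ) (a : Fin n → ℂ) (ha : ∀ k, ‖a k‖ < 1)
    (hinj : Function.Injective a) (ρ : Fin n → ℂ) (hρ : ∀ k, ‖ρ k‖ < 1) :
    -- eigenvalues that are not `o(r ^ 2)`, uniformly in the ratios of the radii
    (∀ c > (0 : ℝ), ∀ ε > (0 : ℝ), ∃ δ > (0 : ℝ), ∀ ν : Fin n → ℝ, RLinear.IsRatio ν →
      ∀ r : ℝ, 0 < r → r < δ → ∀ lam : ℂ, RLinear.IsEigenvalue a (RLinear.radii ν r) ρ lam →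
        c * r ^ 2 ≤ ‖lam‖ →
        ∃ μ : ℂ, μ ≠ 0 ∧ RLinear.IsRootF a ρ ν μ ∧ ‖lam - (r : ℂ) ^ 2 * μ‖ ≤ ε * r ^ 2) ∧
    ∀ ν : Fin n → ℝ, RLinear.IsRatio ν →
      -- eigenvalues of largest modulus
      (((∃ μ : ℂ, RLinear.IsSimpleNonzeroRootF a ρ ν μ) ∨
          (∃ ρ₀ : ℝ, ρ₀ ≠ 0 ∧ ∀ m, ρ m = (ρ₀ : ℂ))) →
        ∀ ε > (0 : ℝ), ∃ δ > (0 : ℝ), ∀ r : ℝ, 0 < r → r < δ →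
          (∃ lam : ℂ, RLinear.IsMaxEigenvalue a (RLinear.radii ν r) ρ lam) ∧
          ∀ lam : ℂ, RLinear.IsMaxEigenvalue a (RLinear.radii ν r) ρ lam →
            ∃ μ : ℂ, μ ≠ 0 ∧ RLinear.IsRootF a ρ ν μ ∧
              ‖lam - (r : ℂ) ^ 2 * μ‖ ≤ ε * r ^ 2) ∧
      -- equal real contrast parameters
      (∀ ρ₀ : ℝ, (∀ m, ρ m = (ρ₀ : ℂ)) →
        (∀ u w : Fin n → ℂ,
          ∑ m, (ν m : ℂ)⁻¹ * (RLinear.matF a ρ ν *ᵥ u) m * conj (w m) =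
            ∑ m, (ν m : ℂ)⁻¹ * u m * conj ((RLinear.matF a ρ ν *ᵥ w) m)) ∧
        ((∀ i j, ν i = ν j) → (RLinear.matF a ρ ν).IsHermitian) ∧
        ∃ x : Fin n → ℝ, ∀ μ : ℂ,
          (μ • (1 : Matrix (Fin n) (Fin n) ℂ) - RLinear.matF a ρ ν).det =
            ∏ i, (μ - (x i : ℂ))) ∧
      -- leading-order eigenfunctions for a simple nonzero root
      (∀ μ : ℂ, RLinear.IsSimpleNonzeroRootF a ρ ν μ →
        (∀ v : Fin n → ℂ, RLinear.IsEigenvectorF a ρ ν μ v →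
          ∃ C > (0 : ℝ), ∃ δ > (0 : ℝ), ∀ r : ℝ, 0 < r → r < δ →
            ∃ (lam : ℂ) (φ : ℂ → ℂ) (φi : Fin n → ℂ → ℂ) (φ0 : ℂ → ℂ),
              RLinear.IsEigensolution a (RLinear.radii ν r) ρ lam φ φi φ0 ∧
              RLinear.LeadingOrder a ρ ν μ v C r lam φi φ0) ∧
        (∃ C > (0 : ℝ), ∃ δ > (0 : ℝ), ∃ η > (0 : ℝ), ∀ r : ℝ, 0 < r → r < δ →
          ∀ (lam : ℂ) (φ : ℂ → ℂ) (φi : Fin n → ℂ → ℂ) (φ0 : ℂ → ℂ),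
            RLinear.IsEigensolution a (RLinear.radii ν r) ρ lam φ φi φ0 →
            ‖lam - (r : ℂ) ^ 2 * μ‖ ≤ η * r ^ 2 →
            ∃ v : Fin n → ℂ, RLinear.IsEigenvectorF a ρ ν μ v ∧
              RLinear.LeadingOrder a ρ ν μ v C r lam φi φ0)) := by
  obtain ⟨s, h⟩ := RLinear.exists_separated ha hinj
  refine ⟨fun c hc ε hε => RLinear.exists_root_near h hρ hc hε, fun ν hν => ⟨?_, ?_, fun μ hμ =>
    ⟨fun v hv => RLinear.exists_eigensolution_near h hρ hν hμ hv,
      RLinear.eigensolution_near_leadingOrder h hρ hν hμ⟩⟩⟩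
  · rintro (⟨μ, hμ⟩ | ⟨ρ₀, hρ₀, hρc⟩) ε hε
    · obtain ⟨e₀, he₀, hker⟩ := RLinear.exists_kernel_of_simple hμ
      exact RLinear.maxEigenvalue_of_kernel h hρ hν (half_pos (norm_pos_iff.2 hμ.1)) he₀
        (fun r C _ _ => hker r C) hε
    · obtain rfl : ρ = fun _ => (ρ₀ : ℂ) := funext hρc
      -- A ratio equal to `1` exists, so there is at least one inclusion and `|ρ₀| < 1` can be read
      -- off from `hρ k`.
      obtain ⟨k, -⟩ := hν.2
      obtain ⟨e₀, he₀, hker⟩ := RLinear.exists_kernel_of_equal_real h hν hρ₀ (hρ k)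
      exact RLinear.maxEigenvalue_of_kernel h hρ hν (half_pos (abs_pos.2 hρ₀)) he₀ hker hε
  · intro ρ₀ hρc
    obtain rfl : ρ = fun _ => (ρ₀ : ℂ) := funext hρc
    exact ⟨RLinear.matF_selfAdjoint a ρ₀ hν, RLinear.matF_isHermitian a ρ₀ hν,
      RLinear.matF_det_eq_prod a ρ₀ hν⟩
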